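/- For a positive integer $n$ let $r_3(n)$ be the number of ordered triples $(x_1,x_2,x_3)$ of positive integers with $x_1^3+x_2^3+x_3^3=n$, and let $\rho(q,a)$ be the number of solutions modulo $q$ of $l_1^3+l_2^3+l_3^3\equiv a\pmod q$. For real $x,Q$ put $$V(x,Q)=\sum_{q\le Q}\sum_{a=1}^{q}\Big|\sum_{\substack{n\le x\\ n\equiv a\,(\mathrm{mod}\,q)}}r_3(n)-\Gamma\big(\tfrac43\big)^3x\,\frac{\rho(q,a)}{q^3}\Big|^2 .$$ With $e(t)=e^{2\pi i t}$ let $S(q,c)=\sum_{m=1}^{q}e(cm^3/q)$ and $$C_0=\Gamma\big(\tfrac43\big)^6\sum_{q=1}^\infty\frac1{q^7}\sum_{\substack{c=1\\(c,q)=1}}^q|S(q,c)|^6,\qquad C_1=\Gamma\big(\tfrac43\big)^6\sum_{q=1}^\infty\frac{\log q}{q^7}\sum_{\substack{c=1\\(c,q)=1}}^q|S(q,c)|^6,$$ $$C_2=-\frac{11}{12}-2\int_1^\infty\frac{B_2(u)}{u^3}\,du,\qquad B_2(u)=\tfrac12(u-[u])^2-\tfrac12(u-[u])+\tfrac1{12},$$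 $$h(l)=\sum_{q\mid l}\frac1{q^6}\sum_{\substack{c=1\\(c,q)=1}}^q|S(q,c)|^6 ,$$ where the two series and the integral converge absolutely. Let $$A^+=\limsup_{x\to\infty}\frac{\log\sum_{n\le x}r_3(n)^2}{\log x},\qquad A^-=\liminf_{x\to\infty}\frac{\log\sum_{n\le x}r_3(n)^2}{\log x};$$ then $1\le A^-\le A^+\le 7/6$. For an integer $k\ge1$ and $x/(k+1)<Q\le x/k$ define $U_0(x,Q)$ by $$V(x,Q)=Q\sum_{n\le x}r_3(n)^2+x^2\Big(C_0\log\frac xQ+C_0C_2-C_1\Big)-\Gamma\big(\tfrac43\big)^6\sum_{l\le k}\frac{h(l)}{l}(x-lQ)^2+U_0(x,Q).$$ **Theorem 2.** Let $\varepsilon>0$. For all sufficiently large $x$ (in terms of $\varepsilon$), all integers $k\ge1$ and all real $Q$ with $x/(k+1)<Q\le x/k$ and $Q\ge x^{1/2}\log x$ (for fixed $k$ this last condition holds automatically once $x$ is large), with implied constants depending only on $\varepsilon$, $$U_0(x,Q)\ll x^{10/9+2A^+/3+\varepsilon};$$ if $A^-=A^+$, then also $$U_0(x,Q)\ll x^{10/9+\varepsilon}\Big(\sum_{n\le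 x}r_3(n)^2\Big)^{2/3};$$ and in any case $U_0(x,Q)\ll x^{17/9+\varepsilon}$. -/

import Mathlib

noncomputable section

/-- The number of ordered representations of `n` as a sum of three positive cubes
(each `x_i` with `x_i ^ 3 ≤ n` satisfies `x_i ≤ n`). -/
def r3 (n : ℕ) : ℕ :=
  ((Finset.Icc 1 n ×ˢ Finset.Icc 1 n ×ˢ Finset.Icc 1 n).filter
    (fun p => p.1 ^ 3 + p.2.1 ^ 3 + p.2.2 ^ 3 = n)).card

/-- The number of solutions of `l₁³ + l₂³ + l₃³ ≡ a (mod q)`, each `l_i` running over the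
residues `1, …, q`. -/
def rho (q a : ℕ) : ℕ :=
  ((Finset.Icc 1 q ×ˢ Finset.Icc 1 q ×ˢ Finset.Icc 1 q).filter
    (fun l => l.1 ^ 3 + l.2.1 ^ 3 + l.2.2 ^ 3 ≡ a [MOD q])).card

/-- The sum of `r3 n` over the positive integers `n ≤ x` with `n ≡ a (mod q)`. -/
def upsilon (x : ℝ) (q a : ℕ) : ℝ :=
  ∑ n ∈ (Finset.Icc 1 ⌊x⌋₊).filter (fun n => n ≡ a [MOD q]), (r3 n : ℝ)

/-- The variance `V(x, Q)`. -/
def variance3 (x Q : ℝ) : ℝ :=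
  ∑ q ∈ Finset.Icc 1 ⌊Q⌋₊, ∑ a ∈ Finset.Icc 1 q,
    |upsilon x q a - Real.Gamma (4 / 3) ^ 3 * x * ((rho q a : ℝ) / (q : ℝ) ^ 3)| ^ 2

/-- The mean square sum `∑_{n ≤ x} r3(n)²`. -/
def sumSq (x : ℝ) : ℝ := ∑ n ∈ Finset.Icc 1 ⌊x⌋₊, (r3 n : ℝ) ^ 2

/-- The upper exponent `A⁺`, as an extended real. -/
def upperExponent : EReal :=
  Filter.limsup (fun x : ℝ => ((Real.log (sumSq x) / Real.log x : ℝ) : EReal)) Filter.atTop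

/-- The lower exponent `A⁻`, as an extended real. -/
def lowerExponent : EReal :=
  Filter.liminf (fun x : ℝ => ((Real.log (sumSq x) / Real.log x : ℝ) : EReal)) Filter.atTop

/-- The cubic Gauss sum `S(q, c) = ∑_{m=1}^q e(c m³ / q)`, with `e(t) = exp(2πit)`. -/
def cubicGaussSum (q c : ℕ) : ℂ :=
  ∑ m ∈ Finset.Icc 1 q,
    Complex.exp (2 * (Real.pi : ℂ) * Complex.I * ((c : ℂ) * (m : ℂ) ^ 3 / (q : ℂ)))

/-- The sum of `|S(q, c)|⁶` over `1 ≤ c ≤ q` with `(c, q) = 1`. -/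
def gaussSixth (q : ℕ) : ℝ :=
  ∑ c ∈ (Finset.Icc 1 q).filter (fun c => Nat.Coprime c q), ‖cubicGaussSum q c‖ ^ 6

/-- `C₀`. The term `q = 0` of the series vanishes, since `gaussSixth 0` is an empty sum. -/
def constC0 : ℝ :=
  Real.Gamma (4 / 3) ^ 6 * ∑' q : ℕ, 1 / (q : ℝ) ^ 7 * gaussSixth q

/-- `C₁`. The term `q = 0` of the series vanishes, since `gaussSixth 0` is an empty sum. -/
def constC1 : ℝ :=
  Real.Gamma (4 / 3) ^ 6 * ∑' q : ℕ, Real.log (q : ℝ) / (q : ℝ) ^ 7 * gaussSixth q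

/-- Half of the periodic second Bernoulli polynomial. -/
def bernoulliHalf (u : ℝ) : ℝ :=
  1 / 2 * (u - (⌊u⌋ : ℝ)) ^ 2 - 1 / 2 * (u - (⌊u⌋ : ℝ)) + 1 / 12

/-- `C₂`. -/
def constC2 : ℝ :=
  -(11 / 12) - 2 * ∫ u in Set.Ioi (1 : ℝ), bernoulliHalf u / u ^ 3

/-- The function `h`. -/
def hFun (l : ℕ) : ℝ := ∑ q ∈ l.divisors, 1 / (q : ℝ) ^ 6 * gaussSixth q

/-- The error term `U₀(x, Q)` for `x / (k + 1) < Q ≤ x / k`. -/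
def errorU0 (k : ℕ) (x Q : ℝ) : ℝ :=
  variance3 x Q -
    (Q * sumSq x + x ^ 2 * (constC0 * Real.log (x / Q) + constC0 * constC2 - constC1)
      - Real.Gamma (4 / 3) ^ 6 *
          ∑ l ∈ Finset.Icc 1 k, hFun l / (l : ℝ) * (x - (l : ℝ) * Q) ^ 2)

end

/-! Opening the square in the variance leaves, for each q ≤ Q, the diagonal `sumSq`, a weighted
count of pairs m < n with q ∣ n - m, a cross term with `rho`, and a multiple of h(q)/q. The pairs
carry the difficulty, because q may be as large as x. Writing n - m = q l exchanges the divisors q >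
Q for complementary divisors l ≤ k with the cut-off n - m > l Q, and the same exchange with √x in
place of Q evaluates the sum over all q (`sum_pairSum_switch`). So only correlations to moduli l ≤
√x remain, each with its own cut-off.

The expected value of such a correlation is Γ(4/3)^6 h(l)/l times the number of pairs. Detecting the
congruence by characters and reducing fractions to lowest terms b/d bounds the total error by local
errors at b/d with weight about 1/d (`sum_abs_pairSum_sub_le`). The cut-off costs a kernel min(X,
1/‖t‖), whatever its position (`norm_sum_cutoff_le`). Fix R. For d ≤ R and ‖t‖ ≤ R/(dX) the
coefficients r3(n)e(nb/d) are compared with their mean, and the deviation is estimated in mean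
square over b mod d (`exists_sum_normSq_dev_le`). No bound for an individual incomplete sum is
needed: it suffices that u³ ≡ v³ (mod d) has few solutions on average over d (`summable_ncub`). This
part costs X^(4/3) R². Off these arcs the spacing of fractions shows that the kernels, weighted by
1/d, add up to about X/R at every point (`sum_kerMin_le`), so Parseval gives (X/R) ∑ r3².
Convergence of the singular series (`summable_gq`) bounds what is left of the main terms by about
X²/R. The cross term obeys the same bounds (`exists_abs_sum_r3_rho_sub_le`).

The main terms are sums of h(l)/l with weights 1 and (1 - l/√x)². They produce the constants γ and γ
- 3/2, and `constC2_eq` identifies C₂ with γ - 3/2, so they combine to the stated expression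
(`exists_abs_main_sub_le`); the sum over l ≤ k stays explicit.

With M = ∑ r3² the error X^(4/3) R² + X²/R + (X/R) M is balanced at R = M^(1/3) x^(-1/9), and M ≫ x
absorbs the middle term: this is x^(10/9) M^(2/3), up to x^ε (`exists_abs_errorU0_le`). The
definition of the upper exponent, or Hua's inequality M ≪ x^(7/6+ε) (`exists_sum_r3_sq_le`), turns
it into a power of x.

Integrals over the circle are replaced throughout by averages over the fractions j/N. Orthogonality
is exact once N exceeds the frequencies, and translation by b/d is exact when d ∣ N. -/

namespace CubeVar

open Finset

noncomputable section

/-! ### Additive characters, grid averages and truncation kernels -/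

/-- `e(t) = exp(2πit)`. -/
def e (t : ℝ) : ℂ := Complex.exp (2 * Real.pi * Complex.I * t)

lemma e_add (s t : ℝ) : e (s + t) = e s * e t := by
  simp only [e, ← Complex.exp_add]; congr 1; push_cast; ring

@[simp] lemma e_zero : e 0 = 1 := by simp [e]

@[simp] lemma norm_e (t : ℝ) : ‖e t‖ = 1 := by
  rw [e, show (2 * Real.pi * Complex.I * t : ℂ) = ((2 * Real.pi * t : ℝ) : ℂ) * Complex.I by
    push_cast; ring, Complex.norm_exp_ofReal_mul_I]

lemma e_intCast (k : ℤ) : e k = 1 := by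
  rw [e, ← Complex.exp_int_mul_two_pi_mul_I k]; congr 1; push_cast; ring

lemma e_neg (t : ℝ) : e (-t) = (starRingEnd ℂ) (e t) := by
  simp only [e, ← Complex.exp_conj]; congr 1
  simp [Complex.conj_ofNat]

lemma e_add_int (t : ℝ) (k : ℤ) : e (t + k) = e t := by rw [e_add, e_intCast, mul_one]

lemma e_sub (s t : ℝ) : e (s - t) = e s * (starRingEnd ℂ) (e t) := by
  rw [sub_eq_add_neg, e_add, e_neg]

lemma e_nat_mul (n : ℕ) (t : ℝ) : e (n * t) = e t ^ n := by
  simp only [e, ← Complex.exp_nat_mul]; congr 1; push_cast; ring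

lemma e_eq_one_iff (t : ℝ) : e t = 1 ↔ ∃ k : ℤ, t = k := by
  constructor
  · intro h
    obtain ⟨k, hk⟩ := Complex.exp_eq_one_iff.1 h
    refine ⟨k, ?_⟩
    have : (2 * Real.pi * Complex.I : ℂ) * (t : ℂ) = (2 * Real.pi * Complex.I) * (k : ℂ) := by
      rw [hk]; ring
    have h2 := mul_left_cancel₀ Complex.two_pi_I_ne_zero this
    exact_mod_cast h2
  · rintro ⟨k, rfl⟩; exact e_intCast k

lemma norm_e_sub_one_le (t : ℝ) : ‖e t - 1‖ ≤ 2 * Real.pi * |t| := by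
  rw [e, show (2 * Real.pi * Complex.I * t : ℂ) = Complex.I * ((2 * Real.pi * t : ℝ) : ℂ) by
    push_cast; ring, Complex.norm_exp_I_mul_ofReal_sub_one, Real.norm_eq_abs, abs_mul, abs_two]
  have h := Real.abs_sin_le_abs (x := 2 * Real.pi * t / 2)
  rw [abs_div, abs_mul, abs_mul, abs_two, abs_of_pos Real.pi_pos] at h
  linarith

/-- Distance to the nearest integer. -/
def nd (t : ℝ) : ℝ := |t - round t|

lemma nd_nonneg (t : ℝ) : 0 ≤ nd t := abs_nonneg _

lemma nd_le_half (t : ℝ) : nd t ≤ 1 / 2 := abs_sub_round t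

lemma nd_add_int (t : ℝ) (k : ℤ) : nd (t + k) = nd t := by
  rw [nd, nd, round_add_intCast]; congr 1; push_cast; ring

/-- Jordan's inequality for the sine, after moving t to its representative in [-1/2, 1/2]. -/
lemma four_nd_le (t : ℝ) : 4 * nd t ≤ ‖e t - 1‖ := by
  have h1 : e t = e (t - round t) := by
    conv_lhs => rw [show t = (t - round t) + (round t : ℤ) by ring, e_add_int]
  rw [h1, nd]
  have h2 := abs_sub_round t
  set s := t - round t
  rw [e, show (2 * Real.pi * Complex.I * s : ℂ) = Complex.I * ((2 * Real.pi * s : ℝ) : ℂ) by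
    push_cast; ring, Complex.norm_exp_I_mul_ofReal_sub_one, Real.norm_eq_abs, abs_mul, abs_two]
  have h3 : |2 * Real.pi * s / 2| ≤ Real.pi / 2 := by
    rw [abs_div, abs_mul, abs_mul, abs_two, abs_of_pos Real.pi_pos]
    nlinarith [Real.pi_pos]
  have h := Real.mul_abs_le_abs_sin h3
  have h4 : 2 / Real.pi * |2 * Real.pi * s / 2| = 2 * |s| := by
    rw [abs_div, abs_mul, abs_mul, abs_two, abs_of_pos Real.pi_pos]
    field_simp [Real.pi_pos.ne']
  linarith

/-- The majorant `min(X, 1/‖t‖)` of a geometric sum of length `X`. -/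
def ker (X : ℕ) (t : ℝ) : ℝ := X / max 1 (X * nd t)

lemma ker_nonneg (X : ℕ) (t : ℝ) : 0 ≤ ker X t := by
  have : (0 : ℝ) < max 1 (X * nd t) := lt_of_lt_of_le one_pos (le_max_left _ _)
  unfold ker; positivity

lemma ker_le (X : ℕ) (t : ℝ) : ker X t ≤ X :=
  div_le_self (Nat.cast_nonneg _) (le_max_left _ _)

lemma ker_mul_nd_le (X : ℕ) (t : ℝ) : ker X t * nd t ≤ 1 := by
  have : (0 : ℝ) < max 1 (X * nd t) := lt_of_lt_of_le one_pos (le_max_left _ _)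
  rw [ker, div_mul_eq_mul_div, div_le_one this]
  exact le_max_right _ _

lemma ker_add_int (X : ℕ) (t : ℝ) (k : ℤ) : ker X (t + k) = ker X t := by
  rw [ker, nd_add_int, ker]

lemma norm_sum_e_le {a b X : ℕ} (hab : b ≤ a + X) (t : ℝ) :
    ‖∑ n ∈ Ioc a b, e (n * t)‖ ≤ ker X t := by
  have hpos : (0 : ℝ) < max 1 (X * nd t) := lt_of_lt_of_le one_pos (le_max_left _ _)
  have htriv : ‖∑ n ∈ Ioc a b, e (n * t)‖ ≤ X := by
    refine (norm_sum_le _ _).trans ?_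
    simp only [norm_e, sum_const, Nat.card_Ioc, nsmul_eq_mul, mul_one]
    exact_mod_cast by omega
  rw [ker, le_div_iff₀ hpos, mul_max_of_nonneg _ _ (norm_nonneg _)]
  refine max_le (by simpa using htriv) ?_
  -- The geometric sum in telescoped form, which avoids dividing by a possibly vanishing e(t) - 1.
  have hgeo : ∀ c : ℕ, (∑ n ∈ Ioc a (a + c), e (n * t)) * (e t - 1)
      = e ((a + c + 1 : ℕ) * t) - e ((a + 1 : ℕ) * t) := by
    intro c
    induction c with
    | zero => simp
    | succ c ih =>
      rw [← add_assoc, sum_Ioc_succ_top (by omega), add_mul, ih]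
      simp only [e_nat_mul]; ring
  have hle : ‖∑ n ∈ Ioc a b, e (n * t)‖ * (4 * nd t) ≤ 2 := by
    rcases le_total b a with h | h
    · rw [Ioc_eq_empty (by omega)]; simp
    · obtain ⟨c, rfl⟩ := Nat.exists_eq_add_of_le h
      calc _ ≤ ‖∑ n ∈ Ioc a (a + c), e (n * t)‖ * ‖e t - 1‖ :=
            mul_le_mul_of_nonneg_left (four_nd_le t) (norm_nonneg _)
        _ = ‖e ((a + c + 1 : ℕ) * t) - e ((a + 1 : ℕ) * t)‖ := by rw [← norm_mul, hgeo]
        _ ≤ 2 := (norm_sub_le _ _).trans (by simp only [norm_e]; norm_num)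
  have := nd_nonneg t
  have hn := norm_nonneg (∑ n ∈ Ioc a b, e (n * t))
  nlinarith [(Nat.cast_nonneg X : (0:ℝ) ≤ X), mul_nonneg hn this]

/-- The average of `f` over the fractions `j / N`, `0 ≤ j < N`. -/
def gridAvg {E : Type*} [AddCommGroup E] [Module ℝ E] (N : ℕ) (f : ℝ → E) : E :=
  (N : ℝ)⁻¹ • ∑ j ∈ range N, f (j / N)

section gridAvg
variable {E : Type*} [AddCommGroup E] [Module ℝ E]

lemma gridAvg_add (N : ℕ) (f g : ℝ → E) :
    gridAvg N (fun t => f t + g t) = gridAvg N f + gridAvg N g := by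
  simp [gridAvg, sum_add_distrib]

lemma gridAvg_sum {ι : Type*} (N : ℕ) (s : Finset ι) (f : ι → ℝ → E) :
    gridAvg N (fun t => ∑ i ∈ s, f i t) = ∑ i ∈ s, gridAvg N (f i) := by
  simp only [gridAvg]; rw [sum_comm, smul_sum]

/-- Translation invariance of the circle survives discretization only for shifts that are multiples
of 1/N. This is why N is later taken divisible by every modulus in play. -/
lemma gridAvg_shift {N : ℕ} (hN : 0 < N) {f : ℝ → E} (hf : ∀ t, f (t + 1) = f t) (k : ℕ) :
    gridAvg N (fun t => f (t + k / N)) = gridAvg N f := by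
  have hN' : (N : ℝ) ≠ 0 := by positivity
  induction k with
  | zero => simp
  | succ k ih =>
    rw [← ih]
    simp only [gridAvg]
    congr 1
    have h := sum_range_succ' (fun j : ℕ => f ((j : ℝ) / N + k / N)) N
    rw [sum_range_succ] at h
    have h0 : f ((N : ℝ) / N + k / N) = f (((0 : ℕ) : ℝ) / N + k / N) := by
      rw [div_self hN', add_comm, hf]; simp
    rw [h0] at h
    rw [add_right_cancel h]
    refine sum_congr rfl fun j _ => ?_
    congr 1; push_cast; ring
end gridAvg

lemma gridAvg_const_mul (N : ℕ) (c : ℂ) (f : ℝ → ℂ) :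
    gridAvg N (fun t => c * f t) = c * gridAvg N f := by
  simp only [gridAvg, ← mul_sum, Algebra.mul_smul_comm]

lemma gridAvg_real_const_mul (N : ℕ) (c : ℝ) (f : ℝ → ℝ) :
    gridAvg N (fun t => c * f t) = c * gridAvg N f := by
  simp only [gridAvg, ← mul_sum, Algebra.mul_smul_comm]

lemma gridAvg_mono {N : ℕ} {f g : ℝ → ℝ} (h : ∀ t, f t ≤ g t) : gridAvg N f ≤ gridAvg N g := by
  simp only [gridAvg, smul_eq_mul]
  exact mul_le_mul_of_nonneg_left (sum_le_sum fun _ _ => h _) (by positivity)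

lemma gridAvg_nonneg {N : ℕ} {f : ℝ → ℝ} (h : ∀ t, 0 ≤ f t) : 0 ≤ gridAvg N f := by
  simp only [gridAvg, smul_eq_mul]
  exact mul_nonneg (by positivity) (sum_nonneg fun _ _ => h _)

lemma norm_gridAvg_le (N : ℕ) (f : ℝ → ℂ) : ‖gridAvg N f‖ ≤ gridAvg N (fun t => ‖f t‖) := by
  simp only [gridAvg, norm_smul, smul_eq_mul, norm_inv, Real.norm_natCast]
  exact mul_le_mul_of_nonneg_left (norm_sum_le _ _) (by positivity)

lemma gridAvg_ofReal (N : ℕ) (f : ℝ → ℝ) :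
    gridAvg N (fun t => (f t : ℂ)) = ((gridAvg N f : ℝ) : ℂ) := by
  simp [gridAvg]

lemma gridAvg_e {N : ℕ} {k : ℤ} (hk : |k| < N) :
    gridAvg N (fun t => e (k * t)) = if k = 0 then 1 else 0 := by
  have hN : 0 < N := by
    have := abs_nonneg k; omega
  have hN' : (N : ℝ) ≠ 0 := by positivity
  split_ifs with h
  · subst h; simp [gridAvg, hN.ne']
  · have h1 : ∀ j : ℕ, e ((k : ℝ) * (j / N)) = e (k / N) ^ j := by
      intro j; rw [← e_nat_mul]; congr 1; ring
    simp only [gridAvg, h1]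
    have hne : e (k / N) ≠ 1 := by
      intro he
      obtain ⟨m, hm⟩ := (e_eq_one_iff _).1 he
      rw [div_eq_iff hN'] at hm
      have hm' : k = m * N := by exact_mod_cast hm
      have : (N : ℤ) ∣ k := ⟨m, by rw [hm']; ring⟩
      exact h (Int.eq_zero_of_abs_lt_dvd this hk)
    rw [geom_sum_eq hne, ← e_nat_mul, mul_div_cancel₀ _ hN', e_intCast]
    simp

/-- The trigonometric polynomial `∑_{n ≤ X} u n e(nt)`. -/
def trig (X : ℕ) (u : ℕ → ℂ) (t : ℝ) : ℂ := ∑ n ∈ Icc 1 X, u n * e (n * t)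

lemma trig_add_one (X : ℕ) (u : ℕ → ℂ) (t : ℝ) : trig X u (t + 1) = trig X u t := by
  simp only [trig]
  refine sum_congr rfl fun n _ => ?_
  have : (n : ℝ) * (t + 1) = n * t + (n : ℤ) := by push_cast; ring
  rw [this, e_add_int]

lemma trig_shift (X : ℕ) (u : ℕ → ℂ) (β t : ℝ) :
    trig X u (t + β) = trig X (fun n => u n * e (n * β)) t := by
  simp only [trig]
  refine sum_congr rfl fun n _ => ?_
  rw [mul_add, e_add]; ring

lemma normSq_trig (X : ℕ) (u : ℕ → ℂ) (t : ℝ) :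
    ((‖trig X u t‖ ^ 2 : ℝ) : ℂ) = ∑ m ∈ Icc 1 X, ∑ n ∈ Icc 1 X,
      u n * (starRingEnd ℂ) (u m) * e (((n : ℤ) - (m : ℤ) : ℤ) * t) := by
  rw [Complex.ofReal_pow, ← Complex.mul_conj', trig, map_sum, sum_mul_sum, sum_comm]
  refine sum_congr rfl fun m _ => sum_congr rfl fun n _ => ?_
  have : (((n : ℤ) - (m : ℤ) : ℤ) : ℝ) * t = n * t - m * t := by push_cast; ring
  rw [this, e_sub, map_mul]; ring

/-- Parseval. Differences of frequencies in [1, X] are below X in absolute value, so the grid sees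
no aliasing already for N = X. -/
lemma gridAvg_normSq_trig {X N : ℕ} (hN : X ≤ N) (u : ℕ → ℂ) :
    gridAvg N (fun t => ‖trig X u t‖ ^ 2) = ∑ n ∈ Icc 1 X, ‖u n‖ ^ 2 := by
  apply Complex.ofReal_injective
  rw [← gridAvg_ofReal]
  simp only [normSq_trig, gridAvg_sum, gridAvg_const_mul]
  simp only [Complex.ofReal_sum, Complex.ofReal_pow]
  refine sum_congr rfl fun m hm => ?_
  rw [sum_eq_single_of_mem m hm]
  · simp only [mem_Icc] at hm
    rw [gridAvg_e (by rw [abs_lt]; constructor <;> omega)]; simp [Complex.mul_conj']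
  · intro n hn hnm
    simp only [mem_Icc] at hm hn
    rw [gridAvg_e (by rw [abs_lt]; constructor <;> omega), if_neg (by omega), mul_zero]

/-- The cut-off is detected by summing the orthogonality relation for n - m = h over y < h ≤ X. The
frequencies n - m - h reach almost 2X in absolute value, hence the size of N. -/
lemma sum_cutoff_eq {X N : ℕ} (hN : 2 * X < N) (u : ℕ → ℂ) (y : ℕ) :
    ∑ m ∈ Icc 1 X, ∑ n ∈ Icc 1 X, (if m + y < n then u n * (starRingEnd ℂ) (u m) else 0)
      = gridAvg N (fun t => (∑ h ∈ Ioc y X, e (h * (-t))) * ((‖trig X u t‖ ^ 2 : ℝ) : ℂ)) := by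
  have key : ∀ t : ℝ, (∑ h ∈ Ioc y X, e (h * (-t))) * ((‖trig X u t‖ ^ 2 : ℝ) : ℂ)
      = ∑ m ∈ Icc 1 X, ∑ n ∈ Icc 1 X, u n * (starRingEnd ℂ) (u m) *
        ∑ h ∈ Ioc y X, e (((n : ℤ) - (m : ℤ) - (h : ℤ) : ℤ) * t) := by
    intro t
    rw [normSq_trig, mul_sum]
    refine sum_congr rfl fun m _ => ?_
    rw [mul_sum]
    refine sum_congr rfl fun n _ => ?_
    rw [mul_sum, sum_mul]
    refine sum_congr rfl fun h _ => ?_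
    have : (((n : ℤ) - (m : ℤ) - (h : ℤ) : ℤ) : ℝ) * t
      = (((n : ℤ) - (m : ℤ) : ℤ) : ℝ) * t + h * (-t) := by push_cast; ring
    rw [this, e_add]; ring
  simp only [key, gridAvg_sum, gridAvg_const_mul]
  refine sum_congr rfl fun m hm => sum_congr rfl fun n hn => ?_
  simp only [mem_Icc] at hm hn
  have hav : ∀ h ∈ Ioc y X, gridAvg N (fun t => e (((n : ℤ) - (m : ℤ) - (h : ℤ) : ℤ) * t))
      = if h = n - m ∧ m < n then 1 else 0 := by
    intro h hh
    simp only [mem_Ioc] at hh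
    rw [gridAvg_e (by rw [abs_lt]; constructor <;> omega)]
    exact if_congr (by omega) rfl rfl
  rw [sum_congr rfl hav]
  by_cases hmn : m + y < n
  · rw [if_pos hmn, sum_eq_single_of_mem (n - m) (by simp only [mem_Ioc]; omega)]
    · simp; omega
    · intro b _ hb; simp [hb]
  · rw [if_neg hmn, sum_eq_zero, mul_zero]
    intro h hh
    simp only [mem_Ioc] at hh
    rw [if_neg (by omega)]

/-- The bound does not depend on y; this uniformity is what lets the cut-off vary with the modulus
after divisors have been switched. -/
lemma norm_sum_cutoff_le {X N : ℕ} (hN : 2 * X < N) (u : ℕ → ℂ) (y : ℕ) :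
    ‖∑ m ∈ Icc 1 X, ∑ n ∈ Icc 1 X, (if m + y < n then u n * (starRingEnd ℂ) (u m) else 0)‖
      ≤ gridAvg N (fun t => ker X t * ‖trig X u t‖ ^ 2) := by
  rw [sum_cutoff_eq hN]
  refine (norm_gridAvg_le _ _).trans (gridAvg_mono fun t => ?_)
  rw [norm_mul, Complex.norm_real, Real.norm_of_nonneg (by positivity)]
  refine mul_le_mul_of_nonneg_right ?_ (by positivity)
  have h1 : ∑ h ∈ Ioc y X, e (h * (-t)) = (starRingEnd ℂ) (∑ h ∈ Ioc y X, e (h * t)) := by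
    rw [map_sum]; refine sum_congr rfl fun h _ => ?_
    rw [← e_neg]; congr 1; ring
  rw [h1, Complex.norm_conj]
  exact norm_sum_e_le (by omega) t

/-- Partial summation against a character. -/
lemma norm_trig_le (X : ℕ) (u : ℕ → ℂ) (t : ℝ) :
    ‖trig X u t‖ ≤ ‖∑ n ∈ Icc 1 X, u n‖ +
      2 * Real.pi * |t| * ∑ z ∈ Icc 1 X, ‖∑ n ∈ Icc 1 z, u n‖ := by
  have key : ∀ X : ℕ, trig X u t = (∑ n ∈ Icc 1 X, u n) * e (X * t)
      - ∑ z ∈ range X, (∑ n ∈ Icc 1 z, u n) * (e ((z + 1 : ℕ) * t) - e (z * t)) := by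
    intro X
    induction X with
    | zero => simp [trig]
    | succ X ih =>
      rw [trig, sum_Icc_succ_top (by omega), ← trig, ih, sum_range_succ, sum_Icc_succ_top (by omega)]
      ring
  rw [key]
  refine (norm_sub_le _ _).trans ?_
  rw [norm_mul, norm_e, mul_one]
  gcongr
  refine (norm_sum_le _ _).trans ?_
  rw [mul_sum]
  have hz : ∀ z : ℕ, ‖(∑ n ∈ Icc 1 z, u n) * (e ((z + 1 : ℕ) * t) - e (z * t))‖
      ≤ 2 * Real.pi * |t| * ‖∑ n ∈ Icc 1 z, u n‖ := by
    intro z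
    have : e ((z + 1 : ℕ) * t) - e (z * t) = e (z * t) * (e t - 1) := by
      rw [mul_sub, ← e_add]; congr 2 <;> push_cast <;> ring
    rw [norm_mul, this, norm_mul, norm_e, one_mul, mul_comm]
    exact mul_le_mul_of_nonneg_right (norm_e_sub_one_le t) (norm_nonneg _)
  calc _ ≤ ∑ z ∈ range X, 2 * Real.pi * |t| * ‖∑ n ∈ Icc 1 z, u n‖ := sum_le_sum fun z _ => hz z
    _ = ∑ z ∈ (range X).filter (1 ≤ ·), 2 * Real.pi * |t| * ‖∑ n ∈ Icc 1 z, u n‖ := by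
      rw [sum_filter_of_ne]
      intro z _ hne
      by_contra h
      have : z = 0 := by omega
      subst this; simp at hne
    _ ≤ _ := by
      refine sum_le_sum_of_subset_of_nonneg ?_ fun _ _ _ => by positivity
      intro z hz
      simp only [mem_filter, mem_range, mem_Icc] at hz ⊢; omega

/-! ### Reduction of fractions and finite Fourier analysis modulo `q` -/

/-- The reduced residues `1 ≤ c ≤ d`. -/
def cop (d : ℕ) : Finset ℕ := (Icc 1 d).filter (fun c => Nat.Coprime c d)

lemma mem_cop {d c : ℕ} : c ∈ cop d ↔ (1 ≤ c ∧ c ≤ d) ∧ Nat.Coprime c d := by simp [cop]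

/-- Each fraction b/l has a unique form in lowest terms, and `hf` says that f depends on the
fraction alone. -/
lemma sum_eq_sum_divisors_cop {M : Type*} [AddCommMonoid M] (f : ℕ → ℕ → M)
    (hf : ∀ d b k, 0 < d → 0 < k → f (d * k) (b * k) = f d b) {l : ℕ} (hl : 0 < l) :
    ∑ b ∈ Icc 1 l, f l b = ∑ d ∈ l.divisors, ∑ b ∈ cop d, f d b := by
  rw [sum_sigma']
  refine sum_bij' (fun b _ => (⟨l / Nat.gcd b l, b / Nat.gcd b l⟩ : (_ : ℕ) × ℕ))
    (fun p _ => p.2 * (l / p.1)) ?_ ?_ ?_ ?_ ?_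
  · intro b hb
    simp only [mem_Icc] at hb
    have hg : 0 < Nat.gcd b l := Nat.gcd_pos_of_pos_right _ hl
    simp only [mem_sigma, Nat.mem_divisors, mem_cop]
    exact ⟨⟨Nat.div_dvd_of_dvd (Nat.gcd_dvd_right _ _), hl.ne'⟩,
      ⟨Nat.div_pos (Nat.le_of_dvd hb.1 (Nat.gcd_dvd_left _ _)) hg,
        Nat.div_le_div_right hb.2⟩, Nat.coprime_div_gcd_div_gcd hg⟩
  · rintro ⟨d, b⟩ hp
    simp only [mem_sigma, Nat.mem_divisors, mem_cop] at hp
    obtain ⟨⟨⟨k, rfl⟩, -⟩, ⟨hb1, hb2⟩, -⟩ := hp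
    have hd : 0 < d := Nat.pos_of_mul_pos_right hl
    have hk : 0 < k := Nat.pos_of_mul_pos_left hl
    simp only [mem_Icc, Nat.mul_div_cancel_left _ hd]
    exact ⟨Nat.mul_pos hb1 hk, Nat.mul_le_mul_right _ hb2⟩
  · intro b hb
    have hg : 0 < Nat.gcd b l := Nat.gcd_pos_of_pos_right _ hl
    simp only
    rw [Nat.div_div_self (Nat.gcd_dvd_right _ _) hl.ne', Nat.div_mul_cancel (Nat.gcd_dvd_left _ _)]
  · rintro ⟨d, b⟩ hp
    simp only [mem_sigma, Nat.mem_divisors, mem_cop] at hp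
    obtain ⟨⟨⟨k, rfl⟩, -⟩, ⟨hb1, hb2⟩, hc⟩ := hp
    have hd : 0 < d := Nat.pos_of_mul_pos_right hl
    have hk : 0 < k := Nat.pos_of_mul_pos_left hl
    have hgcd : Nat.gcd (b * k) (d * k) = k := by rw [Nat.gcd_mul_right, hc, one_mul]
    simp only [Nat.mul_div_cancel_left _ hd, hgcd, Nat.mul_div_cancel _ hk]
  · intro b hb
    have hg : 0 < Nat.gcd b l := Nat.gcd_pos_of_pos_right _ hl
    have := hf (l / Nat.gcd b l) (b / Nat.gcd b l) (Nat.gcd b l)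
      (Nat.div_pos (Nat.le_of_dvd hl (Nat.gcd_dvd_right _ _)) hg) hg
    rwa [Nat.div_mul_cancel (Nat.gcd_dvd_right _ _),
      Nat.div_mul_cancel (Nat.gcd_dvd_left _ _)] at this

/-- The weight `∑_{l ≤ L, d ∣ l} 1 / l`. -/
def wt (L d : ℕ) : ℝ := ∑ l ∈ (Icc 1 L).filter (d ∣ ·), (1 : ℝ) / l

lemma sum_inv_le_one_add_log (n : ℕ) : ∑ i ∈ Icc 1 n, (1 : ℝ) / i ≤ 1 + Real.log n := by
  have := harmonic_le_one_add_log n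
  rw [harmonic_eq_sum_Icc] at this
  push_cast at this
  simpa [one_div] using this

lemma wt_le {L d : ℕ} (hd : 1 ≤ d) : wt L d ≤ (1 + Real.log L) * (1 / d) := by
  have h1 : wt L d = ∑ k ∈ Icc 1 (L / d), (1 : ℝ) / (d * k : ℕ) := by
    rw [wt]
    symm
    refine sum_bij (fun k _ => d * k) ?_ ?_ ?_ ?_
    · intro k hk
      simp only [mem_Icc, mem_filter] at hk ⊢
      have := (Nat.le_div_iff_mul_le hd).1 hk.2
      exact ⟨⟨Nat.mul_pos hd hk.1, by rw [mul_comm]; exact this⟩, dvd_mul_right _ _⟩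
    · intro a _ b _ hab; exact Nat.eq_of_mul_eq_mul_left hd hab
    · intro l hl
      simp only [mem_filter, mem_Icc] at hl
      obtain ⟨⟨h1, h2⟩, k, rfl⟩ := hl
      refine ⟨k, ?_, rfl⟩
      simp only [mem_Icc]
      exact ⟨Nat.pos_of_mul_pos_left h1, (Nat.le_div_iff_mul_le hd).2 (by rwa [mul_comm])⟩
    · intros; rfl
  rw [h1]
  have h2 : ∀ k ∈ Icc 1 (L / d), (1 : ℝ) / (d * k : ℕ) = (1 / k) * (1 / d) := by
    intro k _; push_cast; rw [one_div_mul_one_div, mul_comm]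
  rw [sum_congr rfl h2, ← sum_mul]
  refine mul_le_mul_of_nonneg_right ?_ (by positivity)
  refine le_trans ?_ (sum_inv_le_one_add_log L)
  exact sum_le_sum_of_subset_of_nonneg (Icc_subset_Icc_right (Nat.div_le_self _ _))
    fun _ _ _ => by positivity

lemma sum_inv_mul_sum_divisors {L : ℕ} (f : ℕ → ℝ) :
    ∑ l ∈ Icc 1 L, (1 / (l : ℝ)) * ∑ d ∈ l.divisors, f d = ∑ d ∈ Icc 1 L, wt L d * f d := by
  simp only [mul_sum, wt, sum_mul]
  refine sum_comm' ?_
  intro l d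
  simp only [mem_Icc, Nat.mem_divisors, mem_filter]
  constructor
  · rintro ⟨⟨h1, h2⟩, hd, h0⟩
    have hp := Nat.pos_of_dvd_of_pos hd h1
    exact ⟨⟨⟨h1, h2⟩, hd⟩, hp, (Nat.le_of_dvd h1 hd).trans h2⟩
  · rintro ⟨⟨⟨h1, h2⟩, hd⟩, hp⟩
    exact ⟨⟨h1, h2⟩, hd, by omega⟩

lemma gridAvg_eq_Icc {E : Type*} [AddCommGroup E] [Module ℝ E] {q : ℕ} (hq : 0 < q) {f : ℝ → E}
    (hf : ∀ t, f (t + 1) = f t) : gridAvg q f = (q : ℝ)⁻¹ • ∑ b ∈ Icc 1 q, f (b / q) := by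
  rw [gridAvg]; congr 1
  have h1 : ∑ b ∈ Icc 1 q, f ((b : ℝ) / q) = ∑ j ∈ range q, f ((j + 1 : ℕ) / q) := by
    rw [range_eq_Ico, sum_Ico_add' (fun b : ℕ => f ((b : ℝ) / q)) 0 q 1]
    exact sum_congr (by ext; simp only [mem_Icc, mem_Ico]; omega) fun _ _ => rfl
  have h := sum_range_succ' (fun j : ℕ => f ((j : ℝ) / q)) q
  rw [sum_range_succ] at h
  have h0 : f ((q : ℝ) / q) = f (((0 : ℕ) : ℝ) / q) := by
    rw [div_self (by positivity), ← zero_add (1 : ℝ), hf]; simp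
  rw [h0] at h
  rw [h1, add_right_cancel h]

lemma sum_e_dvd {q : ℕ} (hq : 0 < q) (k : ℤ) :
    ∑ b ∈ Icc 1 q, e (k * (b / q)) = if (q : ℤ) ∣ k then (q : ℂ) else 0 := by
  have hq' : (q : ℝ) ≠ 0 := by positivity
  have hqc : (q : ℂ) ≠ 0 := by exact_mod_cast hq'
  have hper : ∀ t : ℝ, e (k * (t + 1)) = e (k * t) := by
    intro t; rw [mul_add, mul_one, e_add_int]
  have h := gridAvg_eq_Icc hq (f := fun t => e (k * t)) hper
  -- On the grid of denominator q only k mod q matters; the reduction makes the frequency small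
  -- enough for `gridAvg_e`.
  have hg : gridAvg q (fun t => e (k * t)) = gridAvg q (fun t => e (((k % q : ℤ) : ℝ) * t)) := by
    simp only [gridAvg]; congr 1
    refine sum_congr rfl fun j _ => ?_
    have : (k : ℝ) * (j / q) = ((k % q : ℤ) : ℝ) * (j / q) + ((k / q * j : ℤ) : ℝ) := by
      conv_lhs => rw [← Int.emod_add_mul_ediv k q]
      push_cast; field_simp
    rw [this, e_add_int]
  rw [hg, gridAvg_e (by
    rw [abs_of_nonneg (Int.emod_nonneg _ (by omega))]; exact Int.emod_lt_of_pos _ (by omega))] at h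
  have h2 : ∑ b ∈ Icc 1 q, e (k * (b / q)) = (q : ℂ) * (if k % q = 0 then 1 else 0) := by
    rw [h, Complex.real_smul]; push_cast; rw [mul_inv_cancel_left₀ hqc]
  rw [h2]
  simp only [Int.dvd_iff_emod_eq_zero, mul_ite, mul_one, mul_zero]

/-- `∑_{m ≤ Y} e(β m³)`. -/
def cubeSum (Y : ℕ) (β : ℝ) : ℂ := ∑ m ∈ Icc 1 Y, e ((m : ℝ) ^ 3 * β)

lemma cubicGaussSum_eq (q c : ℕ) : cubicGaussSum q c = cubeSum q (c / q) := by
  simp only [cubicGaussSum, cubeSum, e]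
  refine sum_congr rfl fun m _ => ?_
  congr 1; push_cast; ring

lemma norm_cubeSum_le (Y : ℕ) (β : ℝ) : ‖cubeSum Y β‖ ≤ Y := by
  refine (norm_sum_le _ _).trans ?_
  simp

lemma e_nat_mul_frac_congr {q m n : ℕ} (hq : 0 < q) (b : ℕ) (h : m ≡ n [MOD q]) :
    e (m * ((b : ℝ) / q)) = e (n * ((b : ℝ) / q)) := by
  obtain ⟨k, hk⟩ := (Nat.modEq_iff_dvd.1 h)
  have hq' : (q : ℝ) ≠ 0 := by positivity
  have : (n : ℝ) = m + q * k := by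
    have h' : (n : ℤ) = m + q * k := by linarith
    exact_mod_cast congrArg (Int.cast : ℤ → ℝ) h'
  have h2 : (n : ℝ) * ((b : ℝ) / q) = m * ((b : ℝ) / q) + ((k * b : ℤ) : ℝ) := by
    rw [this]; push_cast; field_simp
  rw [h2, e_add_int]

lemma cubeSum_add_period {d : ℕ} (hd : 0 < d) (b Y : ℕ) :
    cubeSum (Y + d) (b / d) = cubeSum Y (b / d) + cubicGaussSum d b := by
  induction Y with
  | zero => simp [cubicGaussSum_eq, cubeSum]
  | succ Y ih =>
    have h1 : ∀ Z : ℕ, cubeSum (Z + 1) (b / d)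
      = cubeSum Z (b / d) + e (((Z + 1) ^ 3 : ℕ) * ((b : ℝ) / d)) := by
      intro Z; rw [cubeSum, sum_Icc_succ_top (by omega), ← cubeSum]; push_cast; rfl
    rw [show Y + 1 + d = (Y + d) + 1 by ring, h1, h1, ih,
      e_nat_mul_frac_congr (m := (Y + d + 1) ^ 3) (n := (Y + 1) ^ 3) hd b]
    · ring
    · refine Nat.ModEq.pow 3 ?_
      rw [show Y + d + 1 = Y + 1 + d by ring]; exact Nat.add_modEq_right

lemma cubeSum_add_mul {d : ℕ} (hd : 0 < d) (b k s : ℕ) :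
    cubeSum (d * k + s) (b / d) = k * cubicGaussSum d b + cubeSum s (b / d) := by
  induction k with
  | zero => simp
  | succ k ih =>
    rw [show d * (k + 1) + s = (d * k + s) + d by ring, cubeSum_add_period hd, ih]
    push_cast; ring

/-- The normalized cubic Gauss sum `S(q, c) / q`. -/
def sg (q c : ℕ) : ℂ := cubicGaussSum q c / q

/-- A sum of length d k at a fraction of denominator d consists of k full periods, so the normalized
sum is a function of the fraction. -/
lemma sg_scale (d b k : ℕ) (hd : 0 < d) (hk : 0 < k) : sg (d * k) (b * k) = sg d b := by
  have hk' : (k : ℝ) ≠ 0 := by positivity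
  have hkc : (k : ℂ) ≠ 0 := by exact_mod_cast hk'
  have h1 : (((b * k : ℕ) : ℝ) / ((d * k : ℕ) : ℝ)) = (b : ℝ) / d := by
    push_cast; rw [mul_div_mul_right _ _ hk']
  rw [sg, cubicGaussSum_eq, h1]
  have h := cubeSum_add_mul hd b k 0
  rw [add_zero] at h
  rw [h, sg]
  simp only [cubeSum]; push_cast
  rw [show Icc 1 0 = (∅ : Finset ℕ) from rfl, sum_empty, add_zero, mul_comm (k : ℂ),
    mul_div_mul_right _ _ hkc]

lemma norm_sg_le_one (q c : ℕ) : ‖sg q c‖ ≤ 1 := by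
  rw [sg, norm_div, Complex.norm_natCast, cubicGaussSum_eq]
  exact div_le_one_of_le₀ (norm_cubeSum_le _ _) (Nat.cast_nonneg _)

/-- `g(q) = q⁻⁶ ∑_c |S(q, c)|⁶`. -/
def gq (q : ℕ) : ℝ := ∑ c ∈ cop q, ‖sg q c‖ ^ 6

lemma gq_nonneg (q : ℕ) : 0 ≤ gq q := sum_nonneg fun _ _ => by positivity

lemma gq_eq (q : ℕ) : gq q = 1 / (q : ℝ) ^ 6 * gaussSixth q := by
  rw [gq, gaussSixth, mul_sum]
  refine sum_congr rfl fun c _ => ?_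
  rw [sg, norm_div, Complex.norm_natCast, div_pow]; ring

lemma hFun_eq (l : ℕ) : hFun l = ∑ q ∈ l.divisors, gq q := by
  simp only [hFun, gq_eq]

/-- Sorting the fractions b/l by reduced denominator explains the divisor sum in `hFun`: it is the
full sixth moment modulo l. -/
lemma sum_norm_sg_pow_six {l : ℕ} (hl : 0 < l) : ∑ b ∈ Icc 1 l, ‖sg l b‖ ^ 6 = hFun l := by
  rw [hFun_eq, sum_eq_sum_divisors_cop (fun l b => ‖sg l b‖ ^ 6) _ hl]
  · rfl
  · intro d b k hd hk; simp only [sg_scale d b k hd hk]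

lemma sum_residues_eq {E : Type*} [AddCommMonoid E] {q : ℕ} (hq : 0 < q) (s : Finset ℕ)
    (f : ℕ → ℕ → E) (hf : ∀ n a b, a ≡ b [MOD q] → f n a = f n b) :
    ∑ a ∈ Icc 1 q, ∑ n ∈ s.filter (fun n => n ≡ a [MOD q]), f n a = ∑ n ∈ s, f n n := by
  simp only [sum_filter]
  rw [sum_comm]
  refine sum_congr rfl fun n _ => ?_
  have hex : ∃ a ∈ Icc 1 q, n ≡ a [MOD q] := by
    by_cases h : n % q = 0
    -- Representatives run over 1, …, q, so the zero class is represented by q rather than 0.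
    · exact ⟨q, by simp; omega, by simp [Nat.ModEq, h]⟩
    · exact ⟨n % q, by simp only [mem_Icc]; have := Nat.mod_lt n hq; omega, (Nat.mod_modEq n q).symm⟩
  obtain ⟨a, ha, hna⟩ := hex
  rw [sum_eq_single_of_mem a ha, if_pos hna, hf n a n hna.symm]
  intro b hb hba
  rw [if_neg]
  intro hnb
  have hab := hna.symm.trans hnb
  simp only [mem_Icc] at ha hb
  apply hba
  rcases lt_or_eq_of_le ha.2 with h1 | h1 <;> rcases lt_or_eq_of_le hb.2 with h2 | h2
  · exact (Nat.ModEq.eq_of_lt_of_lt hab h1 h2).symm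
  · subst h2
    have : b ∣ a := (Nat.modEq_zero_iff_dvd).1 (hab.trans (by simp [Nat.ModEq]))
    exact absurd (Nat.le_of_dvd ha.1 this) (by omega)
  · subst h1
    have : a ∣ b := (Nat.modEq_zero_iff_dvd).1 (hab.symm.trans (by simp [Nat.ModEq]))
    exact absurd (Nat.le_of_dvd hb.1 this) (by omega)
  · omega

lemma rho_congr {q a b : ℕ} (h : a ≡ b [MOD q]) : rho q a = rho q b := by
  unfold rho
  congr 1
  refine filter_congr fun l _ => ⟨fun h' => h'.trans h, fun h' => h'.trans h.symm⟩

lemma upsilon_congr {x : ℝ} {q a b : ℕ} (h : a ≡ b [MOD q]) : upsilon x q a = upsilon x q b := by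
  unfold upsilon
  refine sum_congr (filter_congr fun l _ => ⟨fun h' => h'.trans h, fun h' => h'.trans h.symm⟩)
    fun _ _ => rfl

lemma sum_rho_mul {q : ℕ} (hq : 0 < q) (f : ℕ → ℂ) (hf : ∀ a b, a ≡ b [MOD q] → f a = f b) :
    ∑ a ∈ Icc 1 q, (rho q a : ℂ) * f a
      = ∑ l1 ∈ Icc 1 q, ∑ l2 ∈ Icc 1 q, ∑ l3 ∈ Icc 1 q, f (l1 ^ 3 + l2 ^ 3 + l3 ^ 3) := by
  have h1 : ∀ a, (rho q a : ℂ) * f a = ∑ l1 ∈ Icc 1 q, ∑ l2 ∈ Icc 1 q, ∑ l3 ∈ Icc 1 q,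
      if l1 ^ 3 + l2 ^ 3 + l3 ^ 3 ≡ a [MOD q] then f a else 0 := by
    intro a
    rw [rho, card_filter]
    push_cast
    rw [sum_mul, sum_product]
    refine sum_congr rfl fun l1 _ => ?_
    rw [sum_product]
    refine sum_congr rfl fun l2 _ => sum_congr rfl fun l3 _ => ?_
    split_ifs <;> simp
  simp only [h1]
  rw [sum_comm]; refine sum_congr rfl fun l1 _ => ?_
  rw [sum_comm]; refine sum_congr rfl fun l2 _ => ?_
  rw [sum_comm]; refine sum_congr rfl fun l3 _ => ?_
  have := sum_residues_eq hq {l1 ^ 3 + l2 ^ 3 + l3 ^ 3} (fun _ a => f a) (fun _ a b h => hf a b h)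
  simp only [sum_filter, sum_singleton] at this
  exact this

/-- Counting sums of three cubes is a threefold convolution, so its Fourier transform is the cube of
the Gauss sum. Inversion is `rho_eq` and Parseval is `sum_rho_sq`. -/
lemma sum_rho_e {q : ℕ} (hq : 0 < q) (b : ℕ) :
    ∑ a ∈ Icc 1 q, (rho q a : ℂ) * e (a * ((b : ℝ) / q)) = cubicGaussSum q b ^ 3 := by
  rw [sum_rho_mul hq _ fun a a' h => e_nat_mul_frac_congr hq b h, cubicGaussSum_eq, cubeSum,
    pow_three, sum_mul_sum, sum_mul_sum]
  refine sum_congr rfl fun l1 _ => sum_congr rfl fun l2 _ => ?_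
  rw [mul_sum]
  refine sum_congr rfl fun l3 _ => ?_
  rw [← e_add, ← e_add]; congr 1; push_cast; ring

lemma rho_eq {q : ℕ} (hq : 0 < q) (n : ℕ) :
    (rho q n : ℂ) = (q : ℂ)⁻¹ * ∑ b ∈ Icc 1 q,
      cubicGaussSum q b ^ 3 * (starRingEnd ℂ) (e (n * ((b : ℝ) / q))) := by
  have hqc : (q : ℂ) ≠ 0 := by exact_mod_cast hq.ne'
  simp only [← sum_rho_e hq, sum_mul]
  rw [sum_comm, eq_inv_mul_iff_mul_eq₀ hqc]
  have h1 : ∀ a ∈ Icc 1 q, ∑ b ∈ Icc 1 q, (rho q a : ℂ) * e (a * ((b : ℝ) / q))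
      * (starRingEnd ℂ) (e (n * ((b : ℝ) / q)))
      = if n ≡ a [MOD q] then (q : ℂ) * rho q a else 0 := by
    intro a _
    have : ∀ b ∈ Icc 1 q, (rho q a : ℂ) * e (a * ((b : ℝ) / q))
      * (starRingEnd ℂ) (e (n * ((b : ℝ) / q))) = rho q a * e (((a - n : ℤ) : ℝ) * (b / q)) := by
      intro b _
      rw [mul_assoc, ← e_sub]; congr 2; push_cast; ring
    rw [sum_congr rfl this, ← mul_sum, sum_e_dvd hq]
    simp only [← Nat.modEq_iff_dvd]
    split_ifs <;> simp [mul_comm]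
  rw [sum_congr rfl h1]
  have := sum_residues_eq hq {n} (fun _ a => (q : ℂ) * rho q a)
    (fun _ a b h => by rw [rho_congr h])
  simp only [sum_filter, sum_singleton] at this
  exact this.symm

lemma sum_rho_sq {q : ℕ} (hq : 0 < q) :
    ∑ a ∈ Icc 1 q, (rho q a : ℝ) ^ 2 / (q : ℝ) ^ 6 = hFun q / q := by
  apply Complex.ofReal_injective
  rw [← sum_norm_sg_pow_six hq]
  push_cast
  have hqc : (q : ℂ) ≠ 0 := by exact_mod_cast hq.ne'
  have h1 : ∀ a ∈ Icc 1 q, (rho q a : ℂ) ^ 2 / (q : ℂ) ^ 6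
      = ∑ b ∈ Icc 1 q, (q : ℂ)⁻¹ * (cubicGaussSum q b ^ 3 / (q : ℂ) ^ 6) *
        (starRingEnd ℂ) ((rho q a : ℂ) * e (a * ((b : ℝ) / q))) := by
    intro a _
    rw [sq]; nth_rewrite 2 [rho_eq hq a]
    rw [mul_sum, mul_sum, sum_div]
    refine sum_congr rfl fun b _ => ?_
    rw [map_mul, Complex.conj_natCast]; ring
  rw [sum_congr rfl h1, sum_comm, sum_div]
  refine sum_congr rfl fun b _ => ?_
  rw [← mul_sum, ← map_sum, sum_rho_e hq, map_pow]
  have h2 : (‖sg q b‖ : ℂ) ^ 6 = (sg q b * (starRingEnd ℂ) (sg q b)) ^ 3 := by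
    rw [Complex.mul_conj']; ring
  rw [h2, sg, map_div₀, Complex.conj_natCast]
  field_simp

/-- `∑_{n ≤ X} r3(n) e(nβ)`. -/
def cubeGen (X : ℕ) (β : ℝ) : ℂ := trig X (fun n => (r3 n : ℂ)) β

lemma sum_r3_mul_rho {X q : ℕ} (hq : 0 < q) :
    ((∑ n ∈ Icc 1 X, (r3 n : ℝ) * (rho q n / (q : ℝ) ^ 3) : ℝ) : ℂ)
      = (q : ℂ)⁻¹ * ∑ b ∈ Icc 1 q, sg q b ^ 3 * (starRingEnd ℂ) (cubeGen X (b / q)) := by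
  have hqc : (q : ℂ) ≠ 0 := by exact_mod_cast hq.ne'
  push_cast
  simp only [cubeGen, trig, map_sum, mul_sum]
  rw [sum_comm]
  refine sum_congr rfl fun n _ => ?_
  rw [rho_eq hq, mul_sum, sum_div, mul_sum]
  refine sum_congr rfl fun b _ => ?_
  rw [map_mul, Complex.conj_natCast, sg]
  field_simp

/-- `∑ r3(m) r3(n)` over `m, n ≤ X` with `n - m > y` and `l ∣ n - m`. -/
def pairSum (X l y : ℕ) : ℝ :=
  ∑ m ∈ Icc 1 X, ∑ n ∈ Icc 1 X,
    if m + y < n ∧ m ≡ n [MOD l] then (r3 n : ℝ) * r3 m else 0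

/-- The twisted correlation `∑_{n - m > y} u(n) conj(u(m))`. -/
def corr (X y : ℕ) (u : ℕ → ℂ) : ℂ :=
  ∑ m ∈ Icc 1 X, ∑ n ∈ Icc 1 X, if m + y < n then u n * (starRingEnd ℂ) (u m) else 0

/-- The congruence is detected by characters modulo l, and the character of n - m factors into a
twist of the coefficients at n and at m. -/
lemma pairSum_eq {X l : ℕ} (hl : 0 < l) (y : ℕ) :
    (pairSum X l y : ℂ) = (l : ℂ)⁻¹ * ∑ b ∈ Icc 1 l,
      corr X y (fun n => r3 n * e (n * ((b : ℝ) / l))) := by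
  have hlc : (l : ℂ) ≠ 0 := by exact_mod_cast hl.ne'
  rw [eq_inv_mul_iff_mul_eq₀ hlc, pairSum]
  simp only [corr]
  push_cast
  conv_rhs => rw [sum_comm]
  rw [mul_sum]
  refine sum_congr rfl fun m _ => ?_
  conv_rhs => rw [sum_comm]
  rw [mul_sum]
  refine sum_congr rfl fun n _ => ?_
  by_cases h : m + y < n
  · simp only [h, true_and, if_true]
    have : ∀ b ∈ Icc 1 l, (r3 n : ℂ) * e (n * ((b : ℝ) / l))
      * (starRingEnd ℂ) ((r3 m : ℂ) * e (m * ((b : ℝ) / l)))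
      = r3 n * r3 m * e (((n - m : ℤ) : ℝ) * (b / l)) := by
      intro b _
      have h3 : (((n - m : ℤ) : ℝ) * ((b : ℝ) / l)) = n * ((b : ℝ) / l) - m * ((b : ℝ) / l) := by
        push_cast; ring
      rw [h3, e_sub, map_mul, Complex.conj_natCast]; ring
    rw [sum_congr rfl this, ← mul_sum, sum_e_dvd hl]
    simp only [← Nat.modEq_iff_dvd]
    split_ifs <;> push_cast <;> ring
  · simp [h]

/-- Squaring a sum over a class counts congruent pairs: the diagonal is the mean square, and the
pairs above and below it contribute equally. -/
lemma sum_upsilon_sq {x : ℝ} {q : ℕ} (hq : 0 < q) :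
    ∑ a ∈ Icc 1 q, upsilon x q a ^ 2 = sumSq x + 2 * pairSum ⌊x⌋₊ q 0 := by
  have h1 : ∑ a ∈ Icc 1 q, upsilon x q a ^ 2
      = ∑ n ∈ Icc 1 ⌊x⌋₊, (r3 n : ℝ) * upsilon x q n := by
    rw [← sum_residues_eq hq (Icc 1 ⌊x⌋₊) (fun n a => (r3 n : ℝ) * upsilon x q a)
      (fun n a b h => by rw [upsilon_congr h])]
    refine sum_congr rfl fun a _ => ?_
    rw [← sum_mul, sq]; rfl
  rw [h1]
  set X := ⌊x⌋₊
  have h2 : ∀ n, upsilon x q n = ∑ m ∈ Icc 1 X, if m ≡ n [MOD q] then (r3 m : ℝ) else 0 := by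
    intro n; rw [upsilon, sum_filter]
  simp only [h2, mul_sum]
  have h3 : ∀ n ∈ Icc 1 X, ∀ m ∈ Icc 1 X,
      (r3 n : ℝ) * (if m ≡ n [MOD q] then (r3 m : ℝ) else 0)
      = (if m = n then (r3 n : ℝ) ^ 2 else 0)
        + (if m + 0 < n ∧ m ≡ n [MOD q] then (r3 n : ℝ) * r3 m else 0)
        + (if n + 0 < m ∧ n ≡ m [MOD q] then (r3 m : ℝ) * r3 n else 0) := by
    intro n _ m _
    rcases lt_trichotomy m n with h | h | h
    · have h' : ¬ n < m := by omega
      simp [h, h.ne, h']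
    · subst h; simp [Nat.ModEq.refl, sq]
    · have h' : ¬ m < n := by omega
      have h4 : n ≡ m [MOD q] ↔ m ≡ n [MOD q] := ⟨fun h => h.symm, fun h => h.symm⟩
      simp [h, h.ne', h', h4, mul_comm]
  rw [sum_congr rfl fun n hn => sum_congr rfl (h3 n hn)]
  simp only [sum_add_distrib]
  have hA : ∑ n ∈ Icc 1 X, ∑ m ∈ Icc 1 X, (if m = n then (r3 n : ℝ) ^ 2 else 0) = sumSq x := by
    rw [sumSq]; refine sum_congr rfl fun n hn => ?_
    rw [sum_ite_eq' (Icc 1 X) n, if_pos hn]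
  have hB : ∑ n ∈ Icc 1 X, ∑ m ∈ Icc 1 X,
      (if m + 0 < n ∧ m ≡ n [MOD q] then (r3 n : ℝ) * r3 m else 0) = pairSum X q 0 := by
    rw [sum_comm]; rfl
  have hC : ∑ n ∈ Icc 1 X, ∑ m ∈ Icc 1 X,
      (if n + 0 < m ∧ n ≡ m [MOD q] then (r3 m : ℝ) * r3 n else 0) = pairSum X q 0 := rfl
  rw [hA, hB, hC]; ring

lemma sum_upsilon_mul_rho {x : ℝ} {q : ℕ} (hq : 0 < q) :
    ∑ a ∈ Icc 1 q, upsilon x q a * (rho q a / (q : ℝ) ^ 3)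
      = ∑ n ∈ Icc 1 ⌊x⌋₊, (r3 n : ℝ) * (rho q n / (q : ℝ) ^ 3) := by
  rw [← sum_residues_eq hq (Icc 1 ⌊x⌋₊) (fun n a => (r3 n : ℝ) * (rho q a / (q : ℝ) ^ 3))
    (fun n a b h => by rw [rho_congr h])]
  refine sum_congr rfl fun a _ => ?_
  rw [← sum_mul]; rfl

/-- The variance with the squares multiplied out. -/
lemma variance3_eq (x Q : ℝ) :
    variance3 x Q = ∑ q ∈ Icc 1 ⌊Q⌋₊, (sumSq x + 2 * pairSum ⌊x⌋₊ q 0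
      - 2 * (Real.Gamma (4 / 3) ^ 3 * x) *
          ∑ n ∈ Icc 1 ⌊x⌋₊, (r3 n : ℝ) * (rho q n / (q : ℝ) ^ 3)
      + (Real.Gamma (4 / 3) ^ 3 * x) ^ 2 * (hFun q / q)) := by
  refine sum_congr rfl fun q hq => ?_
  have hq0 : 0 < q := (mem_Icc.1 hq).1
  rw [← sum_upsilon_sq hq0, ← sum_upsilon_mul_rho hq0, ← sum_rho_sq hq0, mul_sum, mul_sum,
    ← sum_sub_distrib, ← sum_add_distrib]
  refine sum_congr rfl fun a _ => ?_
  rw [sq_abs]; ring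

/-! ### Divisor bound, cubic congruences and complete cubic sums -/

/-- Primes with p^ε ≥ 2 satisfy a + 1 ≤ 2^a ≤ p^(εa) and cost nothing; each of the boundedly many
smaller primes costs at most a factor K. -/
lemma card_divisors_le_rpow {ε : ℝ} (hε : 0 < ε) :
    ∃ C : ℝ, 1 ≤ C ∧ ∀ n : ℕ, 1 ≤ n → (n.divisors.card : ℝ) ≤ C * (n : ℝ) ^ ε := by
  have hlog : 0 < Real.log 2 := Real.log_pos (by norm_num)
  -- Chosen so that a + 1 ≤ K (1 + a ε log 2), to which Bernoulli's inequality applies together with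
  -- 1 + ε log 2 ≤ 2^ε.
  set K : ℝ := 1 + 1 / (ε * Real.log 2) with hK
  have hK1 : 1 ≤ K := by rw [hK]; have : 0 < 1 / (ε * Real.log 2) := by positivity
                         linarith
  obtain ⟨P, hP⟩ := exists_nat_ge ((2 : ℝ) ^ (1 / ε))
  refine ⟨K ^ P, one_le_pow₀ hK1, fun n hn => ?_⟩
  have hn0 : n ≠ 0 := by omega
  rw [Nat.card_divisors hn0]
  push_cast
  have hfac : (n : ℝ) ^ ε = ∏ p ∈ n.primeFactors, ((p : ℝ) ^ (n.factorization p)) ^ ε := by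
    conv_lhs => rw [← Nat.prod_factorization_pow_eq_self hn0]
    rw [Finsupp.prod, Nat.support_factorization]
    push_cast
    rw [Real.finsetProd_rpow _ _ fun i _ => by positivity]
  have hloc : ∀ p ∈ n.primeFactors, ((n.factorization p : ℝ) + 1)
      ≤ (if p < P then K else 1) * ((p : ℝ) ^ (n.factorization p)) ^ ε := by
    intro p hp
    have hp2 : (2 : ℝ) ≤ p := by exact_mod_cast (Nat.prime_of_mem_primeFactors hp).two_le
    set a := n.factorization p
    have hswap : ((p : ℝ) ^ a) ^ ε = ((p : ℝ) ^ ε) ^ a := by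
      rw [← Real.rpow_natCast, ← Real.rpow_natCast, ← Real.rpow_mul (by positivity),
        ← Real.rpow_mul (by positivity), mul_comm]
    split_ifs with h
    · have h1 : (1 : ℝ) + ε * Real.log 2 ≤ (2 : ℝ) ^ ε := by
        rw [Real.rpow_def_of_pos (by norm_num)]
        have := Real.add_one_le_exp (Real.log 2 * ε); linarith
      have h2 : (2 : ℝ) ^ ε ≤ (p : ℝ) ^ ε := Real.rpow_le_rpow (by norm_num) hp2 hε.le
      have h3 := one_add_mul_le_pow (a := ε * Real.log 2)
        (by have : 0 < ε * Real.log 2 := by positivity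
            linarith) a
      have h4 : (1 + ε * Real.log 2) ^ a ≤ ((p : ℝ) ^ ε) ^ a :=
        pow_le_pow_left₀ (by positivity) (h1.trans h2) a
      rw [hswap]
      calc (a : ℝ) + 1 ≤ K * (1 + a * (ε * Real.log 2)) := by
            rw [hK]
            have hx : 0 < ε * Real.log 2 := by positivity
            have : (1 + 1 / (ε * Real.log 2)) * (1 + a * (ε * Real.log 2))
              = 1 + a + a * (ε * Real.log 2) + 1 / (ε * Real.log 2) := by field_simp; ring
            rw [this]
            have : 0 ≤ (a : ℝ) * (ε * Real.log 2) := by positivity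
            have : 0 ≤ 1 / (ε * Real.log 2) := by positivity
            linarith
        _ ≤ _ := mul_le_mul_of_nonneg_left (h3.trans h4) (by linarith)
    · rw [one_mul, hswap]
      have h1 : (2 : ℝ) ≤ (p : ℝ) ^ ε := by
        have hPp : (2 : ℝ) ^ (1 / ε) ≤ p := hP.trans (by exact_mod_cast not_lt.1 h)
        calc (2 : ℝ) = ((2 : ℝ) ^ (1 / ε)) ^ ε := by
              rw [← Real.rpow_mul (by norm_num), one_div_mul_cancel hε.ne', Real.rpow_one]
          _ ≤ _ := Real.rpow_le_rpow (by positivity) hPp hε.le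
      calc (a : ℝ) + 1 ≤ (2 : ℝ) ^ a := by exact_mod_cast Nat.lt_two_pow_self
        _ ≤ _ := pow_le_pow_left₀ (by norm_num) h1 a
  calc ∏ p ∈ n.primeFactors, ((n.factorization p : ℝ) + 1)
      ≤ ∏ p ∈ n.primeFactors, (if p < P then K else 1) * ((p : ℝ) ^ (n.factorization p)) ^ ε :=
        prod_le_prod (fun _ _ => by positivity) hloc
    _ = (∏ p ∈ n.primeFactors, (if p < P then K else 1)) * (n : ℝ) ^ ε := by
        rw [prod_mul_distrib, hfac]
    _ ≤ K ^ P * (n : ℝ) ^ ε := by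
        refine mul_le_mul_of_nonneg_right ?_ (by positivity)
        rw [prod_ite, prod_const, prod_const_one, mul_one]
        refine pow_le_pow_right₀ hK1 ?_
        calc _ ≤ (range P).card := card_le_card fun p hp => by
                simp only [mem_filter] at hp; simpa using hp.2
          _ = P := card_range P

/-- The number of `u, v ≤ d` with `u³ ≡ v³ (mod d)`. -/
def ncub (d : ℕ) : ℕ :=
  ((Icc 1 d ×ˢ Icc 1 d).filter (fun p => p.1 ^ 3 ≡ p.2 ^ 3 [MOD d])).card

/-- Off the diagonal one may order the variables, so that d divides a positive integer and the
divisor bound becomes available once d is summed over. -/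
lemma ncub_le (d : ℕ) : (ncub d : ℝ) ≤ d + 2 * ∑ u ∈ Icc 1 d, ∑ v ∈ Ico 1 u,
    if d ∣ u ^ 3 - v ^ 3 then (1 : ℝ) else 0 := by
  rw [ncub, card_filter, sum_product]
  push_cast
  have h1 : ∀ u ∈ Icc 1 d, ∀ v ∈ Icc 1 d, (if u ^ 3 ≡ v ^ 3 [MOD d] then (1 : ℝ) else 0)
      = (if v = u then 1 else 0) + (if v < u then (if d ∣ u ^ 3 - v ^ 3 then (1 : ℝ) else 0) else 0)
        + (if u < v then (if d ∣ v ^ 3 - u ^ 3 then (1 : ℝ) else 0) else 0) := by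
    intro u _ v _
    rcases lt_trichotomy u v with h | h | h
    · have h2 := Nat.modEq_iff_dvd' (n := d) (Nat.pow_le_pow_left h.le 3)
      have h' : ¬ v < u := by omega
      simp [h, h.ne', h', h2]
    · subst h; simp [Nat.ModEq.refl]
    · have h2 := Nat.modEq_iff_dvd' (n := d) (Nat.pow_le_pow_left h.le 3)
      have h3 : u ^ 3 ≡ v ^ 3 [MOD d] ↔ v ^ 3 ≡ u ^ 3 [MOD d] := ⟨fun h => h.symm, fun h => h.symm⟩
      have h' : ¬ u < v := by omega
      simp [h, h.ne, h', h2, h3]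
  rw [sum_congr rfl fun u hu => sum_congr rfl (h1 u hu)]
  simp only [sum_add_distrib]
  have hA : ∑ u ∈ Icc 1 d, ∑ v ∈ Icc 1 d, (if v = u then (1 : ℝ) else 0) = d := by
    rw [sum_congr rfl fun u hu => by rw [sum_ite_eq' (Icc 1 d) u, if_pos hu]]; simp
  have hB : ∀ u ∈ Icc 1 d, ∑ v ∈ Icc 1 d, (if v < u then (if d ∣ u ^ 3 - v ^ 3 then (1 : ℝ) else 0)
      else 0) = ∑ v ∈ Ico 1 u, if d ∣ u ^ 3 - v ^ 3 then (1 : ℝ) else 0 := by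
    intro u hu
    rw [← sum_filter]
    refine sum_congr ?_ fun _ _ => rfl
    ext v; simp only [mem_filter, mem_Icc, mem_Ico] at hu ⊢; omega
  rw [hA, sum_congr rfl hB, sum_comm (f := fun u v => if u < v then _ else _), sum_congr rfl hB]
  linarith

/-- Interchange the summations: for given v < u the moduli d ≥ u dividing u³ - v³ are few by the
divisor bound, and each has weight at most u^(-2-ε). The roughly u values of v leave a convergent
series. This average replaces any pointwise study of cubic congruences. -/
lemma summable_ncub {ε : ℝ} (hε : 0 < ε) :
    Summable (fun d : ℕ => (ncub d : ℝ) * (d : ℝ) ^ (-2 - ε)) := by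
  -- Applied to a number below u³, the divisor bound costs u^(ε/2), half of what is available.
  obtain ⟨C, hC1, hC⟩ := card_divisors_le_rpow (ε := ε / 6) (by positivity)
  have hs1 : Summable (fun d : ℕ => (d : ℝ) ^ (-1 - ε)) :=
    Real.summable_nat_rpow.2 (by linarith)
  have hs2 : Summable (fun d : ℕ => (d : ℝ) ^ (-1 - ε / 2)) :=
    Real.summable_nat_rpow.2 (by linarith)
  refine summable_of_sum_range_le (c := (∑' d : ℕ, (d : ℝ) ^ (-1 - ε))
    + 2 * (C * ∑' d : ℕ, (d : ℝ) ^ (-1 - ε / 2))) (fun d => by positivity) fun D => ?_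
  have h0 : ∑ d ∈ range D, (ncub d : ℝ) * (d : ℝ) ^ (-2 - ε)
      ≤ ∑ d ∈ Icc 1 D, (ncub d : ℝ) * (d : ℝ) ^ (-2 - ε) := by
    calc _ = ∑ d ∈ (range D).filter (1 ≤ ·), (ncub d : ℝ) * (d : ℝ) ^ (-2 - ε) := by
          rw [sum_filter_of_ne]
          intro z _ hne
          by_contra h
          have : z = 0 := by omega
          subst this; simp [ncub] at hne
      _ ≤ _ := by
          refine sum_le_sum_of_subset_of_nonneg ?_ fun _ _ _ => by positivity
          intro z hz
          simp only [mem_filter, mem_range, mem_Icc] at hz ⊢; omega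
  refine h0.trans ?_
  have h1 : ∑ d ∈ Icc 1 D, (ncub d : ℝ) * (d : ℝ) ^ (-2 - ε) ≤ ∑ d ∈ Icc 1 D, (d : ℝ) ^ (-1 - ε)
      + 2 * ∑ d ∈ Icc 1 D, ∑ u ∈ Icc 1 d, ∑ v ∈ Ico 1 u,
        (if d ∣ u ^ 3 - v ^ 3 then (d : ℝ) ^ (-2 - ε) else 0) := by
    rw [mul_sum, ← sum_add_distrib]
    refine sum_le_sum fun d hd => ?_
    have hd1 := (mem_Icc.1 hd).1
    have hd0 : (0 : ℝ) < d := by exact_mod_cast hd1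
    refine (mul_le_mul_of_nonneg_right (ncub_le d) (by positivity)).trans (le_of_eq ?_)
    rw [add_mul, mul_assoc, sum_mul]
    simp only [sum_mul, ite_mul, one_mul, zero_mul]
    congr 1
    rw [show (-1 - ε : ℝ) = 1 + (-2 - ε) by ring, Real.rpow_add hd0, Real.rpow_one]
  refine h1.trans (add_le_add ?_ ?_)
  · exact hs1.sum_le_tsum _ fun _ _ => by positivity
  refine mul_le_mul_of_nonneg_left ?_ (by norm_num)
  have h2 : ∑ d ∈ Icc 1 D, ∑ u ∈ Icc 1 d, ∑ v ∈ Ico 1 u,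
        (if d ∣ u ^ 3 - v ^ 3 then (d : ℝ) ^ (-2 - ε) else 0)
      = ∑ u ∈ Icc 1 D, ∑ v ∈ Ico 1 u, ∑ d ∈ Icc u D,
        (if d ∣ u ^ 3 - v ^ 3 then (d : ℝ) ^ (-2 - ε) else 0) := by
    rw [sum_comm' (t' := Icc 1 D) (s' := fun u => Icc u D)]
    · exact sum_congr rfl fun u _ => sum_comm
    · intro d u; simp only [mem_Icc]; omega
  rw [h2]
  calc _ ≤ ∑ u ∈ Icc 1 D, C * (u : ℝ) ^ (-1 - ε / 2) := by
        refine sum_le_sum fun u hu => ?_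
        have hu1 := (mem_Icc.1 hu).1
        have hu0 : (0 : ℝ) < u := by exact_mod_cast hu1
        have hv : ∀ v ∈ Ico 1 u, ∑ d ∈ Icc u D,
            (if d ∣ u ^ 3 - v ^ 3 then (d : ℝ) ^ (-2 - ε) else 0)
            ≤ C * (u : ℝ) ^ (-2 - ε / 2) := by
          intro v hv
          simp only [mem_Ico] at hv
          have hlt : v ^ 3 < u ^ 3 := Nat.pow_lt_pow_left hv.2 (by norm_num)
          have hpos : 1 ≤ u ^ 3 - v ^ 3 := by omega
          rw [← sum_filter]
          calc _ ≤ ∑ d ∈ (Icc u D).filter (· ∣ u ^ 3 - v ^ 3), (u : ℝ) ^ (-2 - ε) := by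
                refine sum_le_sum fun d hd => ?_
                simp only [mem_filter, mem_Icc] at hd
                exact Real.rpow_le_rpow_of_nonpos hu0 (by exact_mod_cast hd.1.1) (by linarith)
            _ ≤ ((u ^ 3 - v ^ 3).divisors.card : ℝ) * (u : ℝ) ^ (-2 - ε) := by
                rw [sum_const, nsmul_eq_mul]
                refine mul_le_mul_of_nonneg_right ?_ (by positivity)
                have : (Icc u D).filter (· ∣ u ^ 3 - v ^ 3) ⊆ (u ^ 3 - v ^ 3).divisors := by
                  intro d hd
                  simp only [mem_filter, Nat.mem_divisors] at hd ⊢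
                  exact ⟨hd.2, by omega⟩
                exact_mod_cast card_le_card this
            _ ≤ (C * ((u : ℝ) ^ 3) ^ (ε / 6)) * (u : ℝ) ^ (-2 - ε) := by
                refine mul_le_mul_of_nonneg_right ((hC _ hpos).trans ?_) (by positivity)
                refine mul_le_mul_of_nonneg_left ?_ (by linarith)
                refine Real.rpow_le_rpow (by positivity) ?_ (by positivity)
                exact_mod_cast Nat.sub_le _ _
            _ = C * (u : ℝ) ^ (-2 - ε / 2) := by
                rw [← Real.rpow_natCast, ← Real.rpow_mul hu0.le, mul_assoc, ← Real.rpow_add hu0]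
                congr 2; push_cast; ring
        refine (sum_le_sum hv).trans ?_
        rw [sum_const, nsmul_eq_mul, Nat.card_Ico]
        have h3 : (u : ℝ) ^ (-1 - ε / 2) = u * (u : ℝ) ^ (-2 - ε / 2) := by
          rw [show (-1 - ε / 2 : ℝ) = 1 + (-2 - ε / 2) by ring, Real.rpow_add hu0, Real.rpow_one]
        rw [h3]
        have h4 : ((u - 1 : ℕ) : ℝ) ≤ u := by exact_mod_cast Nat.sub_le _ _
        have h5 : 0 ≤ C * (u : ℝ) ^ (-2 - ε / 2) := by positivity
        nlinarith
    _ = C * ∑ u ∈ Icc 1 D, (u : ℝ) ^ (-1 - ε / 2) := by rw [mul_sum]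
    _ ≤ _ := by
        refine mul_le_mul_of_nonneg_left ?_ (by linarith)
        exact hs2.sum_le_tsum _ fun _ _ => by positivity

/-- Mean square of an incomplete cubic sum over the residues modulo `d`. -/
lemma sum_normSq_cubeSum_le {d s : ℕ} (hd : 0 < d) (hs : s ≤ d) :
    ∑ b ∈ Icc 1 d, ‖cubeSum s (b / d)‖ ^ 2 ≤ d * ncub d := by
  have h1 : ((∑ b ∈ Icc 1 d, ‖cubeSum s (b / d)‖ ^ 2 : ℝ) : ℂ)
      = ∑ u ∈ Icc 1 s, ∑ v ∈ Icc 1 s, if u ^ 3 ≡ v ^ 3 [MOD d] then (d : ℂ) else 0 := by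
    push_cast
    have : ∀ b ∈ Icc 1 d, (‖cubeSum s (b / d)‖ : ℂ) ^ 2
        = ∑ u ∈ Icc 1 s, ∑ v ∈ Icc 1 s, e ((((v ^ 3 : ℕ) : ℤ) - ((u ^ 3 : ℕ) : ℤ) : ℤ) *
          ((b : ℝ) / d)) := by
      intro b _
      rw [← Complex.mul_conj', cubeSum, map_sum, sum_mul_sum, sum_comm]
      refine sum_congr rfl fun u _ => sum_congr rfl fun v _ => ?_
      rw [← e_sub]; congr 1; push_cast; ring
    rw [sum_congr rfl this, sum_comm]
    refine sum_congr rfl fun u _ => ?_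
    rw [sum_comm]
    refine sum_congr rfl fun v _ => ?_
    rw [sum_e_dvd hd]
    exact if_congr Nat.modEq_iff_dvd.symm rfl rfl
  have h2 : ∑ b ∈ Icc 1 d, ‖cubeSum s (b / d)‖ ^ 2
      = ∑ u ∈ Icc 1 s, ∑ v ∈ Icc 1 s, if u ^ 3 ≡ v ^ 3 [MOD d] then (d : ℝ) else 0 := by
    apply Complex.ofReal_injective
    rw [h1, Complex.ofReal_sum]
    refine sum_congr rfl fun u _ => ?_
    rw [Complex.ofReal_sum]
    refine sum_congr rfl fun v _ => ?_
    split_ifs <;> simp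
  rw [h2, ncub, card_filter, ← sum_product']
  push_cast
  rw [mul_sum]
  simp only [mul_ite, mul_one, mul_zero]
  refine sum_le_sum_of_subset_of_nonneg ?_ fun _ _ _ => by positivity
  exact product_subset_product (Icc_subset_Icc_right hs) (Icc_subset_Icc_right hs)

lemma sum_norm_sg_sq_le {d : ℕ} (hd : 0 < d) :
    ∑ b ∈ Icc 1 d, ‖sg d b‖ ^ 2 ≤ ncub d / d := by
  have hd' : (0 : ℝ) < d := by exact_mod_cast hd
  have h := sum_normSq_cubeSum_le hd le_rfl
  have h2 : ∀ b ∈ Icc 1 d, ‖sg d b‖ ^ 2 = ‖cubeSum d (b / d)‖ ^ 2 / (d : ℝ) ^ 2 := by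
    intro b _
    rw [sg, norm_div, Complex.norm_natCast, div_pow, cubicGaussSum_eq]
  rw [sum_congr rfl h2, ← sum_div, div_le_div_iff₀ (by positivity) hd']
  nlinarith

lemma sum_Icc_shift {E : Type*} [AddCommGroup E] {q : ℕ} (hq : 0 < q) {f : ℕ → E}
    (hf : ∀ n, f (n + q) = f n) (m : ℕ) : ∑ h ∈ Icc 1 q, f (m + h) = ∑ n ∈ Icc 1 q, f n := by
  induction m with
  | zero => simp
  | succ m ih =>
    rw [← ih]
    obtain ⟨r, rfl⟩ : ∃ r, q = r + 1 := ⟨q - 1, by omega⟩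
    have h1 : ∀ g : ℕ → E, ∑ h ∈ Icc 1 (r + 1), g h = ∑ j ∈ range (r + 1), g (j + 1) := by
      intro g
      rw [range_eq_Ico, sum_Ico_add' g 0 (r + 1) 1]
      exact sum_congr (by ext x; simp only [mem_Icc, mem_Ico]; omega) fun _ _ => rfl
    rw [h1, h1, sum_range_succ, sum_range_succ']
    rw [show m + 1 + (r + 1) = (m + 1) + (r + 1) from rfl, hf]
    congr 1
    exact sum_congr rfl fun j _ => by congr 1; ring

/-- Weyl differencing for complete cubic sums. -/
lemma norm_cubicGaussSum_pow_four_le {q c : ℕ} (hq : 0 < q) (hc : Nat.Coprime c q) :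
    ‖cubicGaussSum q c‖ ^ 4
      ≤ q ^ 2 * ((Icc 1 q ×ˢ Icc 1 q).filter (fun p => q ∣ 6 * p.1 * p.2)).card := by
  -- One differencing step for a phase P periodic modulo q. It is applied first to m³ and then to
  -- the quadratic phases that result; constant terms in m disappear under the modulus.
  have hstep : ∀ (P : ℕ → ℕ) (D : ℕ → ℕ → ℕ), (∀ m h, P (m + h) = P m + D h m) →
      (∀ m, P (m + q) ≡ P m [MOD q]) →
      ‖∑ m ∈ Icc 1 q, e ((P m : ℝ) * ((c : ℝ) / q))‖ ^ 2
        ≤ ∑ h ∈ Icc 1 q, ‖∑ m ∈ Icc 1 q, e ((D h m : ℝ) * ((c : ℝ) / q))‖ := by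
    intro P D hPD hper
    have h1 : ((‖∑ m ∈ Icc 1 q, e ((P m : ℝ) * ((c : ℝ) / q))‖ ^ 2 : ℝ) : ℂ)
        = ∑ h ∈ Icc 1 q, ∑ m ∈ Icc 1 q, e ((D h m : ℝ) * ((c : ℝ) / q)) := by
      rw [Complex.ofReal_pow, ← Complex.mul_conj', map_sum, sum_mul_sum, sum_comm]
      conv_rhs => rw [sum_comm]
      refine sum_congr rfl fun m _ => ?_
      rw [← sum_Icc_shift hq (f := fun n => e ((P n : ℝ) * ((c : ℝ) / q)) *
        (starRingEnd ℂ) (e ((P m : ℝ) * ((c : ℝ) / q)))) _ m]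
      · refine sum_congr rfl fun h _ => ?_
        rw [← e_sub, hPD]; congr 1; push_cast; ring
      · intro n; rw [e_nat_mul_frac_congr hq c (hper n)]
    have h2 := congrArg norm h1
    rw [Complex.norm_real, Real.norm_of_nonneg (by positivity)] at h2
    rw [h2]; exact norm_sum_le _ _
  have hA := hstep (fun m => m ^ 3) (fun h m => 3 * h * m ^ 2 + 3 * h ^ 2 * m + h ^ 3)
    (fun m h => by ring) (fun m => Nat.ModEq.pow 3 Nat.add_modEq_right)
  have hA' : ‖cubicGaussSum q c‖ ^ 2 ≤ ∑ h ∈ Icc 1 q,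
      ‖∑ m ∈ Icc 1 q, e (((3 * h * m ^ 2 + 3 * h ^ 2 * m : ℕ) : ℝ) * ((c : ℝ) / q))‖ := by
    rw [cubicGaussSum_eq, cubeSum]
    push_cast at hA ⊢
    refine hA.trans (le_of_eq (sum_congr rfl fun h _ => ?_))
    rw [← mul_one ‖∑ m ∈ Icc 1 q, e ((3 * (h : ℝ) * m ^ 2 + 3 * h ^ 2 * m) * ((c : ℝ) / q))‖,
      ← norm_e ((h : ℝ) ^ 3 * ((c : ℝ) / q)), ← norm_mul, sum_mul]
    congr 1
    refine sum_congr rfl fun m _ => ?_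
    rw [← e_add]; congr 1; ring
  have hB : ∀ h ∈ Icc 1 q,
      ‖∑ m ∈ Icc 1 q, e (((3 * h * m ^ 2 + 3 * h ^ 2 * m : ℕ) : ℝ) * ((c : ℝ) / q))‖ ^ 2
      ≤ ∑ k ∈ Icc 1 q, if q ∣ 6 * h * k then (q : ℝ) else 0 := by
    intro h _
    refine (hstep (fun m => 3 * h * m ^ 2 + 3 * h ^ 2 * m)
      (fun k m => 6 * h * k * m + (3 * h * k ^ 2 + 3 * h ^ 2 * k)) (fun m k => by ring)
      (fun m => Nat.ModEq.add (Nat.ModEq.mul_left _ (Nat.ModEq.pow 2 Nat.add_modEq_right))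
        (Nat.ModEq.mul_left _ Nat.add_modEq_right))).trans (sum_le_sum fun k _ => ?_)
    have h3 : ∑ m ∈ Icc 1 q, e (((6 * h * k * m + (3 * h * k ^ 2 + 3 * h ^ 2 * k) : ℕ) : ℝ) *
        ((c : ℝ) / q)) = (∑ m ∈ Icc 1 q, e (((6 * h * k * c : ℕ) : ℤ) * ((m : ℝ) / q))) *
          e (((3 * h * k ^ 2 + 3 * h ^ 2 * k : ℕ) : ℝ) * ((c : ℝ) / q)) := by
      rw [sum_mul]
      refine sum_congr rfl fun m _ => ?_
      rw [← e_add]; congr 1; push_cast; ring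
    rw [h3, norm_mul, norm_e, mul_one, sum_e_dvd hq]
    have h4 : ((q : ℤ) ∣ ((6 * h * k * c : ℕ) : ℤ)) ↔ q ∣ 6 * h * k := by
      rw [Int.natCast_dvd_natCast]
      exact ⟨fun h => (Nat.Coprime.dvd_of_dvd_mul_right hc.symm h), fun h => h.mul_right _⟩
    simp only [h4]
    split_ifs <;> simp
  calc ‖cubicGaussSum q c‖ ^ 4 = (‖cubicGaussSum q c‖ ^ 2) ^ 2 := by ring
    _ ≤ (∑ h ∈ Icc 1 q,
      ‖∑ m ∈ Icc 1 q, e (((3 * h * m ^ 2 + 3 * h ^ 2 * m : ℕ) : ℝ) * ((c : ℝ) / q))‖) ^ 2 :=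
        pow_le_pow_left₀ (by positivity) hA' 2
    _ ≤ (Icc 1 q).card * ∑ h ∈ Icc 1 q,
      ‖∑ m ∈ Icc 1 q, e (((3 * h * m ^ 2 + 3 * h ^ 2 * m : ℕ) : ℝ) * ((c : ℝ) / q))‖ ^ 2 :=
        sq_sum_le_card_mul_sum_sq
    _ ≤ q * ∑ h ∈ Icc 1 q, ∑ k ∈ Icc 1 q, if q ∣ 6 * h * k then (q : ℝ) else 0 := by
        rw [Nat.card_Icc, Nat.add_sub_cancel]
        exact mul_le_mul_of_nonneg_left (sum_le_sum hB) (by positivity)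
    _ = _ := by
        rw [card_filter, ← sum_product']
        push_cast
        rw [mul_sum, mul_sum]
        refine sum_congr rfl fun p _ => ?_
        split_ifs <;> ring

/-- Write 6hk = qj with j ≤ 6q. Then h is a divisor of qj and determines k, so the divisor bound
applies for each j. -/
lemma card_dvd_six_mul_le {δ : ℝ} (hδ : 0 < δ) : ∃ C : ℝ, 0 < C ∧ ∀ q : ℕ, 0 < q →
    (((Icc 1 q ×ˢ Icc 1 q).filter (fun p => q ∣ 6 * p.1 * p.2)).card : ℝ)
      ≤ C * (q : ℝ) ^ (1 + δ) := by
  obtain ⟨C, hC1, hC⟩ := card_divisors_le_rpow (ε := δ / 2) (by positivity)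
  refine ⟨6 * (C * 6 ^ (δ / 2)), by positivity, fun q hq => ?_⟩
  have hq0 : (0 : ℝ) < q := by exact_mod_cast hq
  have hsub : (Icc 1 q ×ˢ Icc 1 q).filter (fun p => q ∣ 6 * p.1 * p.2)
      ⊆ (Icc 1 (6 * q)).biUnion fun j => (q * j).divisors.image fun h => (h, q * j / (6 * h)) := by
    rintro ⟨h, k⟩ hp
    simp only [mem_filter, mem_product, mem_Icc] at hp
    obtain ⟨⟨⟨h1, h2⟩, k1, k2⟩, j, hj⟩ := hp
    simp only [mem_biUnion, mem_Icc, mem_image, Nat.mem_divisors, Prod.mk.injEq]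
    have hj0 : 0 < q * j := by rw [← hj]; positivity
    refine ⟨j, ⟨Nat.pos_of_mul_pos_left hj0, ?_⟩, h, ⟨⟨6 * k, by rw [← hj]; ring⟩, hj0.ne'⟩, rfl, ?_⟩
    · by_contra hlt
      have : q * j > q * (6 * q) := Nat.mul_lt_mul_of_pos_left (not_le.1 hlt) hq
      have : 6 * h * k ≤ 6 * q * q := Nat.mul_le_mul (Nat.mul_le_mul_left _ h2) k2
      nlinarith
    · rw [← hj]; exact Nat.mul_div_cancel_left _ (by positivity)
  have hcard : (((Icc 1 q ×ˢ Icc 1 q).filter (fun p => q ∣ 6 * p.1 * p.2)).card : ℝ)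
      ≤ ∑ j ∈ Icc 1 (6 * q), ((q * j).divisors.card : ℝ) := by
    refine (Nat.cast_le.2 ((card_le_card hsub).trans card_biUnion_le)).trans ?_
    push_cast
    exact sum_le_sum fun j _ => by exact_mod_cast card_image_le
  refine hcard.trans ?_
  calc _ ≤ ∑ j ∈ Icc 1 (6 * q), C * ((6 : ℝ) ^ (δ / 2) * (q : ℝ) ^ δ) := by
        refine sum_le_sum fun j hj => ?_
        simp only [mem_Icc] at hj
        refine (hC _ (Nat.mul_pos hq hj.1)).trans (mul_le_mul_of_nonneg_left ?_ (by linarith))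
        calc (((q * j : ℕ) : ℝ)) ^ (δ / 2) ≤ (6 * (q : ℝ) ^ (2 : ℝ)) ^ (δ / 2) := by
              refine Real.rpow_le_rpow (by positivity) ?_ (by positivity)
              have : (j : ℝ) ≤ 6 * q := by exact_mod_cast hj.2
              push_cast
              rw [Real.rpow_two]; nlinarith
          _ = _ := by
              rw [Real.mul_rpow (by norm_num) (by positivity), ← Real.rpow_mul hq0.le]
              congr 2; ring
    _ = _ := by
        rw [sum_const, Nat.card_Icc, nsmul_eq_mul, Real.rpow_add hq0, Real.rpow_one]
        push_cast; ring

/-- Four of the six factors are estimated by Weyl differencing, the remaining two in mean square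
over the residues. -/
lemma gq_le_ncub {δ : ℝ} (hδ : 0 < δ) : ∃ C : ℝ, 0 < C ∧ ∀ q : ℕ, 0 < q →
    gq q ≤ C * (q : ℝ) ^ (-2 + δ) * ncub q := by
  obtain ⟨C, hC0, hC⟩ := card_dvd_six_mul_le hδ
  refine ⟨C, hC0, fun q hq => ?_⟩
  have hq0 : (0 : ℝ) < q := by exact_mod_cast hq
  have h1 : ∀ c ∈ cop q, ‖sg q c‖ ^ 6 ≤ C * (q : ℝ) ^ (-1 + δ) * ‖sg q c‖ ^ 2 := by
    intro c hc
    have h2 : ‖sg q c‖ ^ 4 ≤ C * (q : ℝ) ^ (-1 + δ) := by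
      rw [sg, norm_div, Complex.norm_natCast, div_pow, div_le_iff₀ (by positivity)]
      refine (norm_cubicGaussSum_pow_four_le hq (mem_cop.1 hc).2).trans ?_
      have h3 : (q : ℝ) ^ (-1 + δ) * (q : ℝ) ^ 4 = (q : ℝ) ^ 2 * (q : ℝ) ^ (1 + δ) := by
        rw [← Real.rpow_natCast, ← Real.rpow_natCast, ← Real.rpow_add hq0, ← Real.rpow_add hq0]
        congr 1; push_cast; ring
      rw [mul_assoc, h3]
      have := mul_le_mul_of_nonneg_left (hC q hq) (sq_nonneg (q : ℝ))
      linarith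
    calc ‖sg q c‖ ^ 6 = ‖sg q c‖ ^ 4 * ‖sg q c‖ ^ 2 := by ring
      _ ≤ _ := mul_le_mul_of_nonneg_right h2 (by positivity)
  calc gq q ≤ ∑ c ∈ cop q, C * (q : ℝ) ^ (-1 + δ) * ‖sg q c‖ ^ 2 := sum_le_sum h1
    _ ≤ C * (q : ℝ) ^ (-1 + δ) * ∑ c ∈ Icc 1 q, ‖sg q c‖ ^ 2 := by
        rw [← mul_sum]
        refine mul_le_mul_of_nonneg_left ?_ (by positivity)
        exact sum_le_sum_of_subset_of_nonneg (filter_subset _ _) fun _ _ _ => by positivity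
    _ ≤ C * (q : ℝ) ^ (-1 + δ) * (ncub q / q) :=
        mul_le_mul_of_nonneg_left (sum_norm_sg_sq_le hq) (by positivity)
    _ = _ := by
        rw [show (-1 + δ : ℝ) = 1 + (-2 + δ) by ring, Real.rpow_add hq0, Real.rpow_one]
        field_simp

lemma summable_gq {δ : ℝ} (hδ : 0 < δ) : Summable (fun q : ℕ => gq q * (q : ℝ) ^ (-δ)) := by
  obtain ⟨C, hC0, hC⟩ := gq_le_ncub (δ := δ / 2) (by positivity)
  refine Summable.of_nonneg_of_le (fun q => mul_nonneg (gq_nonneg q) (by positivity)) ?_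
    ((summable_ncub (ε := δ / 2) (by positivity)).mul_left C)
  intro q
  rcases Nat.eq_zero_or_pos q with rfl | hq
  · simp [gq, cop, ncub]
  have hq0 : (0 : ℝ) < q := by exact_mod_cast hq
  calc gq q * (q : ℝ) ^ (-δ) ≤ (C * (q : ℝ) ^ (-2 + δ / 2) * ncub q) * (q : ℝ) ^ (-δ) :=
        mul_le_mul_of_nonneg_right (hC q hq) (by positivity)
    _ = C * (ncub q * ((q : ℝ) ^ (-2 + δ / 2) * (q : ℝ) ^ (-δ))) := by ring
    _ = _ := by rw [← Real.rpow_add hq0]; congr 3; ring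

/-! ### The weight of reduced fractions off the major arcs -/

/-- The kernel `ker X`, removed from the major arc `d ≤ R`, `‖t‖ ≤ R / (dX)`. -/
def kerMin (X : ℕ) (R : ℝ) (d : ℕ) (t : ℝ) : ℝ :=
  if (d : ℝ) ≤ R ∧ nd t ≤ R / (d * X) then 0 else ker X t

lemma kerMin_nonneg (X : ℕ) (R : ℝ) (d : ℕ) (t : ℝ) : 0 ≤ kerMin X R d t := by
  unfold kerMin; split_ifs
  · exact le_rfl
  · exact ker_nonneg _ _

lemma kerMin_add_int (X : ℕ) (R : ℝ) (d : ℕ) (t : ℝ) (k : ℤ) :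
    kerMin X R d (t + k) = kerMin X R d t := by
  rw [kerMin, nd_add_int, ker_add_int, kerMin]

lemma kerMin_of_lt {X : ℕ} {R : ℝ} {d : ℕ} (h : R < d) (t : ℝ) : kerMin X R d t = ker X t := by
  rw [kerMin, if_neg (fun h' => absurd h'.1 (not_le.2 h))]

lemma kerMin_le_ker (X : ℕ) (R : ℝ) (d : ℕ) (t : ℝ) : kerMin X R d t ≤ ker X t := by
  unfold kerMin; split_ifs
  · exact ker_nonneg _ _
  · exact le_rfl

lemma ker_le_of_nd {X : ℕ} {t c : ℝ} (hc : 0 < c) (h : c ≤ nd t) : ker X t ≤ 1 / c := by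
  have h1 := ker_mul_nd_le X t
  rw [le_div_iff₀ hc]
  exact (mul_le_mul_of_nonneg_left h (ker_nonneg X t)).trans h1

/-- The shape of the major arcs is made for this: outside them either d > R or ‖t‖ > R/(dX), and
both give X/R after weighting by 1/d. -/
lemma kerMin_div_le {X d : ℕ} {R : ℝ} (hX : 0 < X) (hd : 0 < d) (hR : 0 < R) (t : ℝ) :
    1 / (d : ℝ) * kerMin X R d t ≤ X / R := by
  have hd' : (0 : ℝ) < d := by exact_mod_cast hd
  have hX' : (0 : ℝ) < X := by exact_mod_cast hX
  rw [kerMin]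
  split_ifs with h
  · rw [mul_zero]; positivity
  · rw [not_and_or, not_le, not_le] at h
    rw [one_div_mul_eq_div]
    rcases h with h | h
    · exact div_le_div₀ hX'.le (ker_le X t) hR h.le
    · rw [div_le_iff₀ hd']
      refine (ker_le_of_nd (by positivity) h.le).trans (le_of_eq ?_)
      field_simp

/-- Distinct reduced fractions with denominators in [D, 2D) differ by more than 1/(4D²) modulo 1.
Cut the line on both sides of α into boxes of that length: each holds at most one fraction, the two
boxes touching α cost X/R each, and the n-th box beyond costs 4D/n. -/
lemma sum_kerMin_block_le {X D : ℕ} {R : ℝ} (hX : 0 < X) (hD : 0 < D) (hR : 0 < R) (α : ℝ) :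
    ∑ d ∈ Ico D (2 * D), ∑ b ∈ cop d, 1 / (d : ℝ) * kerMin X R d (α - b / d)
      ≤ 2 * (X / R) + 8 * D * (1 + Real.log (2 * D ^ 2)) := by
  have hD' : (0 : ℝ) < D := by exact_mod_cast hD
  have hX' : (0 : ℝ) < X := by exact_mod_cast hX
  set ψ : ℕ → ℝ := fun n => if n = 0 then X / R else 4 * D / n with hψ
  have hψ0 : ∀ n, 0 ≤ ψ n := by intro n; simp only [hψ]; split_ifs <;> positivity
  set β : (_ : ℕ) × ℕ → ℝ := fun p => α - p.2 / p.1 with hβ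
  set s : (_ : ℕ) × ℕ → ℤ := fun p => ⌊4 * (D : ℝ) ^ 2 * (β p - round (β p))⌋ with hs
  -- The side of α and the number of the box. On the negative side the shift by one makes the box
  -- next to α have number 0 as well.
  set G : (_ : ℕ) × ℕ → Bool × ℕ := fun p =>
    if 0 ≤ s p then (true, (s p).toNat) else (false, (-s p - 1).toNat) with hG
  have hnd : ∀ p, ((G p).2 : ℝ) ≤ 4 * (D : ℝ) ^ 2 * nd (β p) := by
    intro p
    have h1 := Int.floor_le (4 * (D : ℝ) ^ 2 * (β p - round (β p)))
    have h2 := Int.lt_floor_add_one (4 * (D : ℝ) ^ 2 * (β p - round (β p)))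
    simp only [nd]
    have hp : (0 : ℝ) < 4 * (D : ℝ) ^ 2 := by positivity
    simp only [hG]
    split_ifs with h
    · have h3 : (((s p).toNat : ℕ) : ℝ) = (s p : ℝ) := by
        exact_mod_cast Int.toNat_of_nonneg h
      simp only; rw [h3]
      exact h1.trans (mul_le_mul_of_nonneg_left (le_abs_self _) hp.le)
    · have h3 : (((-s p - 1).toNat : ℕ) : ℝ) = -(s p : ℝ) - 1 := by
        have : (((-s p - 1).toNat : ℕ) : ℤ) = -s p - 1 := Int.toNat_of_nonneg (by omega)
        exact_mod_cast congrArg (Int.cast : ℤ → ℝ) this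
      simp only; rw [h3]
      have h4 := mul_le_mul_of_nonneg_left (neg_abs_le (β p - round (β p))) hp.le
      simp only [hs] at *
      linarith
  have hmem : ∀ p : (_ : ℕ) × ℕ, G p ∈ (univ : Finset Bool) ×ˢ range (2 * D ^ 2 + 1) := by
    intro p
    simp only [mem_product, mem_univ, true_and, mem_range]
    have h1 := (hnd p).trans (mul_le_mul_of_nonneg_left (nd_le_half (β p))
      (by positivity : (0 : ℝ) ≤ 4 * (D : ℝ) ^ 2))
    have h2 : ((G p).2 : ℝ) ≤ ((2 * D ^ 2 : ℕ) : ℝ) := by push_cast; linarith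
    have : (G p).2 ≤ 2 * D ^ 2 := by exact_mod_cast h2
    omega
  have hterm : ∀ p ∈ (Ico D (2 * D)).sigma cop,
      1 / (p.1 : ℝ) * kerMin X R p.1 (β p) ≤ ψ (G p).2 := by
    intro p hp
    simp only [mem_sigma, mem_Ico] at hp
    have hd : 0 < p.1 := by omega
    by_cases h0 : (G p).2 = 0
    · simp only [hψ, h0, if_true]
      exact kerMin_div_le hX hd hR _
    · simp only [hψ, h0, if_false]
      have hn : (0 : ℝ) < (G p).2 := by exact_mod_cast Nat.pos_of_ne_zero h0
      have h1 : ((G p).2 : ℝ) / (4 * (D : ℝ) ^ 2) ≤ nd (β p) := by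
        rw [div_le_iff₀ (by positivity)]; linarith [hnd p]
      have h2 := (kerMin_le_ker X R p.1 (β p)).trans (ker_le_of_nd (by positivity) h1)
      have h3 : 1 / (p.1 : ℝ) ≤ 1 / D :=
        one_div_le_one_div_of_le hD' (by exact_mod_cast hp.1.1)
      calc _ ≤ 1 / (D : ℝ) * (1 / ((G p).2 / (4 * (D : ℝ) ^ 2))) :=
            mul_le_mul h3 h2 (kerMin_nonneg _ _ _ _) (by positivity)
        _ = _ := by field_simp
  have hinj : Set.InjOn G ((Ico D (2 * D)).sigma cop : Finset ((_ : ℕ) × ℕ)) := by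
    rintro ⟨d, b⟩ hp ⟨d', b'⟩ hp' hEq
    simp only [coe_sigma, Set.mem_sigma_iff, mem_coe, mem_Ico, mem_cop] at hp hp'
    obtain ⟨⟨hd1, hd2⟩, ⟨hb1, hb2⟩, hbc⟩ := hp
    obtain ⟨⟨hd1', hd2'⟩, ⟨hb1', hb2'⟩, hbc'⟩ := hp'
    have hss : s ⟨d, b⟩ = s ⟨d', b'⟩ := by
      simp only [hG] at hEq
      split_ifs at hEq with h1 h2 h2
      · have := (Prod.ext_iff.1 hEq).2; simp only at this; omega
      · exact absurd (Prod.ext_iff.1 hEq).1 (by simp)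
      · exact absurd (Prod.ext_iff.1 hEq).1 (by simp)
      · have := (Prod.ext_iff.1 hEq).2; simp only at this; omega
    have hclose := Int.abs_sub_lt_one_of_floor_eq_floor hss
    set r := round (β ⟨d, b⟩)
    set r' := round (β ⟨d', b'⟩)
    have hd0 : (0 : ℝ) < d := by exact_mod_cast (by omega : 0 < d)
    have hd0' : (0 : ℝ) < d' := by exact_mod_cast (by omega : 0 < d')
    -- The numerator of the difference of the two fractions, lifted near α. It is an integer below 1
    -- in absolute value, and hence zero when the boxes coincide.
    set k : ℤ := (b' + r' * d') * d - (b + r * d) * d' with hk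
    have hkr : (k : ℝ) = d * d' * ((β ⟨d, b⟩ - r) - (β ⟨d', b'⟩ - r')) := by
      simp only [hβ, hk]; push_cast; field_simp; ring
    have hk0 : k = 0 := by
      rw [← Int.abs_lt_one_iff]
      have h1 : |(k : ℝ)| < 1 := by
        rw [hkr, abs_mul, abs_of_pos (by positivity : (0 : ℝ) < d * d')]
        rw [← mul_sub, abs_mul, abs_of_pos (by positivity : (0 : ℝ) < 4 * (D : ℝ) ^ 2)] at hclose
        refine lt_of_le_of_lt (mul_le_mul_of_nonneg_right ?_ (abs_nonneg _)) hclose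
        have e1 : (d : ℝ) ≤ 2 * D := by exact_mod_cast hd2.le
        have e2 : (d' : ℝ) ≤ 2 * D := by exact_mod_cast hd2'.le
        nlinarith
      exact_mod_cast h1
    have hkey : ((b' : ℤ) + r' * d') * d = (b + r * d) * d' := by
      rw [hk] at hk0; linarith
    have hc1 : IsCoprime ((b : ℤ) + r * d) d := by
      have := Nat.isCoprime_iff_coprime.2 hbc
      exact (IsCoprime.add_mul_right_left this r)
    have hc2 : IsCoprime ((b' : ℤ) + r' * d') d' := by
      have := Nat.isCoprime_iff_coprime.2 hbc'
      exact (IsCoprime.add_mul_right_left this r')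
    have hdd : (d : ℤ) ∣ d' := hc1.symm.dvd_of_dvd_mul_left (Dvd.intro_left _ hkey)
    have hdd' : (d' : ℤ) ∣ d := hc2.symm.dvd_of_dvd_mul_left (Dvd.intro_left _ hkey.symm)
    have hdeq : d = d' := Nat.dvd_antisymm (Int.natCast_dvd_natCast.1 hdd)
      (Int.natCast_dvd_natCast.1 hdd')
    subst hdeq
    have hdz : (d : ℤ) ≠ 0 := by omega
    have hbb : (b' : ℤ) + r' * d = b + r * d := mul_right_cancel₀ hdz hkey
    have hdvd : (d : ℤ) ∣ (b' : ℤ) - b := ⟨r - r', by linarith⟩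
    have hzero : (b' : ℤ) - b = 0 := by
      refine Int.eq_zero_of_abs_lt_dvd hdvd ?_
      rw [abs_lt]; constructor <;> omega
    have : b = b' := by omega
    subst this; rfl
  rw [sum_sigma']
  calc _ ≤ ∑ p ∈ (Ico D (2 * D)).sigma cop, ψ (G p).2 := sum_le_sum hterm
    _ = ∑ z ∈ ((Ico D (2 * D)).sigma cop).image G, ψ z.2 := by rw [sum_image hinj]
    _ ≤ ∑ z ∈ (univ : Finset Bool) ×ˢ range (2 * D ^ 2 + 1), ψ z.2 := by
        refine sum_le_sum_of_subset_of_nonneg ?_ fun _ _ _ => hψ0 _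
        intro z hz
        obtain ⟨p, -, rfl⟩ := mem_image.1 hz
        exact hmem p
    _ = 2 * (X / R + ∑ n ∈ (Icc 1 (2 * D ^ 2) : Finset ℕ), 4 * (D : ℝ) / (n : ℝ)) := by
        rw [sum_product]
        simp only [sum_const, card_univ, Fintype.card_bool, nsmul_eq_mul]
        rw [sum_range_succ']
        have : ∑ n ∈ (Icc 1 (2 * D ^ 2) : Finset ℕ), 4 * (D : ℝ) / (n : ℝ) = ∑ j ∈ range (2 * D ^ 2), ψ (j + 1) := by
          rw [range_eq_Ico, sum_Ico_add' ψ 0 (2 * D ^ 2) 1]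
          refine sum_congr (by ext x; simp only [mem_Icc, mem_Ico]; omega) fun n hn => ?_
          simp only [mem_Ico] at hn
          simp only [hψ]; rw [if_neg (by omega)]
        rw [this]; simp only [hψ, if_true]; push_cast; ring
    _ ≤ _ := by
        have h1 := sum_inv_le_one_add_log (2 * D ^ 2)
        have h2 : ∑ n ∈ (Icc 1 (2 * D ^ 2) : Finset ℕ), 4 * (D : ℝ) / (n : ℝ)
            = 4 * D * ∑ n ∈ (Icc 1 (2 * D ^ 2) : Finset ℕ), (1 : ℝ) / (n : ℝ) := by
          rw [mul_sum]; exact sum_congr rfl fun _ _ => by ring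
        rw [h2]
        push_cast at h1
        have := mul_le_mul_of_nonneg_left h1 (by positivity : (0 : ℝ) ≤ 4 * D)
        linarith

/-- Dyadic decomposition in d. There are O(log X) blocks, and L² ≤ X keeps the logarithm within a
block below a multiple of 1 + log X. The bound is pointwise in α, so it serves both for averages
over the circle and, by duality, for the large sieve. -/
lemma sum_kerMin_le {X L : ℕ} {R : ℝ} (hL : 1 ≤ L) (hLX : L ^ 2 ≤ X) (hR : 0 < R) (α : ℝ) :
    ∑ d ∈ Icc 1 L, 1 / (d : ℝ) * ∑ b ∈ cop d, kerMin X R d (α - b / d)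
      ≤ 64 * (1 + Real.log X) ^ 2 * (X / R + L) := by
  have hX : 0 < X := lt_of_lt_of_le (by positivity) hLX
  have hX1 : (1 : ℝ) ≤ X := by exact_mod_cast hX
  have hlX : 0 ≤ Real.log X := Real.log_nonneg hX1
  set lam := 1 + Real.log X with hlam
  have hlam1 : 1 ≤ lam := by linarith
  simp only [mul_sum]
  set f : ℕ → ℝ := fun d => ∑ b ∈ cop d, 1 / (d : ℝ) * kerMin X R d (α - b / d) with hf
  have hf0 : ∀ d, 0 ≤ f d := fun d => sum_nonneg fun _ _ =>
    mul_nonneg (by positivity) (kerMin_nonneg _ _ _ _)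
  set I := Nat.log 2 L with hI
  have hcover : Icc 1 L ⊆ (range (I + 1)).biUnion fun i => Ico (2 ^ i) (2 * 2 ^ i) := by
    intro d hd
    simp only [mem_Icc] at hd
    simp only [mem_biUnion, mem_range, mem_Ico]
    refine ⟨Nat.log 2 d, ?_, Nat.pow_log_le_self 2 (by omega), ?_⟩
    · have := Nat.log_mono_right (b := 2) hd.2; omega
    · have := Nat.lt_pow_succ_log_self (b := 2) (by norm_num) d
      rw [pow_succ] at this; omega
  have hlogI : ((I + 1 : ℕ) : ℝ) ≤ 2 * lam := by
    have h1 : (2 : ℝ) ^ I ≤ X := by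
      have h2 : 2 ^ I ≤ L := Nat.pow_log_le_self 2 (by omega)
      have h3 : 2 ^ I ≤ X := by nlinarith
      exact_mod_cast h3
    have h4 := Real.log_le_log (by positivity) h1
    rw [Real.log_pow] at h4
    have h5 := Real.log_two_gt_d9
    push_cast
    have h6 : (0 : ℝ) ≤ I := Nat.cast_nonneg _
    nlinarith
  calc ∑ d ∈ Icc 1 L, f d ≤ ∑ d ∈ (range (I + 1)).biUnion fun i => Ico (2 ^ i) (2 * 2 ^ i), f d :=
        sum_le_sum_of_subset_of_nonneg hcover fun _ _ _ => hf0 _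
    _ ≤ ∑ i ∈ range (I + 1), ∑ d ∈ Ico (2 ^ i) (2 * 2 ^ i), f d := by
        rw [sum_biUnion]
        intro i _ j _ hij
        rw [Function.onFun, disjoint_left]
        intro d hd hd'
        simp only [mem_Ico, ← pow_succ'] at hd hd'
        apply hij
        have h1 := Nat.log_eq_of_pow_le_of_lt_pow hd.1 hd.2
        have h2 := Nat.log_eq_of_pow_le_of_lt_pow hd'.1 hd'.2
        omega
    _ ≤ ∑ i ∈ range (I + 1), (32 * lam * (X / R + L)) := by
        refine sum_le_sum fun i hi => ?_
        have hiI : i ≤ I := by simp only [mem_range] at hi; omega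
        have h2 : 2 ^ i ≤ L := (Nat.pow_le_pow_right (by norm_num) hiI).trans
          (Nat.pow_log_le_self 2 (by omega))
        refine (sum_kerMin_block_le hX (by positivity) hR α).trans ?_
        have h3 : ((2 ^ i : ℕ) : ℝ) ≤ L := by exact_mod_cast h2
        have h4 : Real.log (2 * ((2 ^ i : ℕ) : ℝ) ^ 2) ≤ 1 + Real.log X := by
          have h5 : (((2 ^ i : ℕ) : ℝ) ^ 2) ≤ X := by
            have : (2 ^ i) ^ 2 ≤ X := (Nat.pow_le_pow_left h2 2).trans hLX
            exact_mod_cast this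
          rw [Real.log_mul (by norm_num) (by positivity)]
          have := Real.log_le_log (by positivity) h5
          have := Real.log_two_lt_d9
          linarith
        have h6 : 0 ≤ (X : ℝ) / R := by positivity
        have h7 : (0 : ℝ) ≤ ((2 ^ i : ℕ) : ℝ) := by positivity
        have h8 : 8 * ((2 ^ i : ℕ) : ℝ) * (1 + Real.log (2 * ((2 ^ i : ℕ) : ℝ) ^ 2))
            ≤ 8 * L * (2 * lam) := by
          refine mul_le_mul (by linarith) (by linarith) ?_ (by positivity)
          have : 0 ≤ Real.log (2 * ((2 ^ i : ℕ) : ℝ) ^ 2) := by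
            apply Real.log_nonneg
            have : (1 : ℝ) ≤ ((2 ^ i : ℕ) : ℝ) := by exact_mod_cast Nat.one_le_two_pow
            nlinarith
          linarith
        have h9 : (0 : ℝ) ≤ L := Nat.cast_nonneg _
        nlinarith [mul_nonneg h9 (by linarith : (0:ℝ) ≤ lam)]
    _ = ((I + 1 : ℕ) : ℝ) * (32 * lam * (X / R + L)) := by
        rw [sum_const, card_range, nsmul_eq_mul]
    _ ≤ 2 * lam * (32 * lam * (X / R + L)) :=
        mul_le_mul_of_nonneg_right hlogI (by positivity)
    _ = _ := by ring

/-! ### Counting lattice points and equidistribution in residue classes -/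

lemma exists_filter_eq_Icc (s z K : ℕ) :
    ∃ Y, (Icc 1 K).filter (fun c => s + c ^ 3 ≤ z) = Icc 1 Y := by
  induction K with
  | zero => exact ⟨0, by simp⟩
  | succ K ih =>
    by_cases h : s + (K + 1) ^ 3 ≤ z
    · refine ⟨K + 1, filter_true_of_mem fun c hc => ?_⟩
      have := Nat.pow_le_pow_left (mem_Icc.1 hc).2 3
      omega
    · obtain ⟨Y, hY⟩ := ih
      refine ⟨Y, ?_⟩
      rw [← hY]
      ext c
      simp only [mem_filter, mem_Icc]
      constructor
      · rintro ⟨⟨h1, h2⟩, h3⟩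
        refine ⟨⟨h1, ?_⟩, h3⟩
        rcases Nat.lt_or_ge K c with h4 | h4
        · have : c = K + 1 := by omega
          subst this; exact absurd h3 h
        · exact h4
      · rintro ⟨⟨h1, h2⟩, h3⟩; exact ⟨⟨h1, by omega⟩, h3⟩

/-- The number of `1 ≤ c ≤ K` with `s + c³ ≤ z`. -/
def cubeCount (K z s : ℕ) : ℕ := ((Icc 1 K).filter (fun c => s + c ^ 3 ≤ z)).card

lemma filter_eq_Icc_cubeCount (K z s : ℕ) :
    (Icc 1 K).filter (fun c => s + c ^ 3 ≤ z) = Icc 1 (cubeCount K z s) := by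
  obtain ⟨Y, hY⟩ := exists_filter_eq_Icc s z K
  rw [cubeCount, hY]; simp

lemma sum_ite_eq_cubeSum (K z s : ℕ) (β : ℝ) :
    ∑ c ∈ Icc 1 K, (if s + c ^ 3 ≤ z then e ((c : ℝ) ^ 3 * β) else 0)
      = cubeSum (cubeCount K z s) β := by
  rw [← sum_filter, filter_eq_Icc_cubeCount, cubeSum]

lemma sum_ite_eq_cubeCount (K z s : ℕ) :
    ∑ c ∈ Icc 1 K, (if s + c ^ 3 ≤ z then (1 : ℂ) else 0) = cubeCount K z s := by
  rw [← sum_filter, filter_eq_Icc_cubeCount]; simp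

lemma r3_eq {n K : ℕ} (h : n < (K + 1) ^ 3) : r3 n =
    ((Icc 1 K ×ˢ Icc 1 K ×ˢ Icc 1 K).filter
      (fun p => p.1 ^ 3 + p.2.1 ^ 3 + p.2.2 ^ 3 = n)).card := by
  rw [r3]
  congr 1
  ext ⟨a, b, c⟩
  have key : ∀ a, a ^ 3 ≤ n → a ≤ n ∧ a ≤ K := by
    intro a ha
    refine ⟨(Nat.le_self_pow (by norm_num) a).trans ha, ?_⟩
    by_contra hlt
    have := Nat.pow_le_pow_left (by omega : K + 1 ≤ a) 3
    omega
  simp only [mem_filter, mem_product, mem_Icc]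
  constructor
  · rintro ⟨⟨⟨h1, -⟩, ⟨h2, -⟩, h3, -⟩, hs⟩
    exact ⟨⟨⟨h1, (key a (by omega)).2⟩, ⟨h2, (key b (by omega)).2⟩, h3, (key c (by omega)).2⟩, hs⟩
  · rintro ⟨⟨⟨h1, -⟩, ⟨h2, -⟩, h3, -⟩, hs⟩
    exact ⟨⟨⟨h1, (key a (by omega)).1⟩, ⟨h2, (key b (by omega)).1⟩, h3, (key c (by omega)).1⟩, hs⟩

lemma sum_r3_mul {z K : ℕ} (h : z < (K + 1) ^ 3) (φ : ℕ → ℂ) :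
    ∑ n ∈ Icc 1 z, (r3 n : ℂ) * φ n = ∑ a ∈ Icc 1 K, ∑ b ∈ Icc 1 K, ∑ c ∈ Icc 1 K,
      if a ^ 3 + b ^ 3 + c ^ 3 ≤ z then φ (a ^ 3 + b ^ 3 + c ^ 3) else 0 := by
  have h1 : ∀ n ∈ Icc 1 z, (r3 n : ℂ) * φ n = ∑ a ∈ Icc 1 K, ∑ b ∈ Icc 1 K, ∑ c ∈ Icc 1 K,
      if a ^ 3 + b ^ 3 + c ^ 3 = n then φ n else 0 := by
    intro n hn
    rw [r3_eq (lt_of_le_of_lt (mem_Icc.1 hn).2 h), card_filter]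
    push_cast
    rw [sum_mul, sum_product]
    refine sum_congr rfl fun a _ => ?_
    rw [sum_product]
    refine sum_congr rfl fun b _ => sum_congr rfl fun c _ => ?_
    split_ifs <;> simp
  rw [sum_congr rfl h1, sum_comm]; refine sum_congr rfl fun a ha => ?_
  rw [sum_comm]; refine sum_congr rfl fun b _ => ?_
  rw [sum_comm]; refine sum_congr rfl fun c _ => ?_
  have ha1 : 1 ≤ a ^ 3 := Nat.one_le_pow _ _ (mem_Icc.1 ha).1
  rw [sum_ite_eq (Icc 1 z) (a ^ 3 + b ^ 3 + c ^ 3)]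
  simp only [mem_Icc]
  exact if_congr (by omega) rfl rfl

/-- The deviation of an incomplete cubic sum from its mean value. -/
def cubeErr (d b Y : ℕ) : ℂ := cubeSum Y (b / d) - Y * sg d b

/-- Full periods cancel exactly, so only Y mod d matters; the incomplete and the complete sum are
then both controlled by `ncub` on average over b. -/
lemma sum_normSq_cubeErr_le {d : ℕ} (hd : 0 < d) (Y : ℕ) :
    ∑ b ∈ Icc 1 d, ‖cubeErr d b Y‖ ^ 2 ≤ 4 * (d * ncub d) := by
  have hdc : (d : ℂ) ≠ 0 := by exact_mod_cast hd.ne'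
  have hd' : (0 : ℝ) < d := by exact_mod_cast hd
  have hs := Nat.mod_lt Y hd
  have h1 : ∀ b ∈ Icc 1 d, ‖cubeErr d b Y‖ ^ 2
      ≤ 2 * ‖cubeSum (Y % d) (b / d)‖ ^ 2 + 2 * ((d : ℝ) ^ 2 * ‖sg d b‖ ^ 2) := by
    intro b _
    have : cubeErr d b Y = cubeSum (Y % d) (b / d) - ((Y % d : ℕ) : ℂ) * sg d b := by
      rw [cubeErr]
      conv_lhs => rw [← Nat.div_add_mod Y d, cubeSum_add_mul hd]
      rw [sg]; push_cast; field_simp; ring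
    rw [this]
    have h2 := norm_sub_le (cubeSum (Y % d) (b / d)) (((Y % d : ℕ) : ℂ) * sg d b)
    have h3 : ‖((Y % d : ℕ) : ℂ) * sg d b‖ ≤ d * ‖sg d b‖ := by
      rw [norm_mul, Complex.norm_natCast]
      exact mul_le_mul_of_nonneg_right (by exact_mod_cast hs.le) (norm_nonneg _)
    have h4 : ‖cubeSum (Y % d) (b / d) - ((Y % d : ℕ) : ℂ) * sg d b‖ ^ 2
      ≤ (‖cubeSum (Y % d) (b / d)‖ + d * ‖sg d b‖) ^ 2 :=
      pow_le_pow_left₀ (norm_nonneg _) (h2.trans (by linarith)) 2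
    nlinarith [sq_nonneg (‖cubeSum (Y % d) (b / d)‖ - d * ‖sg d b‖)]
  refine (sum_le_sum h1).trans ?_
  rw [sum_add_distrib, ← mul_sum, ← mul_sum, ← mul_sum]
  have h5 := sum_normSq_cubeSum_le hd hs.le
  have h6 := mul_le_mul_of_nonneg_left (sum_norm_sg_sq_le hd) (sq_nonneg (d : ℝ))
  have h7 : (d : ℝ) ^ 2 * (ncub d / d) = d * ncub d := by field_simp
  linarith

/-- Replace the three exponentials by the mean `sg` one variable at a time. With the other two
variables fixed, the condition on the third cuts out an initial segment, so each replacement costs a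
sum of `cubeErr` over two variables. -/
lemma norm_cubeGen_sub_le {z K : ℕ} (h : z < (K + 1) ^ 3) (d b : ℕ) :
    ‖cubeGen z (b / d) - sg d b ^ 3 * ∑ n ∈ Icc 1 z, (r3 n : ℂ)‖
      ≤ 3 * ∑ i ∈ Icc 1 K, ∑ j ∈ Icc 1 K, ‖cubeErr d b (cubeCount K z (i ^ 3 + j ^ 3))‖ := by
  set β : ℝ := b / d
  set E := ∑ i ∈ Icc 1 K, ∑ j ∈ Icc 1 K, ‖cubeErr d b (cubeCount K z (i ^ 3 + j ^ 3))‖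
  set f : ℕ → ℂ := fun m => e ((m : ℝ) ^ 3 * β) with hf
  have hf1 : ∀ m, ‖f m‖ = 1 := fun m => norm_e _
  -- One replacement, with a unimodular weight in the two other variables. The symmetry of the
  -- region lets the third variable play every role.
  have key : ∀ w : ℕ → ℕ → ℂ, (∀ i j, ‖w i j‖ = 1) →
      ‖(∑ i ∈ Icc 1 K, ∑ j ∈ Icc 1 K, ∑ c ∈ Icc 1 K,
          if i ^ 3 + j ^ 3 + c ^ 3 ≤ z then w i j * f c else 0)
        - sg d b * ∑ i ∈ Icc 1 K, ∑ j ∈ Icc 1 K, ∑ c ∈ Icc 1 K,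
          (if i ^ 3 + j ^ 3 + c ^ 3 ≤ z then w i j else 0)‖ ≤ E := by
    intro w hw
    have h1 : (∑ i ∈ Icc 1 K, ∑ j ∈ Icc 1 K, ∑ c ∈ Icc 1 K,
          if i ^ 3 + j ^ 3 + c ^ 3 ≤ z then w i j * f c else 0)
        - sg d b * ∑ i ∈ Icc 1 K, ∑ j ∈ Icc 1 K, ∑ c ∈ Icc 1 K,
          (if i ^ 3 + j ^ 3 + c ^ 3 ≤ z then w i j else 0)
        = ∑ i ∈ Icc 1 K, ∑ j ∈ Icc 1 K, w i j * cubeErr d b (cubeCount K z (i ^ 3 + j ^ 3)) := by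
      rw [mul_sum, ← sum_sub_distrib]; refine sum_congr rfl fun i _ => ?_
      rw [mul_sum, ← sum_sub_distrib]; refine sum_congr rfl fun j _ => ?_
      rw [cubeErr, ← sum_ite_eq_cubeSum, ← sum_ite_eq_cubeCount, mul_sub, mul_sum, sum_mul,
        mul_sum, mul_sum]
      congr 1
      · refine sum_congr rfl fun c _ => ?_
        split_ifs <;> simp [hf, β]
      · refine sum_congr rfl fun c _ => ?_
        split_ifs <;> simp [mul_comm]
    rw [h1]
    refine (norm_sum_le _ _).trans (sum_le_sum fun i _ => (norm_sum_le _ _).trans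
      (sum_le_sum fun j _ => ?_))
    rw [norm_mul, hw, one_mul]
  have hA0 : cubeGen z β = ∑ i ∈ Icc 1 K, ∑ j ∈ Icc 1 K, ∑ c ∈ Icc 1 K,
      if i ^ 3 + j ^ 3 + c ^ 3 ≤ z then f i * f j * f c else 0 := by
    rw [cubeGen, trig, sum_r3_mul h (fun n => e (n * β))]
    refine sum_congr rfl fun i _ => sum_congr rfl fun j _ => sum_congr rfl fun c _ => ?_
    refine if_congr Iff.rfl ?_ rfl
    simp only [hf]; rw [← e_add, ← e_add]; congr 1; push_cast; ring
  have hA3 : ∑ n ∈ Icc 1 z, (r3 n : ℂ) = ∑ i ∈ Icc 1 K, ∑ j ∈ Icc 1 K, ∑ c ∈ Icc 1 K,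
      if i ^ 3 + j ^ 3 + c ^ 3 ≤ z then (1 : ℂ) else 0 := by
    rw [← sum_r3_mul h (fun _ => 1)]; simp
  have hA1 : (∑ i ∈ Icc 1 K, ∑ j ∈ Icc 1 K, ∑ c ∈ Icc 1 K,
      if i ^ 3 + j ^ 3 + c ^ 3 ≤ z then f i * f c else 0)
      = ∑ i ∈ Icc 1 K, ∑ j ∈ Icc 1 K, ∑ c ∈ Icc 1 K,
      if i ^ 3 + j ^ 3 + c ^ 3 ≤ z then f i * f j else 0 := by
    refine sum_congr rfl fun i _ => ?_
    rw [sum_comm]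
    refine sum_congr rfl fun j _ => sum_congr rfl fun c _ => ?_
    exact if_congr (by omega) rfl rfl
  have hA2 : (∑ i ∈ Icc 1 K, ∑ j ∈ Icc 1 K, ∑ c ∈ Icc 1 K,
      if i ^ 3 + j ^ 3 + c ^ 3 ≤ z then 1 * f c else 0)
      = ∑ i ∈ Icc 1 K, ∑ j ∈ Icc 1 K, ∑ c ∈ Icc 1 K,
      if i ^ 3 + j ^ 3 + c ^ 3 ≤ z then f i else 0 := by
    have : (∑ i ∈ Icc 1 K, ∑ j ∈ Icc 1 K, ∑ c ∈ Icc 1 K,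
      if i ^ 3 + j ^ 3 + c ^ 3 ≤ z then 1 * f c else 0)
      = ∑ i ∈ Icc 1 K, ∑ c ∈ Icc 1 K, ∑ j ∈ Icc 1 K,
      if i ^ 3 + j ^ 3 + c ^ 3 ≤ z then 1 * f c else 0 := sum_congr rfl fun i _ => sum_comm
    rw [this, sum_comm]
    refine sum_congr rfl fun c _ => sum_congr rfl fun i _ => sum_congr rfl fun j _ => ?_
    exact if_congr (by omega) (one_mul _) rfl
  have k0 := key (fun i j => f i * f j) (fun i j => by rw [norm_mul, hf1, hf1, one_mul])
  have k1 := key (fun i _ => f i) (fun i _ => hf1 i)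
  have k2 := key (fun _ _ => 1) (fun _ _ => norm_one)
  rw [← hA0] at k0
  rw [hA1] at k1
  rw [hA2, ← hA3] at k2
  set A1 := ∑ i ∈ Icc 1 K, ∑ j ∈ Icc 1 K, ∑ c ∈ Icc 1 K,
      if i ^ 3 + j ^ 3 + c ^ 3 ≤ z then f i * f j else 0
  set A2 := ∑ i ∈ Icc 1 K, ∑ j ∈ Icc 1 K, ∑ c ∈ Icc 1 K,
      if i ^ 3 + j ^ 3 + c ^ 3 ≤ z then f i else 0
  set A3 := ∑ n ∈ Icc 1 z, (r3 n : ℂ)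
  have hdec : cubeGen z β - sg d b ^ 3 * A3 = (cubeGen z β - sg d b * A1)
      + sg d b * (A1 - sg d b * A2) + sg d b ^ 2 * (A2 - sg d b * A3) := by ring
  rw [hdec]
  have hs := norm_sg_le_one d b
  have hE : 0 ≤ E := (norm_nonneg _).trans k0
  have h3 : ‖sg d b * (A1 - sg d b * A2)‖ ≤ E := by
    rw [norm_mul]; nlinarith [norm_nonneg (A1 - sg d b * A2)]
  have h4 : ‖sg d b ^ 2 * (A2 - sg d b * A3)‖ ≤ E := by
    rw [norm_mul, norm_pow]
    have : ‖sg d b‖ ^ 2 ≤ 1 := pow_le_one₀ (norm_nonneg _) hs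
    nlinarith [norm_nonneg (A2 - sg d b * A3)]
  refine (norm_add_le _ _).trans ?_
  have := norm_add_le (cubeGen z β - sg d b * A1) (sg d b * (A1 - sg d b * A2))
  linarith

lemma sum_normSq_cubeGen_sub_le {z K d : ℕ} (h : z < (K + 1) ^ 3) (hd : 0 < d) :
    ∑ b ∈ Icc 1 d, ‖cubeGen z (b / d) - sg d b ^ 3 * ∑ n ∈ Icc 1 z, (r3 n : ℂ)‖ ^ 2
      ≤ 36 * (K : ℝ) ^ 4 * (d * ncub d) := by
  have h1 : ∀ b ∈ Icc 1 d,
      ‖cubeGen z (b / d) - sg d b ^ 3 * ∑ n ∈ Icc 1 z, (r3 n : ℂ)‖ ^ 2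
      ≤ 9 * ((K : ℝ) ^ 2 * ∑ p ∈ Icc 1 K ×ˢ Icc 1 K,
          ‖cubeErr d b (cubeCount K z (p.1 ^ 3 + p.2 ^ 3))‖ ^ 2) := by
    intro b _
    have h2 := norm_cubeGen_sub_le h d b
    rw [← sum_product'] at h2
    have h3 := pow_le_pow_left₀ (norm_nonneg _) h2 2
    refine h3.trans ?_
    rw [mul_pow]
    have h4 := sq_sum_le_card_mul_sum_sq (s := Icc 1 K ×ˢ Icc 1 K)
      (f := fun p => ‖cubeErr d b (cubeCount K z (p.1 ^ 3 + p.2 ^ 3))‖)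
    rw [card_product, Nat.card_Icc, Nat.add_sub_cancel] at h4
    push_cast at h4
    rw [← sq] at h4
    linarith
  refine (sum_le_sum h1).trans ?_
  rw [← mul_sum, ← mul_sum, sum_comm]
  have h5 : ∑ p ∈ Icc 1 K ×ˢ Icc 1 K, ∑ b ∈ Icc 1 d,
      ‖cubeErr d b (cubeCount K z (p.1 ^ 3 + p.2 ^ 3))‖ ^ 2 ≤ (K : ℝ) ^ 2 * (4 * (d * ncub d)) := by
    refine (sum_le_sum fun p _ => sum_normSq_cubeErr_le hd _).trans ?_
    rw [sum_const, card_product, Nat.card_Icc, Nat.add_sub_cancel, nsmul_eq_mul]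
    push_cast; rw [← sq]
  have h6 := mul_le_mul_of_nonneg_left h5 (sq_nonneg (K : ℝ))
  nlinarith

/-! ### The number of representations by sums of three cubes on average -/

/-- `∫_0^1 (1 - t³)^p dt`. -/
def kap (p : ℝ) : ℝ := ∫ t in (0 : ℝ)..1, (1 - t ^ 3) ^ p

lemma betaIntegral_ofReal (a b : ℝ) : Complex.betaIntegral a b
    = ((∫ x in (0 : ℝ)..1, x ^ (a - 1) * (1 - x) ^ (b - 1) : ℝ) : ℂ) := by
  rw [Complex.betaIntegral, ← intervalIntegral.integral_ofReal]
  refine intervalIntegral.integral_congr fun x hx => ?_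
  rw [Set.uIcc_of_le zero_le_one] at hx
  have h1 : (0 : ℝ) ≤ 1 - x := by linarith [hx.2]
  simp only [Complex.ofReal_mul, Complex.ofReal_cpow hx.1, Complex.ofReal_cpow h1]
  push_cast; rfl

/-- The substitution x = t³ turns the integral into a Beta integral. -/
lemma kap_eq {p : ℝ} (hp : 0 < p) :
    kap p = Real.Gamma (4 / 3) * Real.Gamma (p + 1) / Real.Gamma (p + 4 / 3) := by
  have h1 : Real.Gamma (1 / 3) * Real.Gamma (p + 1) / Real.Gamma (1 / 3 + (p + 1))
      = ∫ x in (0 : ℝ)..1, x ^ ((1 / 3 : ℝ) - 1) * (1 - x) ^ ((p + 1) - 1) := by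
    have h := ProbabilityTheory.beta_eq_betaIntegralReal (1 / 3) (p + 1) (by norm_num) (by linarith)
    rw [betaIntegral_ofReal, Complex.ofReal_re] at h
    exact h
  have h2 : ∫ x in (0 : ℝ)..1, x ^ ((1 / 3 : ℝ) - 1) * (1 - x) ^ ((p + 1) - 1) = 3 * kap p := by
    set g : ℝ → ℝ := (Set.Ioc 0 1).indicator
      (fun u => u ^ ((1 / 3 : ℝ) - 1) * (1 - u) ^ ((p + 1) - 1)) with hg
    have h3 := MeasureTheory.integral_comp_rpow_Ioi_of_pos (g := g) (p := 3) (by norm_num)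
    have h4 : ∫ y in Set.Ioi (0 : ℝ), g y
        = ∫ x in (0 : ℝ)..1, x ^ ((1 / 3 : ℝ) - 1) * (1 - x) ^ ((p + 1) - 1) := by
      rw [intervalIntegral.integral_of_le zero_le_one, hg,
        MeasureTheory.setIntegral_indicator measurableSet_Ioc,
        Set.inter_eq_self_of_subset_right Set.Ioc_subset_Ioi_self]
    have h5 : ∫ x in Set.Ioi (0 : ℝ), ((3 : ℝ) * x ^ ((3 : ℝ) - 1)) • g (x ^ (3 : ℝ))
        = ∫ x in Set.Ioi (0 : ℝ), (Set.Ioc 0 1).indicator (fun t => 3 * (1 - t ^ 3) ^ p) x := by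
      refine MeasureTheory.setIntegral_congr_fun measurableSet_Ioi fun x hx => ?_
      have hx0 : (0 : ℝ) < x := hx
      simp only [hg, smul_eq_mul]
      by_cases hx1 : x ≤ 1
      · have hm : x ^ (3 : ℝ) ∈ Set.Ioc (0 : ℝ) 1 :=
          ⟨by positivity, Real.rpow_le_one hx0.le hx1 (by norm_num)⟩
        rw [Set.indicator_of_mem hm, Set.indicator_of_mem (show x ∈ Set.Ioc (0 : ℝ) 1 from ⟨hx0, hx1⟩)]
        rw [← Real.rpow_mul hx0.le, add_sub_cancel_right]
        have : x ^ ((3 : ℝ) - 1) * x ^ ((3 : ℝ) * (1 / 3 - 1)) = 1 := by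
          rw [← Real.rpow_add hx0]; norm_num
        have h6 : x ^ (3 : ℝ) = x ^ 3 := by exact_mod_cast Real.rpow_natCast x 3
        rw [h6]
        linear_combination (3 * (1 - x ^ 3) ^ p) * this
      · have hm : x ^ (3 : ℝ) ∉ Set.Ioc (0 : ℝ) 1 := by
          rintro ⟨-, h⟩
          exact absurd h (not_le.2 (Real.one_lt_rpow (not_le.1 hx1) (by norm_num)))
        rw [Set.indicator_of_notMem hm, Set.indicator_of_notMem (fun h => hx1 h.2), mul_zero]
    rw [h4, h5, MeasureTheory.setIntegral_indicator measurableSet_Ioc,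
        Set.inter_eq_self_of_subset_right Set.Ioc_subset_Ioi_self,
        ← intervalIntegral.integral_of_le zero_le_one, intervalIntegral.integral_const_mul] at h3
    rw [← h3, kap]
  have h7 : Real.Gamma (4 / 3) = 1 / 3 * Real.Gamma (1 / 3) := by
    rw [← Real.Gamma_add_one (by norm_num)]; norm_num
  rw [h2, show (1 / 3 + (p + 1) : ℝ) = p + 4 / 3 by ring] at h1
  rw [h7]
  linear_combination (-1 / 3 : ℝ) * h1

lemma kap_nonneg {p : ℝ} (hp : 0 < p) : 0 ≤ kap p := by
  rw [kap_eq hp]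
  have h1 := Real.Gamma_pos_of_pos (show (0 : ℝ) < 4 / 3 by norm_num)
  have h2 := Real.Gamma_pos_of_pos (show (0 : ℝ) < p + 1 by linarith)
  have h3 := Real.Gamma_pos_of_pos (show (0 : ℝ) < p + 4 / 3 by linarith)
  positivity

/-- The two values are the factors met in integrating out two variables in turn; Γ(5/3) cancels
between them. -/
lemma kap_mul_kap : kap (1 / 3) * kap (2 / 3) = Real.Gamma (4 / 3) ^ 3 := by
  rw [kap_eq (by norm_num), kap_eq (by norm_num)]
  have h2 := (Real.Gamma_pos_of_pos (show (0 : ℝ) < 5 / 3 by norm_num)).ne'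
  norm_num
  field_simp

/-- Homogeneity: with t = w^(1/3) s the integral scales out. The truncated power makes the range
beyond the cube root of w harmless. -/
lemma integral_max_rpow {p w : ℝ} (hp : 0 < p) {K : ℕ} (hw : w ≤ (K : ℝ) ^ 3) :
    ∫ t in (0 : ℝ)..K, (max (w - t ^ 3) 0) ^ p = kap p * (max w 0) ^ (p + 1 / 3) := by
  have hK : (0 : ℝ) ≤ K := Nat.cast_nonneg K
  have hcont : Continuous fun t : ℝ => (max (w - t ^ 3) 0) ^ p :=
    Continuous.rpow_const (by fun_prop) fun _ => Or.inr hp.le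
  rcases le_or_gt w 0 with h | h
  · have h0 : ∫ t in (0 : ℝ)..K, (max (w - t ^ 3) 0) ^ p = ∫ t in (0 : ℝ)..K, (0 : ℝ) := by
      refine intervalIntegral.integral_congr fun t ht => ?_
      rw [Set.uIcc_of_le hK] at ht
      have : w - t ^ 3 ≤ 0 := by have := pow_nonneg ht.1 3; linarith
      simp only [max_eq_right this, Real.zero_rpow hp.ne']
    rw [h0, max_eq_right h, Real.zero_rpow (by linarith)]; simp
  · set A := w ^ (1 / 3 : ℝ) with hA
    have hA0 : 0 < A := by positivity
    have hA3 : A ^ 3 = w := by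
      rw [hA, ← Real.rpow_natCast, ← Real.rpow_mul h.le]; norm_num
    have hAK : A ≤ K := by
      by_contra hlt
      have := pow_lt_pow_left₀ (not_le.1 hlt) hK (by norm_num : (3 : ℕ) ≠ 0)
      linarith
    rw [← intervalIntegral.integral_add_adjacent_intervals
      (hcont.intervalIntegrable 0 A) (hcont.intervalIntegrable A K)]
    have h2 : ∫ t in A..K, (max (w - t ^ 3) 0) ^ p = ∫ t in A..(K : ℝ), (0 : ℝ) := by
      refine intervalIntegral.integral_congr fun t ht => ?_
      rw [Set.uIcc_of_le hAK] at ht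
      have : w - t ^ 3 ≤ 0 := by have := pow_le_pow_left₀ hA0.le ht.1 3; linarith
      simp only [max_eq_right this, Real.zero_rpow hp.ne']
    have h3 : ∫ t in (0 : ℝ)..A, (max (w - t ^ 3) 0) ^ p = A * (w ^ p * kap p) := by
      have h4 := intervalIntegral.mul_integral_comp_mul_left (a := 0) (b := 1)
        (f := fun t : ℝ => (max (w - t ^ 3) 0) ^ p) A
      rw [mul_zero, mul_one] at h4
      rw [← h4]
      congr 1
      rw [kap, ← intervalIntegral.integral_const_mul]
      refine intervalIntegral.integral_congr fun s hs => ?_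
      rw [Set.uIcc_of_le zero_le_one] at hs
      have h5 : (0 : ℝ) ≤ 1 - s ^ 3 := by
        have := pow_le_one₀ hs.1 hs.2 (n := 3); linarith
      have h6 : w - (A * s) ^ 3 = w * (1 - s ^ 3) := by rw [mul_pow, hA3]; ring
      simp only [h6]
      rw [max_eq_left (by positivity), Real.mul_rpow h.le h5]
    rw [h2, h3, max_eq_left h.le, Real.rpow_add h, ← hA, intervalIntegral.integral_zero]
    ring

lemma abs_sum_max_rpow_sub_le {p w : ℝ} (hp : 0 < p) {K : ℕ} (hw : w ≤ (K : ℝ) ^ 3) :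
    |∑ c ∈ Icc 1 K, (max (w - (c : ℝ) ^ 3) 0) ^ p - kap p * (max w 0) ^ (p + 1 / 3)|
      ≤ (max w 0) ^ p := by
  set f : ℝ → ℝ := fun t => (max (w - t ^ 3) 0) ^ p with hf
  have hanti : AntitoneOn f (Set.Icc 0 (0 + (K : ℝ))) := by
    intro a ha b hb hab
    refine Real.rpow_le_rpow (le_max_right _ _) (max_le_max ?_ le_rfl) hp.le
    have := pow_le_pow_left₀ ha.1 hab 3; linarith
  have h1 := hanti.sum_le_integral
  have h2 := hanti.integral_le_sum
  rw [zero_add, integral_max_rpow hp hw] at h1 h2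
  simp only [zero_add] at h1 h2
  have h3 : ∑ c ∈ Icc 1 K, f c = ∑ i ∈ range K, f ((i + 1 : ℕ) : ℝ) := by
    rw [range_eq_Ico, sum_Ico_add' (fun i : ℕ => f i) 0 K 1]
    exact sum_congr (by ext x; simp only [mem_Icc, mem_Ico]; omega) fun _ _ => rfl
  have h4 := sum_range_succ' (fun i : ℕ => f i) K
  rw [sum_range_succ] at h4
  have h5 : f ((0 : ℕ) : ℝ) = (max w 0) ^ p := by simp [hf]
  have h6 : 0 ≤ f (K : ℝ) := by simp only [hf]; positivity
  have h7 : 0 ≤ (max w 0) ^ p := by positivity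
  change |∑ c ∈ Icc 1 K, f c - _| ≤ _
  rw [h3, abs_le]
  constructor <;> linarith

lemma abs_cubeCount_sub_le {K z s : ℕ} (hK : z ≤ K ^ 3) :
    |(cubeCount K z s : ℝ) - (max ((z : ℝ) - s) 0) ^ (1 / 3 : ℝ)| ≤ 1 := by
  set Y := cubeCount K z s with hY
  have hmem : ∀ c, c ∈ Icc 1 Y ↔ c ∈ (Icc 1 K).filter (fun c => s + c ^ 3 ≤ z) := by
    intro c; rw [filter_eq_Icc_cubeCount]
  set w : ℝ := max ((z : ℝ) - s) 0 with hw
  have hw0 : 0 ≤ w := le_max_right _ _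
  have hroot : ∀ y : ℝ, 0 ≤ y → (y ^ 3) ^ (1 / 3 : ℝ) = y := by
    intro y hy; rw [← Real.rpow_natCast, ← Real.rpow_mul hy]; norm_num
  have hlow : (Y : ℝ) ≤ w ^ (1 / 3 : ℝ) := by
    rw [← hroot Y (Nat.cast_nonneg _)]
    refine Real.rpow_le_rpow (by positivity) ?_ (by norm_num)
    rcases Nat.eq_zero_or_pos Y with h | h
    · rw [h]; simpa using hw0
    · have := (hmem Y).1 (by simp; omega)
      simp only [mem_filter] at this
      have h2 : (s : ℝ) + (Y : ℝ) ^ 3 ≤ z := by exact_mod_cast this.2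
      exact le_trans (by linarith) (le_max_left _ _)
  have hup : w ^ (1 / 3 : ℝ) ≤ Y + 1 := by
    rw [← hroot ((Y : ℝ) + 1) (by positivity)]
    refine Real.rpow_le_rpow hw0 (max_le ?_ (by positivity)) (by norm_num)
    have hn : Y + 1 ∉ Icc 1 Y := by simp
    rw [hmem] at hn
    simp only [mem_filter, mem_Icc, not_and_or, not_le] at hn
    rcases hn with (h | h) | h
    · omega
    · have h1 : z ≤ (Y + 1) ^ 3 := hK.trans (Nat.pow_le_pow_left (by omega) 3)
      have h2 : (z : ℝ) ≤ ((Y : ℝ) + 1) ^ 3 := by exact_mod_cast h1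
      have : (0 : ℝ) ≤ s := Nat.cast_nonneg s
      linarith
    · have h2 : (z : ℝ) < s + ((Y : ℝ) + 1) ^ 3 := by exact_mod_cast h
      linarith
  rw [abs_le]; constructor <;> linarith

lemma exists_cube_root (z : ℕ) : ∃ K : ℕ, z ≤ K ^ 3 ∧ z < (K + 1) ^ 3 ∧
    (1 ≤ z → (K : ℝ) ≤ 2 * (z : ℝ) ^ (1 / 3 : ℝ)) := by
  have hz0 : (0 : ℝ) ≤ z := Nat.cast_nonneg z
  refine ⟨⌈(z : ℝ) ^ (1 / 3 : ℝ)⌉₊, ?_⟩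
  have h1 := Nat.le_ceil ((z : ℝ) ^ (1 / 3 : ℝ))
  set K := ⌈(z : ℝ) ^ (1 / 3 : ℝ)⌉₊ with hK
  have h2 : z ≤ K ^ 3 := by
    have h3 := pow_le_pow_left₀ (by positivity) h1 3
    rw [← Real.rpow_natCast, ← Real.rpow_mul hz0] at h3
    norm_num at h3
    exact_mod_cast h3
  refine ⟨h2, lt_of_le_of_lt h2 (Nat.pow_lt_pow_left (by omega) (by norm_num)), fun hz => ?_⟩
  have h4 : (1 : ℝ) ≤ (z : ℝ) ^ (1 / 3 : ℝ) := Real.one_le_rpow (by exact_mod_cast hz) (by norm_num)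
  have := Nat.ceil_lt_add_one (show (0 : ℝ) ≤ (z : ℝ) ^ (1 / 3 : ℝ) by positivity)
  linarith

/-- `Γ(4/3)³`. -/
def gam : ℝ := Real.Gamma (4 / 3) ^ 3

lemma gam_pos : 0 < gam := by
  have := Real.Gamma_pos_of_pos (show (0 : ℝ) < 4 / 3 by norm_num)
  unfold gam; positivity

/-- Counting lattice points one variable at a time: a cube root replaces the count in the innermost
variable, and monotone sums are replaced by integrals in the other two. With K ≤ 2 z^(1/3) each
stage errs by O(z^(2/3)); the three costs are the summands 4, 2 and `kap (1 / 3)` of the constant.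
-/
lemma exists_abs_sum_r3_sub_le : ∃ C : ℝ, 0 < C ∧ ∀ z : ℕ,
    |∑ n ∈ Icc 1 z, (r3 n : ℝ) - gam * z| ≤ C * (z : ℝ) ^ (2 / 3 : ℝ) := by
  refine ⟨4 + 2 + kap (1 / 3), by have := kap_nonneg (p := 1 / 3) (by norm_num); linarith,
    fun z => ?_⟩
  rcases Nat.eq_zero_or_pos z with rfl | hz
  · simp [Real.zero_rpow]
  obtain ⟨K, hK, hK', hK2⟩ := exists_cube_root z
  have hK2 := hK2 hz
  have hz0 : (0 : ℝ) < z := by exact_mod_cast hz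
  have hKr : (z : ℝ) ≤ (K : ℝ) ^ 3 := by exact_mod_cast hK
  have hk1 := kap_nonneg (p := 1 / 3) (by norm_num)
  set F : ℝ → ℝ → ℝ := fun p w => (max w 0) ^ p with hF
  have h1 : ∑ n ∈ Icc 1 z, (r3 n : ℝ)
      = ∑ a ∈ Icc 1 K, ∑ b ∈ Icc 1 K, (cubeCount K z (a ^ 3 + b ^ 3) : ℝ) := by
    have h := sum_r3_mul hK' (fun _ => 1)
    simp only [mul_one, sum_ite_eq_cubeCount] at h
    exact_mod_cast h
  have h2 : |∑ n ∈ Icc 1 z, (r3 n : ℝ)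
      - ∑ a ∈ Icc 1 K, ∑ b ∈ Icc 1 K, F (1 / 3) (z - (a : ℝ) ^ 3 - (b : ℝ) ^ 3)| ≤ (K : ℝ) ^ 2 := by
    rw [h1, ← sum_sub_distrib]
    refine (abs_sum_le_sum_abs _ _).trans ?_
    calc _ ≤ ∑ a ∈ Icc 1 K, ∑ b ∈ Icc 1 K, (1 : ℝ) := by
          refine sum_le_sum fun a _ => ?_
          rw [← sum_sub_distrib]
          refine (abs_sum_le_sum_abs _ _).trans (sum_le_sum fun b _ => ?_)
          have := abs_cubeCount_sub_le (K := K) (z := z) (s := a ^ 3 + b ^ 3) hK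
          push_cast at this
          rwa [← sub_sub] at this
      _ = _ := by simp [sq]
  have h3 : |∑ a ∈ Icc 1 K, ∑ b ∈ Icc 1 K, F (1 / 3) (z - (a : ℝ) ^ 3 - (b : ℝ) ^ 3)
      - kap (1 / 3) * ∑ a ∈ Icc 1 K, F (2 / 3) (z - (a : ℝ) ^ 3)| ≤ K * (z : ℝ) ^ (1 / 3 : ℝ) := by
    rw [mul_sum, ← sum_sub_distrib]
    refine (abs_sum_le_sum_abs _ _).trans ?_
    calc _ ≤ ∑ a ∈ Icc 1 K, (z : ℝ) ^ (1 / 3 : ℝ) := by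
          refine sum_le_sum fun a _ => ?_
          have h4 : (z : ℝ) - (a : ℝ) ^ 3 ≤ z := by
            have : (0 : ℝ) ≤ (a : ℝ) ^ 3 := by positivity
            linarith
          have := abs_sum_max_rpow_sub_le (p := 1 / 3) (by norm_num) (h4.trans hKr)
          rw [show (1 / 3 + 1 / 3 : ℝ) = 2 / 3 by norm_num] at this
          refine this.trans (Real.rpow_le_rpow (le_max_right _ _) (max_le h4 hz0.le) (by norm_num))
      _ = _ := by simp
  have h4 : |∑ a ∈ Icc 1 K, F (2 / 3) (z - (a : ℝ) ^ 3) - kap (2 / 3) * z| ≤ (z : ℝ) ^ (2 / 3 : ℝ) := by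
    have := abs_sum_max_rpow_sub_le (p := 2 / 3) (by norm_num) hKr
    rw [show (2 / 3 + 1 / 3 : ℝ) = 1 by norm_num, max_eq_left hz0.le, Real.rpow_one] at this
    exact this
  have h5 : kap (1 / 3) * (kap (2 / 3) * z) = gam * z := by
    rw [← mul_assoc, kap_mul_kap, gam]
  have h6 := mul_le_mul_of_nonneg_left h4 hk1
  rw [← abs_of_nonneg hk1, ← abs_mul, abs_of_nonneg hk1, mul_sub, h5] at h6
  have h7 : (z : ℝ) ^ (2 / 3 : ℝ) = (z : ℝ) ^ (1 / 3 : ℝ) * (z : ℝ) ^ (1 / 3 : ℝ) := by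
    rw [← Real.rpow_add hz0]; norm_num
  set y := (z : ℝ) ^ (1 / 3 : ℝ)
  have hy : 0 ≤ y := by positivity
  have hK0 : (0 : ℝ) ≤ K := Nat.cast_nonneg K
  have h8 : (K : ℝ) ^ 2 ≤ 4 * (y * y) := by nlinarith
  have h9 : K * y ≤ 2 * (y * y) := by nlinarith
  rw [h7] at h6 ⊢
  have t1 := abs_sub_le (∑ n ∈ Icc 1 z, (r3 n : ℝ))
    (∑ a ∈ Icc 1 K, ∑ b ∈ Icc 1 K, F (1 / 3) (z - (a : ℝ) ^ 3 - (b : ℝ) ^ 3)) (gam * z)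
  have t2 := abs_sub_le (∑ a ∈ Icc 1 K, ∑ b ∈ Icc 1 K, F (1 / 3) (z - (a : ℝ) ^ 3 - (b : ℝ) ^ 3))
    (kap (1 / 3) * ∑ a ∈ Icc 1 K, F (2 / 3) (z - (a : ℝ) ^ 3)) (gam * z)
  linarith

/-- The coefficients `r3(n) e(nb/d)` with their mean value removed. -/
def dev (d b n : ℕ) : ℂ := r3 n * e (n * ((b : ℝ) / d)) - gam * sg d b ^ 3

lemma sum_dev (d b z : ℕ) :
    ∑ n ∈ Icc 1 z, dev d b n = cubeGen z (b / d) - gam * sg d b ^ 3 * z := by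
  simp only [dev, sum_sub_distrib, cubeGen, trig]
  simp; ring

/-- Mean square of the deviations over the residues modulo `d`. -/
lemma exists_sum_normSq_dev_le : ∃ C : ℝ, 0 < C ∧ ∀ z d : ℕ, 0 < d →
    ∑ b ∈ Icc 1 d, ‖∑ n ∈ Icc 1 z, dev d b n‖ ^ 2
      ≤ C * (z : ℝ) ^ (4 / 3 : ℝ) * (d * ncub d) := by
  obtain ⟨C, hC0, hC⟩ := exists_abs_sum_r3_sub_le
  -- The deviation splits into the error of `norm_cubeGen_sub_le` and that of replacing the sum of
  -- r3 by its mean. The 36 comes from `sum_normSq_cubeGen_sub_le`, the 16 from K ≤ 2 z^(1/3), and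
  -- the factors 2 from squaring a sum of two terms.
  refine ⟨2 * (36 * 16) + 2 * C ^ 2, by positivity, fun z d hd => ?_⟩
  rcases Nat.eq_zero_or_pos z with rfl | hz
  · simp [Real.zero_rpow]
  have hd' : (1 : ℝ) ≤ d := by exact_mod_cast hd
  have hz0 : (0 : ℝ) < z := by exact_mod_cast hz
  obtain ⟨K, hK, hK', hK2⟩ := exists_cube_root z
  have hK2 := hK2 hz
  have hK4 : (K : ℝ) ^ 4 ≤ 16 * (z : ℝ) ^ (4 / 3 : ℝ) := by
    have h := pow_le_pow_left₀ (Nat.cast_nonneg K) hK2 4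
    rw [mul_pow, ← Real.rpow_natCast ((z : ℝ) ^ (1 / 3 : ℝ)), ← Real.rpow_mul hz0.le] at h
    norm_num at h ⊢; exact h
  have h1 : ∀ b ∈ Icc 1 d, ‖∑ n ∈ Icc 1 z, dev d b n‖ ^ 2
      ≤ 2 * ‖cubeGen z (b / d) - sg d b ^ 3 * ∑ n ∈ Icc 1 z, (r3 n : ℂ)‖ ^ 2
        + 2 * (C ^ 2 * (z : ℝ) ^ (4 / 3 : ℝ)) * ‖sg d b‖ ^ 2 := by
    intro b _
    rw [sum_dev]
    have h2 : cubeGen z (b / d) - gam * sg d b ^ 3 * z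
        = (cubeGen z (b / d) - sg d b ^ 3 * ∑ n ∈ Icc 1 z, (r3 n : ℂ))
          + sg d b ^ 3 * ((∑ n ∈ Icc 1 z, (r3 n : ℝ) - gam * z : ℝ) : ℂ) := by
      push_cast; ring
    rw [h2]
    set P := cubeGen z (b / d) - sg d b ^ 3 * ∑ n ∈ Icc 1 z, (r3 n : ℂ)
    set W : ℝ := ∑ n ∈ Icc 1 z, (r3 n : ℝ) - gam * z
    have h3 : ‖sg d b ^ 3 * (W : ℂ)‖ ^ 2 ≤ (C ^ 2 * (z : ℝ) ^ (4 / 3 : ℝ)) * ‖sg d b‖ ^ 2 := by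
      rw [norm_mul, mul_pow, Complex.norm_real, norm_pow, Real.norm_eq_abs, mul_comm]
      refine mul_le_mul ?_ ?_ (by positivity) (by positivity)
      · have := pow_le_pow_left₀ (abs_nonneg _) (hC z) 2
        rw [mul_pow, ← Real.rpow_natCast ((z : ℝ) ^ (2 / 3 : ℝ)), ← Real.rpow_mul hz0.le] at this
        norm_num at this; rw [sq_abs]; exact this
      · rw [← pow_mul]
        exact pow_le_pow_of_le_one (norm_nonneg _) (norm_sg_le_one d b) (by norm_num)
    have h4 := norm_add_le P (sg d b ^ 3 * (W : ℂ))
    have h5 := pow_le_pow_left₀ (norm_nonneg _) h4 2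
    nlinarith [sq_nonneg (‖P‖ - ‖sg d b ^ 3 * (W : ℂ)‖)]
  refine (sum_le_sum h1).trans ?_
  rw [sum_add_distrib, ← mul_sum, ← mul_sum]
  have h6 := sum_normSq_cubeGen_sub_le hK' hd
  have h7 : (ncub d : ℝ) / d ≤ d * ncub d :=
    (div_le_self (Nat.cast_nonneg _) hd').trans (le_mul_of_one_le_left (Nat.cast_nonneg _) hd')
  have h8 := (sum_norm_sg_sq_le hd).trans h7
  have h9 : (0 : ℝ) ≤ d * ncub d := by positivity
  have h10 : 36 * (K : ℝ) ^ 4 * (d * ncub d)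
      ≤ 36 * (16 * (z : ℝ) ^ (4 / 3 : ℝ)) * (d * ncub d) :=
    mul_le_mul_of_nonneg_right (by linarith) h9
  have h11 := mul_le_mul_of_nonneg_left h8
    (by positivity : (0 : ℝ) ≤ 2 * (C ^ 2 * (z : ℝ) ^ (4 / 3 : ℝ)))
  linarith

/-! ### Hua's inequality for the sixth moment -/

lemma normSq_sum_e_eq (φ : ℕ → ℝ) (L : ℕ) :
    ‖∑ y ∈ Icc 1 L, e (φ y)‖ ^ 2 = L + 2 * (∑ h ∈ Icc 1 L, ∑ y ∈ Icc 1 (L - h),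
      e (φ (y + h) - φ y)).re := by
  have h1 : ∀ L : ℕ, ‖∑ y ∈ Icc 1 L, e (φ y)‖ ^ 2
      = L + 2 * (∑ x ∈ Icc 1 L, ∑ y ∈ Ico 1 x, e (φ x - φ y)).re := by
    intro L
    induction L with
    | zero => simp
    | succ L ih =>
      rw [sum_Icc_succ_top (by omega), sum_Icc_succ_top (by omega), Complex.add_re]
      have h2 : ∀ z w : ℂ, ‖z + w‖ ^ 2 = ‖z‖ ^ 2 + ‖w‖ ^ 2 + 2 * (w * (starRingEnd ℂ) z).re := by
        intro z w
        rw [← Complex.normSq_eq_norm_sq, ← Complex.normSq_eq_norm_sq, ← Complex.normSq_eq_norm_sq,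
          Complex.normSq_add, mul_comm w, ← Complex.conj_re (z * (starRingEnd ℂ) w)]
        simp [mul_comm]
      rw [h2, ih, norm_e, map_sum, mul_sum]
      have h3 : ∑ y ∈ Ico 1 (L + 1), e (φ (L + 1) - φ y)
          = ∑ i ∈ Icc 1 L, e (φ (L + 1)) * (starRingEnd ℂ) (e (φ i)) := by
        refine sum_congr (by ext x; simp only [mem_Icc, mem_Ico]; omega) fun i _ => e_sub _ _
      rw [h3]; push_cast; ring
  rw [h1]
  congr 3
  rw [sum_sigma', sum_sigma']
  refine sum_bij' (fun p _ => (⟨p.1 - p.2, p.2⟩ : (_ : ℕ) × ℕ))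
    (fun p _ => (⟨p.2 + p.1, p.2⟩ : (_ : ℕ) × ℕ)) ?_ ?_ ?_ ?_ ?_
  · rintro ⟨x, y⟩ hp; simp only [mem_sigma, mem_Icc, mem_Ico] at hp ⊢; omega
  · rintro ⟨h, y⟩ hp; simp only [mem_sigma, mem_Icc, mem_Ico] at hp ⊢; omega
  · rintro ⟨x, y⟩ hp; simp only [mem_sigma, mem_Icc, mem_Ico] at hp
    simp only; congr 1; omega
  · rintro ⟨h, y⟩ hp; simp only; congr 1; omega
  · rintro ⟨x, y⟩ hp; simp only [mem_sigma, mem_Icc, mem_Ico] at hp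
    simp only; congr 3; omega

/-- The differencing variables `(h, k, y)` with `h + k + y ≤ P`. -/
def diffTriples (P : ℕ) : Finset (ℕ × ℕ × ℕ) :=
  (Icc 1 P ×ˢ Icc 1 P ×ˢ Icc 1 P).filter fun q => q.1 + q.2.1 + q.2.2 ≤ P

/-- The second difference `6hky + 3hk² + 3h²k` of the cube. -/
def secondDiff (q : ℕ × ℕ × ℕ) : ℕ :=
  6 * q.1 * q.2.1 * q.2.2 + 3 * q.1 * q.2.1 ^ 2 + 3 * q.1 ^ 2 * q.2.1

/-- Two Weyl differencing steps over the integers, with the final triple sum kept as it is instead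
of estimated: for the eighth moment it must be averaged against ‖f‖⁴, where it counts solutions of
an equation. -/
lemma norm_cubeSum_pow_four_le {P : ℕ} (hP : 1 ≤ P) (t : ℝ) :
    ‖cubeSum P t‖ ^ 4 ≤ 10 * (P : ℝ) ^ 3
      + 16 * P * (∑ q ∈ diffTriples P, e (secondDiff q * t)).re := by
  have hP' : (1 : ℝ) ≤ P := by exact_mod_cast hP
  set g : ℕ → ℂ := fun h => ∑ y ∈ Icc 1 (P - h), e ((3 * h * y ^ 2 + 3 * h ^ 2 * y) * t) with hg
  have h1 : ‖cubeSum P t‖ ^ 2 ≤ P + 2 * ∑ h ∈ Icc 1 P, ‖g h‖ := by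
    rw [cubeSum, normSq_sum_e_eq (fun m => (m : ℝ) ^ 3 * t)]
    gcongr
    refine (Complex.re_le_norm _).trans ((norm_sum_le _ _).trans (sum_le_sum fun h _ => ?_))
    have : ∑ y ∈ Icc 1 (P - h), e (((y + h : ℕ) : ℝ) ^ 3 * t - (y : ℝ) ^ 3 * t)
        = e ((h : ℝ) ^ 3 * t) * g h := by
      rw [hg, mul_sum]; refine sum_congr rfl fun y _ => ?_
      rw [← e_add]; congr 1; push_cast; ring
    rw [this, norm_mul, norm_e, one_mul]
  have h2 : (∑ h ∈ Icc 1 P, ‖g h‖) ^ 2 ≤ P * ∑ h ∈ Icc 1 P, ‖g h‖ ^ 2 := by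
    have := sq_sum_le_card_mul_sum_sq (s := Icc 1 P) (f := fun h => ‖g h‖)
    rwa [Nat.card_Icc, Nat.add_sub_cancel] at this
  have h3 : ∑ h ∈ Icc 1 P, ‖g h‖ ^ 2
      ≤ (P : ℝ) ^ 2 + 2 * (∑ q ∈ diffTriples P, e (secondDiff q * t)).re := by
    have h4 : ∀ h ∈ Icc 1 P, ‖g h‖ ^ 2 ≤ P + 2 * (∑ k ∈ Icc 1 (P - h), ∑ y ∈ Icc 1 (P - h - k),
        e (secondDiff (h, k, y) * t)).re := by
      intro h _
      rw [hg, normSq_sum_e_eq (fun y => (3 * (h : ℝ) * (y : ℝ) ^ 2 + 3 * (h : ℝ) ^ 2 * y) * t)]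
      have hle : ((P - h : ℕ) : ℝ) ≤ P := by exact_mod_cast Nat.sub_le _ _
      have heq : ∑ k ∈ Icc 1 (P - h), ∑ y ∈ Icc 1 (P - h - k),
          e ((3 * (h : ℝ) * ((y + k : ℕ) : ℝ) ^ 2 + 3 * (h : ℝ) ^ 2 * ((y + k : ℕ) : ℝ)) * t
            - (3 * (h : ℝ) * (y : ℝ) ^ 2 + 3 * (h : ℝ) ^ 2 * y) * t)
          = ∑ k ∈ Icc 1 (P - h), ∑ y ∈ Icc 1 (P - h - k), e (secondDiff (h, k, y) * t) := by
        refine sum_congr rfl fun k _ => sum_congr rfl fun y _ => ?_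
        congr 1; simp only [secondDiff]; push_cast; ring
      rw [heq]; linarith
    refine (sum_le_sum h4).trans (le_of_eq ?_)
    rw [sum_add_distrib, ← mul_sum, ← Complex.re_sum]
    congr 1
    · simp [sq]
    · congr 2
      rw [diffTriples, sum_filter, sum_product]
      refine sum_congr rfl fun h _ => ?_
      rw [sum_product, sum_sigma', sum_sigma', ← sum_filter]
      refine sum_congr ?_ fun _ _ => rfl
      ext ⟨k, y⟩
      simp only [mem_sigma, mem_filter, mem_Icc]; omega
  set W := (∑ q ∈ diffTriples P, e (secondDiff q * t)).re
  set S := ∑ h ∈ Icc 1 P, ‖g h‖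
  calc ‖cubeSum P t‖ ^ 4 = (‖cubeSum P t‖ ^ 2) ^ 2 := by ring
    _ ≤ (P + 2 * S) ^ 2 := pow_le_pow_left₀ (by positivity) h1 2
    _ ≤ 2 * (P : ℝ) ^ 2 + 8 * S ^ 2 := by nlinarith [sq_nonneg ((P : ℝ) - 2 * S)]
    _ ≤ 2 * (P : ℝ) ^ 2 + 8 * (P * ((P : ℝ) ^ 2 + 2 * W)) := by
        have := mul_le_mul_of_nonneg_left h3 (by linarith : (0 : ℝ) ≤ P)
        linarith
    _ ≤ _ := by nlinarith [sq_nonneg (P : ℝ)]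

/-- Both h and k divide ν, and together they determine y. -/
lemma card_secondDiff_eq_le (P ν : ℕ) :
    ((diffTriples P).filter fun q => secondDiff q = ν).card ≤ ν.divisors.card ^ 2 := by
  rw [sq, ← card_product]
  refine card_le_card_of_injOn (fun q => (q.1, q.2.1)) ?_ ?_
  · rintro ⟨h, k, y⟩ hq
    simp only [diffTriples, coe_filter, Set.mem_ofPred_eq, mem_filter, mem_product, mem_Icc] at hq
    obtain ⟨⟨⟨⟨h1, -⟩, ⟨k1, -⟩, -⟩, -⟩, rfl⟩ := hq
    simp only [secondDiff, coe_product, Set.mem_prod, mem_coe, Nat.mem_divisors]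
    have hpos : 0 < 3 * h * k ^ 2 := by positivity
    refine ⟨⟨⟨6 * k * y + 3 * k ^ 2 + 3 * h * k, by ring⟩, by omega⟩,
      ⟨⟨6 * h * y + 3 * h * k + 3 * h ^ 2, by ring⟩, by omega⟩⟩
  · rintro ⟨h, k, y⟩ hq ⟨h', k', y'⟩ hq' heq
    simp only [diffTriples, coe_filter, Set.mem_ofPred_eq, mem_filter, mem_product, mem_Icc]
      at hq hq'
    obtain ⟨⟨⟨⟨h1, -⟩, ⟨k1, -⟩, -⟩, -⟩, hν⟩ := hq
    obtain ⟨-, hν'⟩ := hq'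
    simp only [Prod.mk.injEq] at heq
    obtain ⟨rfl, rfl⟩ := heq
    simp only [secondDiff] at hν hν'
    have hpos : 0 < 6 * h * k := by positivity
    have : 6 * h * k * y = 6 * h * k * y' := by omega
    rw [Nat.eq_of_mul_eq_mul_left hpos this]

/-- The number of `1 ≤ x, y ≤ P` with `x³ + y³ = n`. -/
def twoCubes (P n : ℕ) : ℕ :=
  ((Icc 1 P ×ˢ Icc 1 P).filter fun p => p.1 ^ 3 + p.2 ^ 3 = n).card

/-- The factor x + y divides n, and with x³ + y³ it fixes the product x y, hence the unordered pair.
Splitting according to x ≤ y makes (x, y) ↦ x + y injective on each half. -/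
lemma twoCubes_le (P : ℕ) {n : ℕ} (hn : 1 ≤ n) : twoCubes P n ≤ 2 * n.divisors.card := by
  have hinj : ∀ x y x' y' : ℕ, x ^ 3 + y ^ 3 = n → x' ^ 3 + y' ^ 3 = n → x + y = x' + y' →
      1 ≤ x → (x = x' ∧ y = y') ∨ (x = y' ∧ y = x') := by
    intro x y x' y' h1 h2 h3 h4
    zify at h1 h2 h3 h4 ⊢
    have h5 : 3 * ((x : ℤ) + y) * (x * y - x' * y') = 0 := by
      linear_combination h2 - h1 + (((x : ℤ) + y) ^ 2 + (x + y) * (x' + y') + (x' + y') ^ 2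
        - 3 * x' * y') * h3
    have h6 : (x : ℤ) * y - x' * y' = 0 := by
      rcases mul_eq_zero.1 h5 with h | h
      · have : (0 : ℤ) ≤ y := Int.natCast_nonneg y
        omega
      · exact h
    have h7 : ((x : ℤ) - x') * (x - y') = 0 := by
      linear_combination (x : ℤ) * h3 - h6
    rcases mul_eq_zero.1 h7 with h | h
    · left; constructor <;> linarith
    · right; constructor <;> linarith
  have hdvd : ∀ x y : ℕ, x ^ 3 + y ^ 3 = n → x + y ∈ n.divisors := by
    intro x y h
    rw [Nat.mem_divisors]
    refine ⟨?_, by omega⟩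
    zify
    refine ⟨(x : ℤ) ^ 2 - x * y + y ^ 2, ?_⟩
    rw [← h]; push_cast; ring
  have hA : ∀ r : ℕ → ℕ → Prop, ∀ [DecidableRel r],
      (∀ x y, r x y → r y x → x = y) →
      (((Icc 1 P ×ˢ Icc 1 P).filter fun p => p.1 ^ 3 + p.2 ^ 3 = n).filter
        fun p => r p.1 p.2).card ≤ n.divisors.card := by
    intro r _ hr
    refine card_le_card_of_injOn (fun p => p.1 + p.2) ?_ ?_
    · rintro ⟨x, y⟩ hp
      simp only [coe_filter, Set.mem_ofPred_eq, mem_filter] at hp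
      exact hdvd x y hp.1.2
    · rintro ⟨x, y⟩ hp ⟨x', y'⟩ hp' heq
      simp only [coe_filter, Set.mem_ofPred_eq, mem_filter, mem_product, mem_Icc] at hp hp'
      rcases hinj x y x' y' hp.1.2 hp'.1.2 heq hp.1.1.1.1 with ⟨rfl, rfl⟩ | ⟨rfl, rfl⟩
      · rfl
      · have := hr x y hp.2 hp'.2
        subst this; rfl
  rw [twoCubes, ← card_filter_add_card_filter_not (p := fun p : ℕ × ℕ => p.1 ≤ p.2), two_mul]
  refine add_le_add (hA (fun x y => x ≤ y) fun x y h h' => le_antisymm h h') ?_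
  exact hA (fun x y => ¬ x ≤ y) fun x y h h' => by omega

lemma cubeSum_sq_eq (P : ℕ) (t : ℝ) :
    cubeSum P t ^ 2 = trig (2 * P ^ 3) (fun n => (twoCubes P n : ℂ)) t := by
  have h1 : ∀ n : ℕ, (twoCubes P n : ℂ) * e (n * t) = ∑ x ∈ Icc 1 P, ∑ y ∈ Icc 1 P,
      if x ^ 3 + y ^ 3 = n then e (n * t) else 0 := by
    intro n
    rw [twoCubes, card_filter]; push_cast
    rw [sum_mul, sum_product]
    refine sum_congr rfl fun x _ => sum_congr rfl fun y _ => ?_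
    split_ifs <;> simp
  simp only [trig, h1]
  rw [sq, cubeSum, sum_mul_sum]
  conv_rhs => rw [sum_comm]
  refine sum_congr rfl fun x hx => ?_
  conv_rhs => rw [sum_comm]
  refine sum_congr rfl fun y hy => ?_
  simp only [mem_Icc] at hx hy
  have hx3 := Nat.pow_le_pow_left hx.2 3
  have hy3 := Nat.pow_le_pow_left hy.2 3
  have hx1 := Nat.one_le_pow 3 x hx.1
  rw [sum_ite_eq, if_pos (by simp only [mem_Icc]; omega), ← e_add]
  congr 1; push_cast; ring

lemma sum_twoCubes (P : ℕ) : ∑ n ∈ Icc 1 (2 * P ^ 3), (twoCubes P n : ℝ) = (P : ℝ) ^ 2 := by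
  have h := cubeSum_sq_eq P 0
  simp only [cubeSum, trig, mul_zero, e_zero, mul_one, sum_const, Nat.card_Icc, nsmul_eq_mul,
    Nat.add_sub_cancel] at h
  exact_mod_cast h.symm

/-- By Parseval the sixth moment is the mean square of the count over the box [1, P]³. That count
equals r3 up to X, and what lies beyond is nonnegative. -/
lemma sum_r3_sq_le_gridAvg {X P N : ℕ} (h1 : X ≤ P ^ 3) (h2 : X < (P + 1) ^ 3)
    (hN : 3 * P ^ 3 ≤ N) :
    ∑ n ∈ Icc 1 X, (r3 n : ℝ) ^ 2 ≤ gridAvg N (fun t => ‖cubeSum P t‖ ^ 6) := by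
  set u : ℕ → ℕ := fun n => ((Icc 1 P ×ˢ Icc 1 P ×ˢ Icc 1 P).filter
      (fun p => p.1 ^ 3 + p.2.1 ^ 3 + p.2.2 ^ 3 = n)).card with hu
  have h3 : ∀ t, cubeSum P t ^ 3 = trig (3 * P ^ 3) (fun n => (u n : ℂ)) t := by
    intro t
    have h1 : ∀ n : ℕ, (u n : ℂ) * e (n * t) = ∑ x ∈ Icc 1 P, ∑ y ∈ Icc 1 P, ∑ z ∈ Icc 1 P,
        if x ^ 3 + y ^ 3 + z ^ 3 = n then e (n * t) else 0 := by
      intro n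
      simp only [hu]
      rw [card_filter]; push_cast
      rw [sum_mul, sum_product]
      refine sum_congr rfl fun x _ => ?_
      rw [sum_product]
      refine sum_congr rfl fun y _ => sum_congr rfl fun z _ => ?_
      split_ifs <;> simp
    simp only [trig, h1]
    rw [pow_three', cubeSum, sum_mul_sum, sum_mul, sum_comm]
    refine sum_congr rfl fun x hx => ?_
    rw [sum_mul, sum_comm]
    refine sum_congr rfl fun y hy => ?_
    rw [mul_sum, sum_comm]
    refine sum_congr rfl fun z hz => ?_
    simp only [mem_Icc] at hx hy hz
    have hx3 := Nat.pow_le_pow_left hx.2 3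
    have hy3 := Nat.pow_le_pow_left hy.2 3
    have hz3 := Nat.pow_le_pow_left hz.2 3
    have hx1 := Nat.one_le_pow 3 x hx.1
    rw [sum_ite_eq, if_pos (by simp only [mem_Icc]; omega), ← e_add, ← e_add]
    congr 1; push_cast; ring
  have h4 : ∀ t, ‖cubeSum P t‖ ^ 6 = ‖trig (3 * P ^ 3) (fun n => (u n : ℂ)) t‖ ^ 2 := by
    intro t; rw [← h3, norm_pow]; ring
  simp only [h4]
  rw [gridAvg_normSq_trig hN]
  calc _ = ∑ n ∈ Icc 1 X, ‖(u n : ℂ)‖ ^ 2 := by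
        refine sum_congr rfl fun n hn => ?_
        rw [r3_eq (lt_of_le_of_lt (mem_Icc.1 hn).2 h2), Complex.norm_natCast]
    _ ≤ _ := by
        refine sum_le_sum_of_subset_of_nonneg (Icc_subset_Icc_right ?_) fun _ _ _ => by positivity
        omega

lemma gridAvg_pow_four_le {P N : ℕ} (hN : 2 * P ^ 3 ≤ N) {T : ℝ}
    (hT : ∀ n ∈ Icc 1 (2 * P ^ 3), (n.divisors.card : ℝ) ≤ T) :
    gridAvg N (fun t => ‖cubeSum P t‖ ^ 4) ≤ 2 * T * (P : ℝ) ^ 2 := by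
  have h4 : ∀ t, ‖cubeSum P t‖ ^ 4 = ‖trig (2 * P ^ 3) (fun n => (twoCubes P n : ℂ)) t‖ ^ 2 := by
    intro t; rw [← cubeSum_sq_eq, norm_pow]; ring
  simp only [h4]
  rw [gridAvg_normSq_trig hN, ← sum_twoCubes, mul_sum]
  refine sum_le_sum fun n hn => ?_
  rw [Complex.norm_natCast, sq]
  refine mul_le_mul_of_nonneg_right ?_ (Nat.cast_nonneg _)
  have : (twoCubes P n : ℝ) ≤ 2 * n.divisors.card := by
    exact_mod_cast twoCubes_le P (mem_Icc.1 hn).1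
  linarith [hT n hn]

lemma gridAvg_e_mul_normSq_trig {D N n : ℕ} (hN : D + n < N) (u : ℕ → ℂ) :
    gridAvg N (fun t => e (n * t) * ((‖trig D u t‖ ^ 2 : ℝ) : ℂ))
      = ∑ m ∈ Icc 1 D, ∑ m' ∈ Icc 1 D, u m' * (starRingEnd ℂ) (u m) *
        (if m = m' + n then 1 else 0) := by
  have key : ∀ t : ℝ, e (n * t) * ((‖trig D u t‖ ^ 2 : ℝ) : ℂ)
      = ∑ m ∈ Icc 1 D, ∑ m' ∈ Icc 1 D, u m' * (starRingEnd ℂ) (u m) *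
        e (((m' : ℤ) - (m : ℤ) + (n : ℤ) : ℤ) * t) := by
    intro t
    rw [normSq_trig, mul_sum]
    refine sum_congr rfl fun m _ => ?_
    rw [mul_sum]
    refine sum_congr rfl fun m' _ => ?_
    have : (((m' : ℤ) - (m : ℤ) + (n : ℤ) : ℤ) : ℝ) * t
      = (((m' : ℤ) - (m : ℤ) : ℤ) : ℝ) * t + n * t := by push_cast; ring
    rw [this, e_add]; ring
  simp only [key, gridAvg_sum, gridAvg_const_mul]
  refine sum_congr rfl fun m hm => sum_congr rfl fun m' hm' => ?_
  simp only [mem_Icc] at hm hm'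
  rw [gridAvg_e (by rw [abs_lt]; constructor <;> omega)]
  congr 1
  exact if_congr (by omega) rfl rfl

/-- Insert the differencing bound for one factor ‖f‖⁴ and Parseval for the other. The average counts
solutions of m = m' + second difference, where m and m' are sums of two cubes: P⁴ weighted pairs,
each with at most T² triples. Frequencies stay within 2P³ + 12P³. -/
lemma gridAvg_pow_eight_le {P N : ℕ} (hP : 1 ≤ P) (hN : 14 * P ^ 3 < N) {T : ℝ} (hT1 : 1 ≤ T)
    (hT : ∀ n ∈ Icc 1 (2 * P ^ 3), (n.divisors.card : ℝ) ≤ T) :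
    gridAvg N (fun t => ‖cubeSum P t‖ ^ 8) ≤ 36 * T ^ 2 * (P : ℝ) ^ 5 := by
  have hP' : (1 : ℝ) ≤ P := by exact_mod_cast hP
  set D := 2 * P ^ 3 with hD
  set u : ℕ → ℂ := fun n => (twoCubes P n : ℂ) with hu
  have h4 : ∀ t, ‖cubeSum P t‖ ^ 4 = ‖trig D u t‖ ^ 2 := by
    intro t; rw [← cubeSum_sq_eq, norm_pow]; ring
  have hle : ∀ t, ‖cubeSum P t‖ ^ 8 ≤ 10 * (P : ℝ) ^ 3 * ‖cubeSum P t‖ ^ 4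
      + 16 * P * (∑ q ∈ diffTriples P, e (secondDiff q * t) *
        ((‖trig D u t‖ ^ 2 : ℝ) : ℂ)).re := by
    intro t
    have h5 := mul_le_mul_of_nonneg_right (norm_cubeSum_pow_four_le hP t)
      (by positivity : 0 ≤ ‖cubeSum P t‖ ^ 4)
    rw [← sum_mul, Complex.re_mul_ofReal, ← h4]
    nlinarith
  have hre : ∀ F : ℝ → ℂ, gridAvg N (fun t => (F t).re) = (gridAvg N F).re := by
    intro F; simp [gridAvg, Complex.re_sum]
  have hmain : (gridAvg N (fun t => ∑ q ∈ diffTriples P, e (secondDiff q * t) *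
        ((‖trig D u t‖ ^ 2 : ℝ) : ℂ))).re ≤ T ^ 2 * (P : ℝ) ^ 4 := by
    rw [gridAvg_sum]
    have hq : ∀ q ∈ diffTriples P, gridAvg N (fun t => e (secondDiff q * t) *
        ((‖trig D u t‖ ^ 2 : ℝ) : ℂ)) = ((∑ m ∈ Icc 1 D, ∑ m' ∈ Icc 1 D,
          (twoCubes P m' : ℝ) * twoCubes P m * (if m = m' + secondDiff q then 1 else 0) : ℝ) : ℂ) := by
      intro q hq
      simp only [diffTriples, mem_filter, mem_product, mem_Icc] at hq
      obtain ⟨⟨⟨h1, h1'⟩, ⟨h2, h2'⟩, h3, h3'⟩, h4⟩ := hq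
      rw [gridAvg_e_mul_normSq_trig]
      · push_cast
        refine sum_congr rfl fun m _ => sum_congr rfl fun m' _ => ?_
        split_ifs <;> simp [hu]
      · have e1 : 6 * q.1 * q.2.1 * q.2.2 ≤ 6 * P * P * P := by gcongr
        have e2 : 3 * q.1 * q.2.1 ^ 2 ≤ 3 * P * P ^ 2 := by gcongr
        have e3 : 3 * q.1 ^ 2 * q.2.1 ≤ 3 * P ^ 2 * P := by gcongr
        have : 6 * P * P * P + 3 * P * P ^ 2 + 3 * P ^ 2 * P = 12 * P ^ 3 := by ring
        simp only [secondDiff, hD]; omega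
    rw [sum_congr rfl hq, ← Complex.ofReal_sum, Complex.ofReal_re, sum_comm]
    calc _ = ∑ m ∈ Icc 1 D, ∑ m' ∈ Icc 1 D, (twoCubes P m' : ℝ) * twoCubes P m *
          ∑ q ∈ diffTriples P, (if m = m' + secondDiff q then (1 : ℝ) else 0) := by
          refine sum_congr rfl fun m _ => ?_
          rw [sum_comm]
          exact sum_congr rfl fun m' _ => by rw [mul_sum]
      _ ≤ ∑ m ∈ Icc 1 D, ∑ m' ∈ Icc 1 D, (twoCubes P m' : ℝ) * twoCubes P m * T ^ 2 := by
          refine sum_le_sum fun m hm => sum_le_sum fun m' hm' =>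
            mul_le_mul_of_nonneg_left ?_ (by positivity)
          simp only [mem_Icc] at hm hm'
          have hcard : ∑ q ∈ diffTriples P, (if m = m' + secondDiff q then (1 : ℝ) else 0)
              = (((diffTriples P).filter fun q => m = m' + secondDiff q).card : ℝ) := by
            rw [card_filter]; push_cast; rfl
          rw [hcard]
          rcases Nat.lt_or_ge m' m with h | h
          · have hsub : (diffTriples P).filter (fun q => m = m' + secondDiff q)
                = (diffTriples P).filter fun q => secondDiff q = m - m' :=
              filter_congr fun q _ => by omega
            rw [hsub]
            have h6 := hT (m - m') (by simp only [mem_Icc]; omega)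
            calc _ ≤ (((m - m').divisors.card ^ 2 : ℕ) : ℝ) := by
                  exact_mod_cast card_secondDiff_eq_le P (m - m')
              _ ≤ T ^ 2 := by
                  push_cast; exact pow_le_pow_left₀ (Nat.cast_nonneg _) h6 2
          · rw [filter_false_of_mem]
            · simp; positivity
            · intro q hq
              simp only [diffTriples, mem_filter, mem_product, mem_Icc] at hq
              have : 0 < 3 * q.1 * q.2.1 ^ 2 :=
                Nat.mul_pos (by omega) (pow_pos (by omega) 2)
              simp only [secondDiff]; omega
      _ = _ := by
          simp only [← sum_mul, ← mul_sum]
          rw [sum_twoCubes]; ring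
  have h6 := gridAvg_pow_four_le (N := N) (by omega) hT
  calc _ ≤ gridAvg N (fun t => 10 * (P : ℝ) ^ 3 * ‖cubeSum P t‖ ^ 4
      + 16 * P * (∑ q ∈ diffTriples P, e (secondDiff q * t) *
        ((‖trig D u t‖ ^ 2 : ℝ) : ℂ)).re) := gridAvg_mono hle
    _ = 10 * (P : ℝ) ^ 3 * gridAvg N (fun t => ‖cubeSum P t‖ ^ 4)
      + 16 * P * (gridAvg N (fun t => ∑ q ∈ diffTriples P, e (secondDiff q * t) *
        ((‖trig D u t‖ ^ 2 : ℝ) : ℂ))).re := by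
        rw [gridAvg_add, gridAvg_real_const_mul, gridAvg_real_const_mul, hre]
    _ ≤ 10 * (P : ℝ) ^ 3 * (2 * T * (P : ℝ) ^ 2) + 16 * P * (T ^ 2 * (P : ℝ) ^ 4) := by
        gcongr
    _ = (20 * T + 16 * T ^ 2) * (P : ℝ) ^ 5 := by ring
    _ ≤ _ := by
        refine mul_le_mul_of_nonneg_right ?_ (by positivity)
        nlinarith

/-- Hua's bound `∑_{n ≤ X} r3(n)² ≪ X^{7/6 + ε}`. -/
lemma exists_sum_r3_sq_le {ε : ℝ} (hε : 0 < ε) : ∃ C : ℝ, 0 < C ∧ ∀ X : ℕ, 1 ≤ X →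
    ∑ n ∈ Icc 1 X, (r3 n : ℝ) ^ 2 ≤ C * (X : ℝ) ^ (7 / 6 + ε) := by
  obtain ⟨C, hC1, hC⟩ := card_divisors_le_rpow (ε := ε / 2) (by positivity)
  refine ⟨19 * (C * 16 ^ (ε / 2)) ^ 2 * 2 ^ (7 / 2 : ℝ), by positivity, fun X hX => ?_⟩
  have hX0 : (0 : ℝ) < X := by exact_mod_cast hX
  obtain ⟨P, hP1, hP2, hP3⟩ := exists_cube_root X
  have hP3 := hP3 hX
  have hP : 1 ≤ P := by
    by_contra h
    have : P = 0 := by omega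
    subst this; norm_num at hP1; omega
  have hP0 : (0 : ℝ) < P := by exact_mod_cast hP
  set T : ℝ := C * 16 ^ (ε / 2) * (X : ℝ) ^ (ε / 2) with hTdef
  have hT1 : 1 ≤ T := by
    have h1 : (1 : ℝ) ≤ 16 ^ (ε / 2) := Real.one_le_rpow (by norm_num) (by positivity)
    have h2 : (1 : ℝ) ≤ (X : ℝ) ^ (ε / 2) := Real.one_le_rpow (by exact_mod_cast hX) (by positivity)
    rw [hTdef]
    exact one_le_mul_of_one_le_of_one_le (one_le_mul_of_one_le_of_one_le hC1 h1) h2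
  have hP3X : (P : ℝ) ^ 3 ≤ 8 * X := by
    have h := pow_le_pow_left₀ hP0.le hP3 3
    rw [mul_pow, ← Real.rpow_natCast ((X : ℝ) ^ (1 / 3 : ℝ)), ← Real.rpow_mul hX0.le] at h
    norm_num at h; exact h
  have hT : ∀ n ∈ Icc 1 (2 * P ^ 3), (n.divisors.card : ℝ) ≤ T := by
    intro n hn
    simp only [mem_Icc] at hn
    refine (hC n hn.1).trans ?_
    rw [hTdef, mul_assoc, ← Real.mul_rpow (by norm_num) hX0.le]
    refine mul_le_mul_of_nonneg_left (Real.rpow_le_rpow (by positivity) ?_ (by positivity))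
      (by linarith)
    have : (n : ℝ) ≤ 2 * (P : ℝ) ^ 3 := by exact_mod_cast hn.2
    linarith
  set N := 14 * P ^ 3 + 1 with hN
  have h4 := gridAvg_pow_four_le (N := N) (by omega) hT
  have h8 := gridAvg_pow_eight_le (N := N) hP (by omega) hT1 hT
  have h6 := sum_r3_sq_le_gridAvg (N := N) hP1 hP2 (by omega)
  -- The weight balancing the fourth moment, about P², against the eighth, about P⁵: Cauchy–Schwarz
  -- for the sixth moment in pointwise form.
  set lam : ℝ := (P : ℝ) ^ (3 / 2 : ℝ) with hlam
  have hlam0 : 0 < lam := by positivity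
  have hpt : ∀ t, ‖cubeSum P t‖ ^ 6 ≤ lam / 2 * ‖cubeSum P t‖ ^ 4
      + 1 / (2 * lam) * ‖cubeSum P t‖ ^ 8 := by
    intro t
    have h9 : lam / 2 * ‖cubeSum P t‖ ^ 4 + 1 / (2 * lam) * ‖cubeSum P t‖ ^ 8 - ‖cubeSum P t‖ ^ 6
        = ‖cubeSum P t‖ ^ 4 * (lam - ‖cubeSum P t‖ ^ 2) ^ 2 / (2 * lam) := by
      field_simp; ring
    have : 0 ≤ ‖cubeSum P t‖ ^ 4 * (lam - ‖cubeSum P t‖ ^ 2) ^ 2 / (2 * lam) := by positivity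
    linarith
  have h10 := gridAvg_mono (N := N) hpt
  rw [gridAvg_add, gridAvg_real_const_mul, gridAvg_real_const_mul] at h10
  have e1 : lam * (P : ℝ) ^ 2 = (P : ℝ) ^ (7 / 2 : ℝ) := by
    rw [hlam, ← Real.rpow_natCast, ← Real.rpow_add hP0]; norm_num
  have e2 : (P : ℝ) ^ 5 = lam * (P : ℝ) ^ (7 / 2 : ℝ) := by
    rw [hlam, ← Real.rpow_natCast, ← Real.rpow_add hP0]; norm_num
  have e3 : lam / 2 * (2 * T * (P : ℝ) ^ 2) = T * (P : ℝ) ^ (7 / 2 : ℝ) := by rw [← e1]; ring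
  have e4 : 1 / (2 * lam) * (36 * T ^ 2 * (P : ℝ) ^ 5) = 18 * T ^ 2 * (P : ℝ) ^ (7 / 2 : ℝ) := by
    rw [e2]; field_simp; ring
  have h11 := mul_le_mul_of_nonneg_left h4 (by positivity : 0 ≤ lam / 2)
  have h12 := mul_le_mul_of_nonneg_left h8 (by positivity : 0 ≤ 1 / (2 * lam))
  rw [e3] at h11; rw [e4] at h12
  have hP72 : (P : ℝ) ^ (7 / 2 : ℝ) ≤ 2 ^ (7 / 2 : ℝ) * (X : ℝ) ^ (7 / 6 : ℝ) := by
    refine (Real.rpow_le_rpow hP0.le hP3 (by norm_num)).trans (le_of_eq ?_)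
    rw [Real.mul_rpow (by norm_num) (by positivity), ← Real.rpow_mul hX0.le]; norm_num
  calc _ ≤ 19 * T ^ 2 * (P : ℝ) ^ (7 / 2 : ℝ) := by
        have : T * (P : ℝ) ^ (7 / 2 : ℝ) ≤ T ^ 2 * (P : ℝ) ^ (7 / 2 : ℝ) :=
          mul_le_mul_of_nonneg_right (by nlinarith) (by positivity)
        linarith
    _ ≤ 19 * T ^ 2 * (2 ^ (7 / 2 : ℝ) * (X : ℝ) ^ (7 / 6 : ℝ)) :=
        mul_le_mul_of_nonneg_left hP72 (by positivity)
    _ = _ := by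
        have : ((X : ℝ) ^ (ε / 2)) ^ 2 = (X : ℝ) ^ ε := by
          rw [← Real.rpow_natCast, ← Real.rpow_mul hX0.le]; congr 1; push_cast; ring
        rw [hTdef, mul_pow _ ((X : ℝ) ^ (ε / 2)), this, Real.rpow_add hX0]; ring

/-! ### Correlations in residue classes: local estimates -/

lemma sum_comp_le_sum {s t : Finset ℕ} {g : ℕ → ℕ} {f : ℕ → ℝ} (hf : ∀ n, 0 ≤ f n)
    (hg : Set.InjOn g s) (hst : ∀ n ∈ s, g n ∈ t) : ∑ n ∈ s, f (g n) ≤ ∑ n ∈ t, f n := by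
  rw [← sum_image (f := f) hg]
  refine sum_le_sum_of_subset_of_nonneg (fun x hx => ?_) fun _ _ _ => hf _
  obtain ⟨n, hn, rfl⟩ := mem_image.1 hx
  exact hst n hn

/-- The number of `m, n ≤ X` with `n - m > y`. -/
def pairCount (X y : ℕ) : ℝ := ∑ m ∈ Icc 1 X, ∑ n ∈ Icc 1 X, if m + y < n then 1 else 0

lemma pairCount_nonneg (X y : ℕ) : 0 ≤ pairCount X y :=
  sum_nonneg fun _ _ => sum_nonneg fun _ _ => by split_ifs <;> norm_num

lemma pairCount_le (X y : ℕ) : pairCount X y ≤ (X : ℝ) ^ 2 := by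
  calc pairCount X y ≤ ∑ m ∈ Icc 1 X, ∑ n ∈ Icc 1 X, (1 : ℝ) :=
        sum_le_sum fun _ _ => sum_le_sum fun _ _ => by split_ifs <;> norm_num
    _ = _ := by simp [sq]

/-- The total size of the partial sums of `w` up to `X`. -/
def partialTot (X : ℕ) (w : ℕ → ℂ) : ℝ :=
  X * ‖∑ n ∈ Icc 1 X, w n‖ + ∑ z ∈ Icc 1 X, ‖∑ n ∈ Icc 1 z, w n‖

/-- The inner sum is a difference of two partial sums of w. As m varies, the lower ends m + y are
distinct, so they are covered by the sum over all lengths in `partialTot`. -/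
lemma norm_sum_upper_le (X y : ℕ) (w : ℕ → ℂ) :
    ‖∑ m ∈ Icc 1 X, ∑ n ∈ Icc 1 X, (if m + y < n then w n else 0)‖ ≤ partialTot X w := by
  have h1 : ∀ m ∈ Icc 1 X, ‖∑ n ∈ Icc 1 X, (if m + y < n then w n else 0)‖
      ≤ ‖∑ n ∈ Icc 1 X, w n‖
        + if m + y ≤ X then ‖∑ n ∈ Icc 1 (m + y), w n‖ else 0 := by
    intro m hm
    rw [← sum_filter]
    split_ifs with h
    · have h2 : ∑ n ∈ (Icc 1 X).filter (fun n => m + y < n), w n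
          = ∑ n ∈ Icc 1 X, w n - ∑ n ∈ Icc 1 (m + y), w n := by
        rw [eq_sub_iff_add_eq, ← sum_union]
        · refine sum_congr ?_ fun _ _ => rfl
          ext n; simp only [mem_union, mem_filter, mem_Icc]; omega
        · rw [disjoint_left]; intro n; simp only [mem_filter, mem_Icc]; omega
      rw [h2]; exact norm_sub_le _ _
    · rw [filter_false_of_mem (fun n hn => by simp only [mem_Icc] at hn; omega)]
      simp
  refine (norm_sum_le _ _).trans ((sum_le_sum h1).trans ?_)
  rw [sum_add_distrib, partialTot, ← sum_filter]
  refine add_le_add (by simp) ?_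
  refine sum_comp_le_sum (f := fun z => ‖∑ n ∈ Icc 1 z, w n‖) (g := fun m => m + y)
    (fun _ => norm_nonneg _) (fun a _ b _ h => by simpa using h) fun m hm => ?_
  simp only [mem_filter, mem_Icc] at hm ⊢; omega

lemma norm_sum_lower_le (X y : ℕ) (w : ℕ → ℂ) :
    ‖∑ m ∈ Icc 1 X, ∑ n ∈ Icc 1 X, (if m + y < n then w m else 0)‖ ≤ partialTot X w := by
  rw [sum_comm]
  have h1 : ∀ n ∈ Icc 1 X, ‖∑ m ∈ Icc 1 X, (if m + y < n then w m else 0)‖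
      = if y + 1 < n then ‖∑ m ∈ Icc 1 (n - y - 1), w m‖ else 0 := by
    intro n hn
    simp only [mem_Icc] at hn
    rw [← sum_filter]
    have h2 : (Icc 1 X).filter (fun m => m + y < n) = Icc 1 (n - y - 1) := by
      ext m; simp only [mem_filter, mem_Icc]; omega
    rw [h2]
    split_ifs with h
    · rfl
    · rw [show n - y - 1 = 0 by omega]; simp
  refine (norm_sum_le _ _).trans ?_
  rw [sum_congr rfl h1, partialTot, ← sum_filter]
  have h3 : ∑ n ∈ (Icc 1 X).filter (fun n => y + 1 < n), ‖∑ m ∈ Icc 1 (n - y - 1), w m‖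
      ≤ ∑ z ∈ Icc 1 X, ‖∑ n ∈ Icc 1 z, w n‖ := by
    refine sum_comp_le_sum (f := fun z => ‖∑ n ∈ Icc 1 z, w n‖) (g := fun n => n - y - 1)
      (fun _ => norm_nonneg _) (fun a ha b hb h => ?_) fun m hm => ?_
    · simp only [coe_filter, Set.mem_ofPred_eq, mem_Icc] at ha hb h; omega
    · simp only [mem_filter, mem_Icc] at hm ⊢; omega
  have : 0 ≤ (X : ℝ) * ‖∑ n ∈ Icc 1 X, w n‖ := by positivity
  linarith

/-- Expand the Hermitian form: the constant against itself is the main term, and the two mixed terms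
are linear in w and see only its partial sums. -/
lemma norm_corr_add_const_sub_le (X y : ℕ) (w : ℕ → ℂ) (μ : ℂ) :
    ‖corr X y (fun n => w n + μ) - ((‖μ‖ ^ 2 * pairCount X y : ℝ) : ℂ)‖
      ≤ ‖corr X y w‖ + 2 * ‖μ‖ * partialTot X w := by
  have h1 : corr X y (fun n => w n + μ) - ((‖μ‖ ^ 2 * pairCount X y : ℝ) : ℂ) = corr X y w
      + (starRingEnd ℂ) μ * (∑ m ∈ Icc 1 X, ∑ n ∈ Icc 1 X, (if m + y < n then w n else 0))
      + μ * (starRingEnd ℂ) (∑ m ∈ Icc 1 X, ∑ n ∈ Icc 1 X, (if m + y < n then w m else 0)) := by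
    rw [sub_eq_iff_eq_add]
    simp only [corr, pairCount]
    push_cast
    rw [map_sum, mul_sum, mul_sum, mul_sum, ← sum_add_distrib, ← sum_add_distrib,
      ← sum_add_distrib]
    refine sum_congr rfl fun m _ => ?_
    rw [map_sum, mul_sum, mul_sum, mul_sum, ← sum_add_distrib, ← sum_add_distrib,
      ← sum_add_distrib]
    refine sum_congr rfl fun n _ => ?_
    split_ifs
    · rw [← Complex.mul_conj', map_add]; push_cast; ring
    · simp
  rw [h1]
  refine (norm_add_le _ _).trans ?_
  have h2 := norm_add_le (corr X y w) ((starRingEnd ℂ) μ *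
    (∑ m ∈ Icc 1 X, ∑ n ∈ Icc 1 X, (if m + y < n then w n else 0)))
  rw [norm_mul, Complex.norm_conj] at h2
  rw [norm_mul, Complex.norm_conj]
  have h3 := mul_le_mul_of_nonneg_left (norm_sum_upper_le X y w) (norm_nonneg μ)
  have h4 := mul_le_mul_of_nonneg_left (norm_sum_lower_le X y w) (norm_nonneg μ)
  linarith

/-- The point 0 always counts, so ρ must not fall below the mesh; then at most ρN + 1 ≤ 2ρN grid
points lie on each side. -/
lemma gridAvg_nd_le {N : ℕ} {ρ : ℝ} (hN : 0 < N) (hρ : 1 / (N : ℝ) ≤ ρ) :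
    gridAvg N (fun t => if nd t ≤ ρ then (1 : ℝ) else 0) ≤ 4 * ρ := by
  have hN' : (0 : ℝ) < N := by exact_mod_cast hN
  have hρ1 : 1 ≤ ρ * N := by rwa [div_le_iff₀ hN'] at hρ
  rw [gridAvg, smul_eq_mul, inv_mul_le_iff₀ hN', ← sum_filter, sum_const, nsmul_eq_mul, mul_one]
  set k := ⌊ρ * N⌋₊ with hk
  have hkle : (k : ℝ) ≤ ρ * N := Nat.floor_le (by linarith)
  have hsub : (range N).filter (fun j : ℕ => nd ((j : ℝ) / N) ≤ ρ)
      ⊆ range (k + 1) ∪ (range (k + 1)).image (fun i => N - i) := by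
    intro j hj
    simp only [mem_filter, mem_range] at hj
    obtain ⟨hjN, hnd⟩ := hj
    have hj0 : (0 : ℝ) ≤ (j : ℝ) / N := by positivity
    have hj1 : (j : ℝ) / N < 1 := by
      rw [div_lt_one hN']; exact_mod_cast hjN
    rw [nd, abs_sub_round_eq_min, Int.fract_eq_self.2 ⟨hj0, hj1⟩] at hnd
    simp only [mem_union, mem_range, mem_image]
    rcases min_le_iff.1 hnd with h | h
    · left
      rw [div_le_iff₀ hN'] at h
      have := Nat.le_floor h
      omega
    · right
      refine ⟨N - j, ?_, by omega⟩
      have h2 : ((N - j : ℕ) : ℝ) ≤ ρ * N := by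
        rw [Nat.cast_sub hjN.le]
        have : (1 - (j : ℝ) / N) * N = N - j := by field_simp
        rw [← this]
        exact mul_le_mul_of_nonneg_right h hN'.le
      have := Nat.le_floor h2
      omega
  have hcard : ((range N).filter (fun j : ℕ => nd ((j : ℝ) / N) ≤ ρ)).card
      ≤ (k + 1) + (k + 1) := by
    refine (card_le_card hsub).trans ((card_union_le _ _).trans ?_)
    refine add_le_add (by simp) (card_image_le.trans (by simp))
  have : (((range N).filter (fun j : ℕ => nd ((j : ℝ) / N) ≤ ρ)).card : ℝ)
      ≤ (k + 1) + (k + 1) := by exact_mod_cast hcard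
  linarith

lemma norm_trig_le_nd {X : ℕ} (hX : 0 < X) (w : ℕ → ℂ) (t : ℝ) :
    ‖trig X w t‖ ≤ 2 * Real.pi / X * (1 + X * nd t) * partialTot X w := by
  have hX' : (0 : ℝ) < X := by exact_mod_cast hX
  have h1 : trig X w t = trig X w (t - round t) := by
    simp only [trig]
    refine sum_congr rfl fun n _ => ?_
    have : (n : ℝ) * t = n * (t - round t) + ((n * round t : ℤ) : ℝ) := by push_cast; ring
    rw [this, e_add_int]
  rw [h1]
  refine (norm_trig_le X w _).trans ?_
  change ‖∑ n ∈ Icc 1 X, w n‖ + 2 * Real.pi * nd t * _ ≤ _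
  set A := ‖∑ n ∈ Icc 1 X, w n‖ with hA
  set S := ∑ z ∈ Icc 1 X, ‖∑ n ∈ Icc 1 z, w n‖ with hS
  have hA0 : 0 ≤ A := norm_nonneg _
  have hS0 : 0 ≤ S := sum_nonneg fun _ _ => norm_nonneg _
  have hnd := nd_nonneg t
  have hpi : 1 ≤ 2 * Real.pi := by linarith [Real.pi_gt_three]
  have h2 : 2 * Real.pi / X * (1 + X * nd t) * partialTot X w
      = 2 * Real.pi * A + 2 * Real.pi * nd t * S
        + 2 * Real.pi * X * nd t * A + 2 * Real.pi / X * S := by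
    rw [partialTot]; field_simp; ring
  rw [h2]
  have h3 : 0 ≤ 2 * Real.pi * X * nd t * A := by positivity
  have h4 : 0 ≤ 2 * Real.pi / X * S := by positivity
  nlinarith

/-- The quadratic form on a major arc and its complement. -/
lemma gridAvg_ker_le {X N d : ℕ} {R : ℝ} (hX : 0 < X) (hd : 0 < d) (hdR : (d : ℝ) ≤ R)
    (hN : X ≤ N) (w : ℕ → ℂ) :
    gridAvg N (fun t => ker X t * ‖trig X w t‖ ^ 2)
      ≤ 64 * Real.pi ^ 2 * (R / d) ^ 2 * (partialTot X w ^ 2 / (X : ℝ) ^ 2)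
        + gridAvg N (fun t => kerMin X R d t * ‖trig X w t‖ ^ 2) := by
  have hX' : (0 : ℝ) < X := by exact_mod_cast hX
  have hd' : (0 : ℝ) < d := by exact_mod_cast hd
  have hR : 0 < R := hd'.trans_le hdR
  have hRd : 1 ≤ R / d := by rwa [one_le_div hd']
  set V := partialTot X w
  set ρ := R / (d * X) with hρ
  have hρX : X * ρ = R / d := by rw [hρ]; field_simp
  -- On the arc one factor 1 + X‖t‖ is absorbed by the kernel and the other is at most 2R/d.
  -- Multiplying by the measure 4ρ of the arc gives the factor 64π² (R/d)².
  have hpt : ∀ t, ker X t * ‖trig X w t‖ ^ 2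
      ≤ (16 * Real.pi ^ 2 * (R / d) * (V ^ 2 / X)) * (if nd t ≤ ρ then (1 : ℝ) else 0)
        + kerMin X R d t * ‖trig X w t‖ ^ 2 := by
    intro t
    by_cases h : nd t ≤ ρ
    · rw [if_pos h, mul_one, kerMin, if_pos ⟨hdR, h⟩, zero_mul, add_zero]
      have h1 := pow_le_pow_left₀ (norm_nonneg _) (norm_trig_le_nd hX w t) 2
      have hnd := nd_nonneg t
      have hmax : (0 : ℝ) < max 1 (X * nd t) := lt_of_lt_of_le one_pos (le_max_left _ _)
      have h2 : ker X t * (1 + X * nd t) ≤ 2 * X := by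
        rw [ker, div_mul_eq_mul_div, div_le_iff₀ hmax]
        have := le_max_left (1 : ℝ) (X * nd t)
        have := le_max_right (1 : ℝ) (X * nd t)
        nlinarith
      have h3 : 1 + X * nd t ≤ 2 * (R / d) := by
        have := mul_le_mul_of_nonneg_left h hX'.le
        linarith
      calc ker X t * ‖trig X w t‖ ^ 2 ≤ ker X t * (2 * Real.pi / X * (1 + X * nd t) * V) ^ 2 :=
            mul_le_mul_of_nonneg_left h1 (ker_nonneg _ _)
        _ = (ker X t * (1 + X * nd t)) * (1 + X * nd t) * (4 * Real.pi ^ 2 * V ^ 2 / X ^ 2) := by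
            field_simp; ring
        _ ≤ (2 * X) * (2 * (R / d)) * (4 * Real.pi ^ 2 * V ^ 2 / X ^ 2) := by
            gcongr
        _ = _ := by field_simp; ring
    · rw [if_neg h, mul_zero, zero_add, kerMin, if_neg (fun h' => h h'.2)]
  refine (gridAvg_mono hpt).trans ?_
  rw [gridAvg_add, gridAvg_real_const_mul]
  have hN0 : 0 < N := lt_of_lt_of_le hX hN
  have h5 : 1 / (N : ℝ) ≤ ρ := by
    have h6 : 1 / (N : ℝ) ≤ 1 / X := one_div_le_one_div_of_le hX' (by exact_mod_cast hN)
    refine h6.trans ?_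
    rw [div_le_iff₀ hX', mul_comm, hρX]; exact hRd
  have h7 := mul_le_mul_of_nonneg_left (gridAvg_nd_le hN0 h5)
    (by positivity : 0 ≤ 16 * Real.pi ^ 2 * (R / d) * (V ^ 2 / X))
  have h8 : 16 * Real.pi ^ 2 * (R / d) * (V ^ 2 / X) * (4 * ρ)
      = 64 * Real.pi ^ 2 * (R / d) ^ 2 * (V ^ 2 / (X : ℝ) ^ 2) := by
    rw [hρ]; field_simp; ring
  linarith

/-- The mean square of `cubeGen` around `b / d`, off the major arc. -/
def minorTot (X N : ℕ) (R : ℝ) (d b : ℕ) : ℝ :=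
  gridAvg N (fun s => kerMin X R d (s - b / d) * ‖cubeGen X s‖ ^ 2)

lemma minorTot_nonneg (X N : ℕ) (R : ℝ) (d b : ℕ) : 0 ≤ minorTot X N R d b :=
  gridAvg_nonneg fun _ => mul_nonneg (kerMin_nonneg _ _ _ _) (by positivity)

/-- Recentring at b/d is a shift of the grid because d ∣ N. In the form of the definition every b/d
involves the same function of s, so the kernels can be summed first. -/
lemma minorTot_eq {X N d : ℕ} (R : ℝ) (b : ℕ) (hN : 0 < N) (hd : 0 < d) (hdN : d ∣ N) :
    minorTot X N R d b = gridAvg N (fun t => kerMin X R d t * ‖cubeGen X (t + b / d)‖ ^ 2) := by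
  obtain ⟨k, rfl⟩ := hdN
  have hd' : (d : ℝ) ≠ 0 := by positivity
  have hk : (k : ℝ) ≠ 0 := by
    have := Nat.pos_of_mul_pos_left hN
    positivity
  have h := gridAvg_shift hN (f := fun s => kerMin X R d (s - b / d) * ‖cubeGen X s‖ ^ 2)
    (fun t => by
      have h1 : t + 1 - (b : ℝ) / d = (t - b / d) + ((1 : ℤ) : ℝ) := by push_cast; ring
      rw [h1, kerMin_add_int, cubeGen, trig_add_one, ← cubeGen]) (b * k)
  rw [minorTot, ← h]
  have h2 : ((b * k : ℕ) : ℝ) / ((d * k : ℕ) : ℝ) = b / d := by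
    push_cast; rw [mul_div_mul_right _ _ hk]
  simp only [h2, add_sub_cancel_right]

lemma cubeGen_shift (X d b : ℕ) (t : ℝ) :
    cubeGen X (t + b / d) = trig X (fun n => r3 n * e (n * ((b : ℝ) / d))) t := by
  rw [cubeGen, trig_shift]

/-- The majorant of the error in the correlation at `b / d`. -/
def corrBound (X N : ℕ) (R : ℝ) (d b : ℕ) : ℝ :=
  2 * minorTot X N R d b + if (d : ℝ) ≤ R then
    64 * Real.pi ^ 2 * (R / d) ^ 2 * (partialTot X (dev d b) ^ 2 / (X : ℝ) ^ 2)
      + 2 * gam ^ 2 * (‖sg d b‖ ^ 6 * (d * (X : ℝ) ^ 2 / R))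
      + 2 * gam * (‖sg d b‖ ^ 3 * partialTot X (dev d b))
    else gam ^ 2 * (‖sg d b‖ ^ 6 * (X : ℝ) ^ 2)

lemma norm_gam_mul_sg (d b : ℕ) : ‖(gam : ℂ) * sg d b ^ 3‖ = gam * ‖sg d b‖ ^ 3 := by
  rw [norm_mul, Complex.norm_real, Real.norm_of_nonneg gam_pos.le, norm_pow]

/-- For d ≤ R the coefficients are split into mean and deviation. For d > R nothing is subtracted:
the whole correlation is a minor-arc quantity, and its expected value is itself counted as an error.
-/
lemma norm_corr_sub_le {X N d : ℕ} {R : ℝ} (y b : ℕ) (hX : 0 < X) (hR : 0 < R) (hN : 2 * X < N)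
    (hd : 0 < d) (hdN : d ∣ N) :
    ‖corr X y (fun n => r3 n * e (n * ((b : ℝ) / d)))
      - ((gam ^ 2 * ‖sg d b‖ ^ 6 * pairCount X y : ℝ) : ℂ)‖ ≤ corrBound X N R d b := by
  have hX' : (0 : ℝ) < X := by exact_mod_cast hX
  have hd' : (0 : ℝ) < d := by exact_mod_cast hd
  have hN0 : 0 < N := by omega
  set μ : ℂ := gam * sg d b ^ 3 with hμ
  have hμn : ‖μ‖ = gam * ‖sg d b‖ ^ 3 := norm_gam_mul_sg d b
  have hμ2 : gam ^ 2 * ‖sg d b‖ ^ 6 = ‖μ‖ ^ 2 := by rw [hμn]; ring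
  rw [hμ2, corrBound]
  split_ifs with hdR
  · have h1 : (fun n => (r3 n : ℂ) * e (n * ((b : ℝ) / d))) = fun n => dev d b n + μ := by
      funext n; simp [dev, hμ]
    rw [h1]
    refine (norm_corr_add_const_sub_le X y (dev d b) μ).trans ?_
    have h2 := (norm_sum_cutoff_le hN (dev d b) y).trans
      (gridAvg_ker_le hX hd hdR (by omega) (dev d b))
    -- Off the arc the mean is put back, since the generating function, unlike the deviation, does
    -- not depend on b/d. The mean alone is bounded by Parseval, as the kernel is at most dX/R
    -- there.
    have h3 : gridAvg N (fun t => kerMin X R d t * ‖trig X (dev d b) t‖ ^ 2)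
        ≤ 2 * minorTot X N R d b + 2 * ‖μ‖ ^ 2 * (d * (X : ℝ) ^ 2 / R) := by
      have hpt : ∀ t, kerMin X R d t * ‖trig X (dev d b) t‖ ^ 2
          ≤ 2 * (kerMin X R d t * ‖cubeGen X (t + b / d)‖ ^ 2)
            + (2 * ‖μ‖ ^ 2 * (d * X / R)) * ‖trig X (fun _ => 1) t‖ ^ 2 := by
        intro t
        have h4 : trig X (dev d b) t = cubeGen X (t + b / d) - μ * trig X (fun _ => 1) t := by
          rw [cubeGen_shift]
          simp only [trig, mul_sum, ← sum_sub_distrib]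
          refine sum_congr rfl fun n _ => ?_
          simp only [dev, hμ]; ring
        have h5 : ‖trig X (dev d b) t‖ ^ 2 ≤ 2 * ‖cubeGen X (t + b / d)‖ ^ 2
            + 2 * ‖μ‖ ^ 2 * ‖trig X (fun _ => 1) t‖ ^ 2 := by
          rw [h4]
          have h6 := pow_le_pow_left₀ (norm_nonneg _)
            (norm_sub_le (cubeGen X (t + b / d)) (μ * trig X (fun _ => 1) t)) 2
          rw [norm_mul] at h6
          nlinarith [sq_nonneg (‖cubeGen X (t + b / d)‖ - ‖μ‖ * ‖trig X (fun _ => 1) t‖)]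
        have h7 : kerMin X R d t ≤ d * X / R := by
          rw [kerMin]
          split_ifs with h
          · positivity
          · have h8 : R / (d * X) ≤ nd t := by
              by_contra hc
              exact h ⟨hdR, (not_le.1 hc).le⟩
            refine (ker_le_of_nd (by positivity) h8).trans (le_of_eq ?_)
            field_simp
        have h9 := mul_le_mul_of_nonneg_left h5 (kerMin_nonneg X R d t)
        have h10 := mul_le_mul_of_nonneg_right h7
          (by positivity : 0 ≤ 2 * ‖μ‖ ^ 2 * ‖trig X (fun _ => 1) t‖ ^ 2)
        linarith
      refine (gridAvg_mono hpt).trans ?_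
      rw [gridAvg_add, gridAvg_real_const_mul, gridAvg_real_const_mul,
        gridAvg_normSq_trig (by omega), ← minorTot_eq R b hN0 hd hdN]
      refine le_of_eq ?_
      simp; ring
    have h11 : 2 * gam ^ 2 * (‖sg d b‖ ^ 6 * (d * (X : ℝ) ^ 2 / R))
        = 2 * ‖μ‖ ^ 2 * (d * (X : ℝ) ^ 2 / R) := by rw [← hμ2]; ring
    have h12 : 2 * gam * (‖sg d b‖ ^ 3 * partialTot X (dev d b))
        = 2 * ‖μ‖ * partialTot X (dev d b) := by rw [hμn]; ring
    rw [h11, h12]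
    have h13 : ‖corr X y (dev d b)‖ ≤ 64 * Real.pi ^ 2 * (R / d) ^ 2 *
        (partialTot X (dev d b) ^ 2 / (X : ℝ) ^ 2)
        + gridAvg N (fun t => kerMin X R d t * ‖trig X (dev d b) t‖ ^ 2) := h2
    linarith
  · rw [not_le] at hdR
    have h1 := norm_sum_cutoff_le hN (fun n => r3 n * e (n * ((b : ℝ) / d))) y
    have h2 : gridAvg N (fun t => ker X t *
        ‖trig X (fun n => r3 n * e (n * ((b : ℝ) / d))) t‖ ^ 2) = minorTot X N R d b := by
      rw [minorTot_eq R b hN0 hd hdN]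
      simp only [cubeGen_shift, kerMin_of_lt hdR]
    rw [h2] at h1
    have h3 := minorTot_nonneg X N R d b
    refine (norm_sub_le _ _).trans ?_
    have h4 : ‖((‖μ‖ ^ 2 * pairCount X y : ℝ) : ℂ)‖ ≤ ‖μ‖ ^ 2 * (X : ℝ) ^ 2 := by
      rw [Complex.norm_real, Real.norm_of_nonneg (mul_nonneg (by positivity)
        (pairCount_nonneg X y))]
      exact mul_le_mul_of_nonneg_left (pairCount_le X y) (by positivity)
    have h5 : gam ^ 2 * (‖sg d b‖ ^ 6 * (X : ℝ) ^ 2) = ‖μ‖ ^ 2 * (X : ℝ) ^ 2 := by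
      rw [← hμ2]; ring
    rw [h5]
    have h6 : ‖corr X y (fun n => r3 n * e (n * ((b : ℝ) / d)))‖ ≤ minorTot X N R d b := h1
    linarith

lemma sum_abs_pairSum_sub_le {X N L : ℕ} {R : ℝ} (y : ℕ → ℕ) (hX : 0 < X) (hR : 0 < R)
    (hN : 2 * X < N) (hdN : ∀ d ∈ Icc 1 L, d ∣ N) :
    ∑ l ∈ Icc 1 L, |pairSum X l (y l) - gam ^ 2 * (hFun l / l) * pairCount X (y l)|
      ≤ (1 + Real.log L) * ∑ d ∈ Icc 1 L, 1 / (d : ℝ) * ∑ b ∈ cop d, corrBound X N R d b := by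
  set G : ℕ → ℕ → ℕ → ℝ := fun y d b => ‖corr X y (fun n => r3 n * e (n * ((b : ℝ) / d)))
      - ((gam ^ 2 * ‖sg d b‖ ^ 6 * pairCount X y : ℝ) : ℂ)‖ with hG
  have h1 : ∀ l ∈ Icc 1 L, |pairSum X l (y l) - gam ^ 2 * (hFun l / l) * pairCount X (y l)|
      ≤ 1 / (l : ℝ) * ∑ d ∈ l.divisors, ∑ b ∈ cop d, corrBound X N R d b := by
    intro l hl
    have hl0 : 0 < l := (mem_Icc.1 hl).1
    have h2 : ((pairSum X l (y l) - gam ^ 2 * (hFun l / l) * pairCount X (y l) : ℝ) : ℂ)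
        = (l : ℂ)⁻¹ * ∑ b ∈ Icc 1 l, (corr X (y l) (fun n => r3 n * e (n * ((b : ℝ) / l)))
          - ((gam ^ 2 * ‖sg l b‖ ^ 6 * pairCount X (y l) : ℝ) : ℂ)) := by
      rw [sum_sub_distrib, mul_sub, ← pairSum_eq hl0, ← Complex.ofReal_sum, ← sum_mul, ← mul_sum,
        sum_norm_sg_pow_six hl0]
      push_cast; ring
    have h3 := congrArg norm h2
    rw [Complex.norm_real, Real.norm_eq_abs] at h3
    rw [h3, norm_mul, norm_inv, Complex.norm_natCast, one_div]
    refine mul_le_mul_of_nonneg_left ((norm_sum_le _ _).trans ?_) (by positivity)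
    change ∑ b ∈ Icc 1 l, G (y l) l b ≤ _
    rw [sum_eq_sum_divisors_cop (G (y l)) _ hl0]
    · refine sum_le_sum fun d hd => sum_le_sum fun b _ => ?_
      have hdl := Nat.dvd_of_mem_divisors hd
      have hd0 := Nat.pos_of_dvd_of_pos hdl hl0
      refine norm_corr_sub_le (y l) b hX hR hN hd0 (hdN d ?_)
      have := Nat.le_of_dvd hl0 hdl
      simp only [mem_Icc] at hl ⊢; omega
    · intro d b k hd hk
      have hk' : (k : ℝ) ≠ 0 := by positivity
      have : ((b * k : ℕ) : ℝ) / ((d * k : ℕ) : ℝ) = (b : ℝ) / d := by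
        push_cast; rw [mul_div_mul_right _ _ hk']
      simp only [hG, this, sg_scale d b k hd hk]
  refine (sum_le_sum h1).trans ?_
  rw [sum_inv_mul_sum_divisors, mul_sum]
  refine sum_le_sum fun d hd => ?_
  rw [← mul_assoc]
  refine mul_le_mul_of_nonneg_right (wt_le (mem_Icc.1 hd).1) (sum_nonneg fun b _ => ?_)
  exact (norm_nonneg _).trans (norm_corr_sub_le 0 b hX hR hN (mem_Icc.1 hd).1 (hdN d hd))

/-! ### Correlations in residue classes: summation -/

lemma one_add_log_pow_le {δ : ℝ} (hδ : 0 < δ) (k : ℕ) : ∃ C : ℝ, 0 < C ∧ ∀ x : ℝ, 1 ≤ x →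
    (1 + Real.log x) ^ k ≤ C * x ^ δ := by
  rcases Nat.eq_zero_or_pos k with rfl | hk
  · exact ⟨1, one_pos, fun x hx => by simpa using Real.one_le_rpow hx hδ.le⟩
  have hη : 0 < δ / k := by positivity
  refine ⟨(1 + 1 / (δ / k)) ^ k, by positivity, fun x hx => ?_⟩
  have h0 : (0 : ℝ) ≤ x := by linarith
  have h1 := Real.log_le_rpow_div h0 hη
  have h2 := Real.one_le_rpow hx hη.le
  have h3 := Real.log_nonneg hx
  calc (1 + Real.log x) ^ k ≤ ((1 + 1 / (δ / k)) * x ^ (δ / k)) ^ k := by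
        refine pow_le_pow_left₀ (by positivity) ?_ k
        rw [add_mul, one_mul, one_div_mul_eq_div]; linarith
    _ = _ := by
        rw [mul_pow, ← Real.rpow_natCast (x ^ (δ / k)), ← Real.rpow_mul h0,
          div_mul_cancel₀ _ (by positivity : (k : ℝ) ≠ 0)]

/-- The mean square `∑_{n ≤ X} r3(n)²`. -/
def sqTot (X : ℕ) : ℝ := ∑ n ∈ Icc 1 X, (r3 n : ℝ) ^ 2

lemma sqTot_nonneg (X : ℕ) : 0 ≤ sqTot X := sum_nonneg fun _ _ => by positivity

/-- The error terms, for a dissection at height `R`. -/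
def errBound (X : ℕ) (R : ℝ) : ℝ :=
  (X : ℝ) ^ (4 / 3 : ℝ) * R ^ 2 + (X : ℝ) ^ 2 / R + X / R * sqTot X

/-- Sum the weighted kernels under the average, use their pointwise bound, and finish with Parseval.
-/
lemma sum_minorTot_le {X N L : ℕ} {R : ℝ} (hL : 1 ≤ L) (hLX : L ^ 2 ≤ X) (hR : 0 < R)
    (hN : X ≤ N) :
    ∑ d ∈ Icc 1 L, 1 / (d : ℝ) * ∑ b ∈ cop d, minorTot X N R d b
      ≤ 64 * (1 + Real.log X) ^ 2 * (X / R + L) * sqTot X := by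
  have h1 : ∑ d ∈ Icc 1 L, 1 / (d : ℝ) * ∑ b ∈ cop d, minorTot X N R d b
      = gridAvg N (fun s => (∑ d ∈ Icc 1 L, 1 / (d : ℝ) * ∑ b ∈ cop d, kerMin X R d (s - b / d))
        * ‖cubeGen X s‖ ^ 2) := by
    simp only [sum_mul, mul_sum, mul_assoc]
    rw [gridAvg_sum]
    refine sum_congr rfl fun d _ => ?_
    rw [gridAvg_sum]
    refine sum_congr rfl fun b _ => ?_
    rw [gridAvg_real_const_mul, minorTot]
  rw [h1]
  have h2 : sqTot X = gridAvg N (fun s => ‖cubeGen X s‖ ^ 2) := by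
    simp only [cubeGen]
    rw [gridAvg_normSq_trig hN]; simp [sqTot]
  rw [h2, ← gridAvg_real_const_mul]
  exact gridAvg_mono fun s => mul_le_mul_of_nonneg_right (sum_kerMin_le hL hLX hR s) (by positivity)

lemma sq_partialTot_le (X : ℕ) (w : ℕ → ℂ) : partialTot X w ^ 2
    ≤ 2 * X ^ 2 * ‖∑ n ∈ Icc 1 X, w n‖ ^ 2 + 2 * X * ∑ z ∈ Icc 1 X, ‖∑ n ∈ Icc 1 z, w n‖ ^ 2 := by
  have h1 := sq_sum_le_card_mul_sum_sq (s := Icc 1 X) (f := fun z => ‖∑ n ∈ Icc 1 z, w n‖)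
  simp only [Nat.card_Icc, Nat.add_sub_cancel] at h1
  rw [partialTot]
  nlinarith [sq_nonneg (X * ‖∑ n ∈ Icc 1 X, w n‖ - ∑ z ∈ Icc 1 X, ‖∑ n ∈ Icc 1 z, w n‖)]

lemma cop_subset (d : ℕ) : cop d ⊆ Icc 1 d := filter_subset _ _

lemma exists_sum_sq_partialTot_le : ∃ C : ℝ, 0 < C ∧ ∀ X d : ℕ, 0 < d →
    ∑ b ∈ cop d, partialTot X (dev d b) ^ 2
      ≤ C * ((X : ℝ) ^ 2 * (X : ℝ) ^ (4 / 3 : ℝ) * (d * ncub d)) := by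
  obtain ⟨C, hC0, hC⟩ := exists_sum_normSq_dev_le
  refine ⟨4 * C, by positivity, fun X d hd => ?_⟩
  have h0 : ∀ z, ∑ b ∈ cop d, ‖∑ n ∈ Icc 1 z, dev d b n‖ ^ 2
      ≤ C * (z : ℝ) ^ (4 / 3 : ℝ) * (d * ncub d) := fun z =>
    (sum_le_sum_of_subset_of_nonneg (cop_subset d) fun _ _ _ => by positivity).trans (hC z d hd)
  calc ∑ b ∈ cop d, partialTot X (dev d b) ^ 2
      ≤ ∑ b ∈ cop d, (2 * X ^ 2 * ‖∑ n ∈ Icc 1 X, dev d b n‖ ^ 2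
        + 2 * X * ∑ z ∈ Icc 1 X, ‖∑ n ∈ Icc 1 z, dev d b n‖ ^ 2) :=
        sum_le_sum fun b _ => sq_partialTot_le X _
    _ = 2 * X ^ 2 * ∑ b ∈ cop d, ‖∑ n ∈ Icc 1 X, dev d b n‖ ^ 2
        + 2 * X * ∑ z ∈ Icc 1 X, ∑ b ∈ cop d, ‖∑ n ∈ Icc 1 z, dev d b n‖ ^ 2 := by
        rw [sum_add_distrib, ← mul_sum, ← mul_sum]; congr 2; exact sum_comm
    _ ≤ 2 * X ^ 2 * (C * (X : ℝ) ^ (4 / 3 : ℝ) * (d * ncub d))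
        + 2 * X * ∑ z ∈ Icc 1 X, (C * (X : ℝ) ^ (4 / 3 : ℝ) * (d * ncub d)) := by
        refine add_le_add (mul_le_mul_of_nonneg_left (h0 X) (by positivity))
          (mul_le_mul_of_nonneg_left (sum_le_sum fun z hz => (h0 z).trans ?_) (by positivity))
        have : (z : ℝ) ≤ X := by exact_mod_cast (mem_Icc.1 hz).2
        gcongr
    _ = _ := by simp; ring

lemma exists_sum_ncub_le {δ : ℝ} (hδ : 0 < δ) : ∃ C : ℝ, 0 < C ∧ ∀ (s : Finset ℕ) (R : ℝ), 0 < R →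
    (∀ d ∈ s, 0 < d ∧ (d : ℝ) ≤ R) → ∑ d ∈ s, (ncub d : ℝ) / (d : ℝ) ^ 2 ≤ C * R ^ δ := by
  have hs := summable_ncub hδ
  set K := ∑' d : ℕ, (ncub d : ℝ) * (d : ℝ) ^ (-2 - δ)
  have hK : 0 ≤ K := tsum_nonneg fun d => by positivity
  refine ⟨K + 1, by positivity, fun s R hR0 hR => ?_⟩
  have h1 : ∀ d ∈ s, (ncub d : ℝ) / (d : ℝ) ^ 2 ≤ ((ncub d : ℝ) * (d : ℝ) ^ (-2 - δ)) * R ^ δ := by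
    intro d hd
    have hd' : (0 : ℝ) < d := by exact_mod_cast (hR d hd).1
    have h2 : (ncub d : ℝ) / (d : ℝ) ^ 2 = ((ncub d : ℝ) * (d : ℝ) ^ (-2 - δ)) * (d : ℝ) ^ δ := by
      rw [mul_assoc, ← Real.rpow_add hd', show -2 - δ + δ = -((2 : ℕ) : ℝ) by push_cast; ring,
        Real.rpow_neg hd'.le, Real.rpow_natCast]; rfl
    rw [h2]
    have := Real.rpow_le_rpow hd'.le (hR d hd).2 hδ.le
    gcongr
  refine (sum_le_sum h1).trans ?_
  rw [← sum_mul]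
  have h2 := hs.sum_le_tsum s fun d _ => by positivity
  have h3 : 0 ≤ R ^ δ := by positivity
  nlinarith

/-- Rankin's trick on both sides of R: d^δ ≤ R^δ below it, and d^(δ-1) ≤ R^(δ-1) above it, which
needs δ ≤ 1. -/
lemma exists_sum_gq_le {δ : ℝ} (hδ : 0 < δ) (hδ1 : δ ≤ 1) : ∃ C : ℝ, 0 < C ∧ ∀ (s : Finset ℕ)
    (R : ℝ), 0 < R → (∀ d ∈ s, 0 < d) →
      ∑ d ∈ s, (if (d : ℝ) ≤ R then gq d / R else gq d / d) ≤ C * (R ^ δ / R) := by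
  have hs := summable_gq hδ
  set K := ∑' d : ℕ, gq d * (d : ℝ) ^ (-δ)
  have hK : 0 ≤ K := tsum_nonneg fun d => mul_nonneg (gq_nonneg d) (by positivity)
  refine ⟨K + 1, by positivity, fun s R hR0 hs0 => ?_⟩
  have h1 : ∀ d ∈ s, (if (d : ℝ) ≤ R then gq d / R else gq d / d)
      ≤ gq d * (d : ℝ) ^ (-δ) * (R ^ δ / R) := by
    intro d hd
    have hd' : (0 : ℝ) < d := by exact_mod_cast hs0 d hd
    have hg := gq_nonneg d
    have h3 : gq d = gq d * (d : ℝ) ^ (-δ) * (d : ℝ) ^ δ := by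
      rw [mul_assoc, ← Real.rpow_add hd']; simp
    split_ifs with h
    · have := Real.rpow_le_rpow hd'.le h hδ.le
      calc gq d / R = gq d * (d : ℝ) ^ (-δ) * ((d : ℝ) ^ δ / R) := by
            rw [← mul_div_assoc, ← h3]
        _ ≤ _ := by gcongr
    · calc gq d / d = gq d * (d : ℝ) ^ (-δ) * ((d : ℝ) ^ δ / d) := by
            rw [← mul_div_assoc, ← h3]
        _ ≤ _ := by
            refine mul_le_mul_of_nonneg_left ?_ (by positivity)
            have e1 : ∀ y : ℝ, 0 < y → y ^ δ / y = y ^ (-(1 - δ)) := by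
              intro y hy
              rw [show -(1 - δ) = δ - 1 by ring, Real.rpow_sub_one hy.ne']
            rw [e1 _ hd', e1 _ hR0]
            exact Real.rpow_le_rpow_of_nonpos hR0 (not_le.1 h).le (by linarith)
  refine (sum_le_sum h1).trans ?_
  rw [← sum_mul]
  have h2 := hs.sum_le_tsum s fun d _ => mul_nonneg (gq_nonneg d) (by positivity)
  have h3 : 0 ≤ R ^ δ / R := by positivity
  nlinarith

/-- A simplified form of `corrBound`. -/
lemma corrBound_le {X N d b : ℕ} {R : ℝ} (hX : 0 < X) (hR : 0 < R) (hd : 0 < d) :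
    corrBound X N R d b ≤ 2 * minorTot X N R d b
      + (if (d : ℝ) ≤ R then (64 * Real.pi ^ 2 + gam) * ((R / d) ^ 2 *
        (partialTot X (dev d b) ^ 2 / (X : ℝ) ^ 2)) else 0)
      + (2 * gam ^ 2 + gam) * (‖sg d b‖ ^ 6 * (X : ℝ) ^ 2
        * (if (d : ℝ) ≤ R then d / R else 1)) := by
  have hX' : (0 : ℝ) < X := by exact_mod_cast hX
  have hd' : (0 : ℝ) < d := by exact_mod_cast hd
  have hg := gam_pos
  rw [corrBound]
  split_ifs with h
  · have hρ : 1 ≤ R / d := (one_le_div hd').2 h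
    set P := partialTot X (dev d b)
    set s := ‖sg d b‖ ^ 3 with hs
    have h6 : ‖sg d b‖ ^ 6 = s ^ 2 := by rw [hs]; ring
    rw [h6]
    set ρ := R / d with hρd
    have e1 : (d : ℝ) * (X : ℝ) ^ 2 / R = (X : ℝ) ^ 2 / ρ := by rw [hρd]; field_simp
    have e2 : (d : ℝ) / R = 1 / ρ := by rw [hρd]; field_simp
    rw [e1, e2]
    have hρ0 : 0 < ρ := by linarith
    -- The inequality of the means, weighted so that the mixed term falls into the two kinds of
    -- error already present.
    have h1 : 2 * (s * P) ≤ s ^ 2 * ((X : ℝ) ^ 2 / ρ) + ρ * (P ^ 2 / (X : ℝ) ^ 2) := by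
      have : 0 ≤ (s * X - ρ * P / X) ^ 2 / ρ := by positivity
      have e3 : (s * X - ρ * P / X) ^ 2 / ρ
          = s ^ 2 * ((X : ℝ) ^ 2 / ρ) + ρ * (P ^ 2 / (X : ℝ) ^ 2) - 2 * (s * P) := by
        field_simp; ring
      linarith
    have h2 : ρ * (P ^ 2 / (X : ℝ) ^ 2) ≤ ρ ^ 2 * (P ^ 2 / (X : ℝ) ^ 2) := by
      have : ρ ≤ ρ ^ 2 := by nlinarith
      gcongr
    have h3 := mul_le_mul_of_nonneg_left (h1.trans (add_le_add_right h2 _)) hg.le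
    have e4 : s ^ 2 * (X : ℝ) ^ 2 * (1 / ρ) = s ^ 2 * ((X : ℝ) ^ 2 / ρ) := by ring
    rw [e4]
    nlinarith
  · have : 0 ≤ (gam ^ 2 + gam) * (‖sg d b‖ ^ 6 * (X : ℝ) ^ 2) := by positivity
    nlinarith

lemma errBound_parts {X : ℕ} {R : ℝ} (hR : 0 < R) :
    (X : ℝ) ^ (4 / 3 : ℝ) * R ^ 2 ≤ errBound X R ∧ (X : ℝ) ^ 2 / R ≤ errBound X R ∧
      X / R * sqTot X ≤ errBound X R ∧ 0 ≤ errBound X R := by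
  have h1 : 0 ≤ (X : ℝ) ^ (4 / 3 : ℝ) * R ^ 2 := by positivity
  have h2 : 0 ≤ (X : ℝ) ^ 2 / R := by positivity
  have h3 : 0 ≤ X / R * sqTot X := mul_nonneg (by positivity) (sqTot_nonneg X)
  rw [errBound]
  refine ⟨?_, ?_, ?_, ?_⟩ <;> linarith

/-- The three terms of `errBound` have separate sources: the deviations on the major arcs, the
singular series of the main terms, and the minor arcs. Logarithms and Rankin losses go into X^ε. -/
theorem exists_sum_abs_pairSum_sub_le {ε : ℝ} (hε : 0 < ε) : ∃ C : ℝ, 0 < C ∧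
    ∀ (X L : ℕ) (R : ℝ) (y : ℕ → ℕ), 1 ≤ L → L ^ 2 ≤ X → 1 ≤ R → R ^ 2 ≤ X →
      ∑ l ∈ Icc 1 L, |pairSum X l (y l) - gam ^ 2 * (hFun l / l) * pairCount X (y l)|
        ≤ C * (X : ℝ) ^ ε * errBound X R := by
  set δ := min (ε / 2) 1 with hδd
  have hδ : 0 < δ := lt_min (by positivity) one_pos
  have hδε : δ + δ ≤ ε := by
    have := min_le_left (ε / 2) 1; linarith
  obtain ⟨C1, hC1, hlog⟩ := one_add_log_pow_le hδ 3
  obtain ⟨C2, hC2, hpt⟩ := exists_sum_sq_partialTot_le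
  obtain ⟨C3, hC3, hnc⟩ := exists_sum_ncub_le hδ
  obtain ⟨C4, hC4, hgs⟩ := exists_sum_gq_le hδ (min_le_right _ _)
  have hg := gam_pos
  set A := 256 + (64 * Real.pi ^ 2 + gam) * C2 * C3 + (2 * gam ^ 2 + gam) * C4 with hA
  refine ⟨C1 * A, by positivity, fun X L R y hL hLX hR hRX => ?_⟩
  have hX : 0 < X := lt_of_lt_of_le (by positivity) hLX
  have hX' : (0 : ℝ) < X := by exact_mod_cast hX
  have hX1 : (1 : ℝ) ≤ X := by exact_mod_cast hX
  have hR0 : 0 < R := by linarith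
  -- Larger than 2X for orthogonality, and divisible by every d ≤ L ≤ X for the shifts. No bound
  -- depends on its size.
  set N := (2 * X + 1) * X.factorial with hN
  have hfac := Nat.factorial_pos X
  have hN2 : 2 * X < N := by rw [hN]; nlinarith
  have hLX1 : L ≤ X := le_trans (by nlinarith) hLX
  have hdN : ∀ d ∈ Icc 1 L, d ∣ N := fun d hd =>
    Dvd.dvd.mul_left (Nat.dvd_factorial (mem_Icc.1 hd).1 ((mem_Icc.1 hd).2.trans hLX1)) _
  refine (sum_abs_pairSum_sub_le y hX hR0 hN2 hdN).trans ?_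
  obtain ⟨hE1, hE2, hE3, hE0⟩ := errBound_parts (X := X) hR0
  set E := errBound X R
  have hlogX := Real.log_nonneg hX1
  have hRX1 : R ≤ X := by nlinarith
  have hRd : R ^ δ ≤ (X : ℝ) ^ δ := Real.rpow_le_rpow hR0.le hRX1 hδ.le
  have hXd : 1 ≤ (X : ℝ) ^ δ := Real.one_le_rpow hX1 hδ.le
  have hL2 : ((L : ℝ)) ^ 2 ≤ X := by exact_mod_cast hLX
  -- Both L² and R² are at most X, so the term L of the kernel bound is absorbed by X/R.
  have hLR : (L : ℝ) ≤ X / R := by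
    rw [le_div_iff₀ hR0]
    refine abs_le_of_sq_le_sq' ?_ hX'.le |>.2
    rw [mul_pow, sq (X : ℝ)]
    exact mul_le_mul hL2 hRX (by positivity) hX'.le
  have hsplit : ∑ d ∈ Icc 1 L, 1 / (d : ℝ) * ∑ b ∈ cop d, corrBound X N R d b
      ≤ 2 * ∑ d ∈ Icc 1 L, 1 / (d : ℝ) * ∑ b ∈ cop d, minorTot X N R d b
        + (64 * Real.pi ^ 2 + gam) * C2 * ((X : ℝ) ^ (4 / 3 : ℝ) * R ^ 2 *
          ∑ d ∈ (Icc 1 L).filter (fun d : ℕ => (d : ℝ) ≤ R), (ncub d : ℝ) / (d : ℝ) ^ 2)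
        + (2 * gam ^ 2 + gam) * ((X : ℝ) ^ 2 *
          ∑ d ∈ Icc 1 L, (if (d : ℝ) ≤ R then gq d / R else gq d / d)) := by
    rw [sum_filter]
    simp only [mul_sum, ← sum_add_distrib]
    refine sum_le_sum fun d hd => ?_
    have hd0 := (mem_Icc.1 hd).1
    have hd' : (0 : ℝ) < d := by exact_mod_cast hd0
    have h1 : ∑ b ∈ cop d, corrBound X N R d b ≤ ∑ b ∈ cop d, (2 * minorTot X N R d b
      + (if (d : ℝ) ≤ R then (64 * Real.pi ^ 2 + gam) * ((R / d) ^ 2 *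
        (partialTot X (dev d b) ^ 2 / (X : ℝ) ^ 2)) else 0)
      + (2 * gam ^ 2 + gam) * (‖sg d b‖ ^ 6 * (X : ℝ) ^ 2
        * (if (d : ℝ) ≤ R then d / R else 1))) :=
      sum_le_sum fun b _ => corrBound_le hX hR0 hd0
    have h2 := mul_le_mul_of_nonneg_left h1 (by positivity : 0 ≤ 1 / (d : ℝ))
    simp only [← mul_sum] at h2 ⊢
    refine h2.trans ?_
    rw [sum_add_distrib, sum_add_distrib, mul_add, mul_add]
    refine add_le_add (add_le_add ?_ ?_) ?_
    · rw [← mul_sum]; exact le_of_eq (by ring)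
    · split_ifs with h
      · rw [← mul_sum, ← mul_sum, ← sum_div]
        have h3 := hpt X d hd0
        calc _ ≤ 1 / (d : ℝ) * ((64 * Real.pi ^ 2 + gam) * ((R / d) ^ 2 *
              (C2 * ((X : ℝ) ^ 2 * (X : ℝ) ^ (4 / 3 : ℝ) * (d * ncub d)) / (X : ℝ) ^ 2))) := by
              gcongr
          _ = _ := by field_simp
      · simp
    · rw [← mul_sum, ← sum_mul, ← sum_mul, ← gq]
      refine le_of_eq ?_
      split_ifs with h
      · field_simp
      · field_simp
  have hm := sum_minorTot_le (N := N) hL hLX hR0 (by omega)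
  have hn := hnc ((Icc 1 L).filter (fun d : ℕ => (d : ℝ) ≤ R)) R hR0 fun d hd =>
    ⟨(mem_Icc.1 (mem_filter.1 hd).1).1, (mem_filter.1 hd).2⟩
  have hgq := hgs (Icc 1 L) R hR0 fun d hd => (mem_Icc.1 hd).1
  have hΛ : (1 : ℝ) ≤ (1 + Real.log X) ^ 2 := one_le_pow₀ (by linarith)
  set Λ := 1 + Real.log X with hΛd
  have hΛ1 : 1 ≤ Λ := by linarith
  have b1 : 2 * ∑ d ∈ Icc 1 L, 1 / (d : ℝ) * ∑ b ∈ cop d, minorTot X N R d b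
      ≤ 256 * (Λ ^ 2 * (X : ℝ) ^ δ * E) := by
    calc _ ≤ 2 * (64 * Λ ^ 2 * (X / R + X / R) * sqTot X) := by
          refine mul_le_mul_of_nonneg_left (hm.trans ?_) (by norm_num)
          have := sqTot_nonneg X
          gcongr
      _ = 256 * (Λ ^ 2 * 1 * (X / R * sqTot X)) := by ring
      _ ≤ _ := by
          have : 0 ≤ X / R * sqTot X := mul_nonneg (by positivity) (sqTot_nonneg X)
          gcongr
  have b2 : (64 * Real.pi ^ 2 + gam) * C2 * ((X : ℝ) ^ (4 / 3 : ℝ) * R ^ 2 *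
          ∑ d ∈ (Icc 1 L).filter (fun d : ℕ => (d : ℝ) ≤ R), (ncub d : ℝ) / (d : ℝ) ^ 2)
      ≤ (64 * Real.pi ^ 2 + gam) * C2 * C3 * (Λ ^ 2 * (X : ℝ) ^ δ * E) := by
    calc _ ≤ (64 * Real.pi ^ 2 + gam) * C2 * ((X : ℝ) ^ (4 / 3 : ℝ) * R ^ 2 *
          (C3 * (X : ℝ) ^ δ)) := by
          have := hn.trans (mul_le_mul_of_nonneg_left hRd hC3.le)
          gcongr
      _ = (64 * Real.pi ^ 2 + gam) * C2 * C3 * (1 * (X : ℝ) ^ δ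
          * ((X : ℝ) ^ (4 / 3 : ℝ) * R ^ 2)) := by ring
      _ ≤ _ := by gcongr
  have b3 : (2 * gam ^ 2 + gam) * ((X : ℝ) ^ 2 *
          ∑ d ∈ Icc 1 L, (if (d : ℝ) ≤ R then gq d / R else gq d / d))
      ≤ (2 * gam ^ 2 + gam) * C4 * (Λ ^ 2 * (X : ℝ) ^ δ * E) := by
    calc _ ≤ (2 * gam ^ 2 + gam) * ((X : ℝ) ^ 2 * (C4 * ((X : ℝ) ^ δ / R))) := by
          have := hgq.trans (mul_le_mul_of_nonneg_left
            (div_le_div_of_nonneg_right hRd hR0.le) hC4.le)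
          gcongr
      _ = (2 * gam ^ 2 + gam) * C4 * (1 * (X : ℝ) ^ δ * ((X : ℝ) ^ 2 / R)) := by ring
      _ ≤ _ := by gcongr
  have hL1 : (1 : ℝ) ≤ L := by exact_mod_cast hL
  have hLlog : 1 + Real.log L ≤ Λ := by
    have : (L : ℝ) ≤ X := by exact_mod_cast hLX1
    have := Real.log_le_log (by linarith) this
    linarith
  have hLl0 : 0 ≤ 1 + Real.log L := by linarith [Real.log_nonneg hL1]
  calc _ ≤ (1 + Real.log L) * (A * (Λ ^ 2 * (X : ℝ) ^ δ * E)) := by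
        refine mul_le_mul_of_nonneg_left (hsplit.trans ?_) hLl0
        rw [hA, add_mul, add_mul]; linarith
    _ ≤ Λ * (A * (Λ ^ 2 * (X : ℝ) ^ δ * E)) := by gcongr
    _ = Λ ^ 3 * (A * ((X : ℝ) ^ δ * E)) := by ring
    _ ≤ C1 * (X : ℝ) ^ δ * (A * ((X : ℝ) ^ δ * E)) := by
        refine mul_le_mul_of_nonneg_right (hlog X hX1) (by positivity)
    _ = C1 * A * (X : ℝ) ^ (δ + δ) * E := by rw [Real.rpow_add hX']; ring
    _ ≤ _ := by
        have := Real.rpow_le_rpow_of_exponent_le hX1 hδε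
        gcongr

/-! ### A weighted large sieve and the singular series on average -/

/-- Large sieve by duality. Cauchy–Schwarz reduces the claim to the dual form, whose matrix entries
are geometric sums bounded by `ker`; the hypothesis on K is the row-sum condition of Schur's test.
-/
lemma sum_weight_normSq_trig_le {ι : Type*} {s : Finset ι} {w α : ι → ℝ} {X : ℕ} {K : ℝ}
    (hw : ∀ i ∈ s, 0 ≤ w i) (hK : ∀ t, ∑ i ∈ s, w i * ker X (t - α i) ≤ K) (a : ℕ → ℂ) :
    ∑ i ∈ s, w i * ‖trig X a (α i)‖ ^ 2 ≤ K * ∑ n ∈ Icc 1 X, ‖a n‖ ^ 2 := by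
  set F : ι → ℂ := fun i => trig X a (α i) with hF
  set S := ∑ i ∈ s, w i * ‖F i‖ ^ 2 with hS
  have hS0 : 0 ≤ S := sum_nonneg fun i hi => mul_nonneg (hw i hi) (by positivity)
  set c : ι → ℂ := fun i => w i * (starRingEnd ℂ) (F i) with hc
  set B : ℕ → ℂ := fun n => ∑ i ∈ s, c i * e (n * α i) with hB
  have hSB : (S : ℂ) = ∑ n ∈ Icc 1 X, a n * B n := by
    simp only [hB, mul_sum]
    rw [sum_comm, hS]
    push_cast
    refine sum_congr rfl fun i _ => ?_
    rw [← Complex.conj_mul', ← mul_assoc]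
    change c i * F i = _
    simp only [hF, trig, mul_sum]
    exact sum_congr rfl fun n _ => by ring
  have h1 : S ^ 2 ≤ (∑ n ∈ Icc 1 X, ‖a n‖ ^ 2) * ∑ n ∈ Icc 1 X, ‖B n‖ ^ 2 := by
    have h2 : S ≤ ∑ n ∈ Icc 1 X, ‖a n‖ * ‖B n‖ := by
      have := congrArg norm hSB
      rw [Complex.norm_real, Real.norm_of_nonneg hS0] at this
      rw [this]
      exact (norm_sum_le _ _).trans (sum_le_sum fun n _ => (norm_mul _ _).le)
    exact (pow_le_pow_left₀ hS0 h2 2).trans (sum_mul_sq_le_sq_mul_sq _ _ _)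
  have hsw : ∀ i ∈ s, ∀ j ∈ s, ‖∑ n ∈ Icc 1 X, e (n * (α i - α j))‖ ≤ ker X (α i - α j) :=
    fun i _ j _ => norm_sum_e_le (a := 0) (b := X) (by omega) _
  have hsw' : ∀ i ∈ s, ∀ j ∈ s, ‖∑ n ∈ Icc 1 X, e (n * (α i - α j))‖ ≤ ker X (α j - α i) := by
    intro i hi j hj
    refine le_trans (le_of_eq ?_) (hsw j hj i hi)
    rw [← Complex.norm_conj, map_sum]
    congr 1
    refine sum_congr rfl fun n _ => ?_
    rw [← e_neg]; congr 1; ring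
  have h3 : ∑ n ∈ Icc 1 X, ‖B n‖ ^ 2 ≤ K * S := by
    have h4 : ((∑ n ∈ Icc 1 X, ‖B n‖ ^ 2 : ℝ) : ℂ) = ∑ i ∈ s, ∑ j ∈ s,
        c i * (starRingEnd ℂ) (c j) * ∑ n ∈ Icc 1 X, e (n * (α i - α j)) := by
      push_cast
      simp only [mul_sum]
      rw [sum_congr rfl fun i _ => sum_comm, sum_comm]
      refine sum_congr rfl fun n _ => ?_
      rw [← Complex.mul_conj', hB, map_sum, sum_mul_sum]
      refine sum_congr rfl fun i _ => sum_congr rfl fun j _ => ?_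
      rw [map_mul, mul_sub, e_sub]; ring
    have h5 : ∑ n ∈ Icc 1 X, ‖B n‖ ^ 2 ≤ ∑ i ∈ s, ∑ j ∈ s, (1 / 2 : ℝ) *
        (w i * ‖F i‖ ^ 2 * (w j * ker X (α i - α j))
          + w j * ‖F j‖ ^ 2 * (w i * ker X (α j - α i))) := by
      have h6 := congrArg norm h4
      rw [Complex.norm_real, Real.norm_of_nonneg (by positivity)] at h6
      rw [h6]
      refine (norm_sum_le _ _).trans (sum_le_sum fun i hi => (norm_sum_le _ _).trans
        (sum_le_sum fun j hj => ?_))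
      rw [norm_mul, norm_mul, Complex.norm_conj]
      simp only [hc, norm_mul, Complex.norm_conj, Complex.norm_real]
      rw [Real.norm_of_nonneg (hw i hi), Real.norm_of_nonneg (hw j hj)]
      have k1 := hsw i hi j hj
      have k2 := hsw' i hi j hj
      set k := ‖∑ n ∈ Icc 1 X, e (n * (α i - α j))‖
      have hk : 0 ≤ k := norm_nonneg _
      have hij : 0 ≤ w i * w j := mul_nonneg (hw i hi) (hw j hj)
      calc w i * ‖F i‖ * (w j * ‖F j‖) * k = w i * w j * k * (‖F i‖ * ‖F j‖) := by ring
        _ ≤ w i * w j * k * ((1 / 2) * (‖F i‖ ^ 2 + ‖F j‖ ^ 2)) := by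
            refine mul_le_mul_of_nonneg_left ?_ (by positivity)
            nlinarith [sq_nonneg (‖F i‖ - ‖F j‖)]
        _ = (1 / 2) * (w i * w j * ‖F i‖ ^ 2 * k + w i * w j * ‖F j‖ ^ 2 * k) := by ring
        _ ≤ (1 / 2) * (w i * w j * ‖F i‖ ^ 2 * ker X (α i - α j)
            + w i * w j * ‖F j‖ ^ 2 * ker X (α j - α i)) := by gcongr
        _ = _ := by ring
    refine h5.trans ?_
    have h7 : ∑ i ∈ s, w i * ‖F i‖ ^ 2 * ∑ j ∈ s, w j * ker X (α i - α j) ≤ K * S := by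
      rw [mul_comm K, hS, sum_mul]
      exact sum_le_sum fun i hi => mul_le_mul_of_nonneg_left (hK _)
        (mul_nonneg (hw i hi) (by positivity))
    simp only [← mul_sum, sum_add_distrib]
    conv_lhs => enter [2, 2]; rw [sum_comm]
    simp only [← mul_sum]
    linarith
  have hM : 0 ≤ ∑ n ∈ Icc 1 X, ‖a n‖ ^ 2 := by positivity
  have h8 := h1.trans (mul_le_mul_of_nonneg_left h3 hM)
  rcases hS0.eq_or_lt with h0 | h0
  · rw [← h0]
    refine mul_nonneg (le_trans (sum_nonneg fun i hi => ?_) (hK 0)) hM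
    exact mul_nonneg (hw i hi) (ker_nonneg _ _)
  · nlinarith

lemma card_filter_modEq_le (d X a : ℕ) :
    (((Icc 1 X).filter (fun n => n ≡ a [MOD d])).card : ℝ) ≤ X / d + 1 := by
  have h1 : ((Icc 1 X).filter (fun n => n ≡ a [MOD d])).card ≤ (range (X / d + 1)).card := by
    refine card_le_card_of_injOn (fun n => n / d) (fun n hn => ?_) fun m hm n hn h => ?_
    · simp only [coe_filter, Set.mem_ofPred_eq, mem_Icc] at hn
      simp only [coe_range, Set.mem_Iio]
      exact Nat.lt_succ_of_le (Nat.div_le_div_right hn.1.2)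
    · simp only [coe_filter, Set.mem_ofPred_eq, mem_Icc] at hm hn h
      have h2 : m % d = n % d := hm.2.trans hn.2.symm
      rw [← Nat.div_add_mod m d, ← Nat.div_add_mod n d, h, h2]
  rw [card_range] at h1
  have h2 : ((X / d : ℕ) : ℝ) ≤ X / d := Nat.cast_div_le
  have h3 : (((Icc 1 X).filter (fun n => n ≡ a [MOD d])).card : ℝ) ≤ ((X / d + 1 : ℕ) : ℝ) := by
    exact_mod_cast h1
  push_cast at h3
  linarith

/-- For a single denominator, fold the coefficients into residue classes, use Parseval modulo d, and
apply Cauchy–Schwarz in each class. No averaging over d is needed, so this reaches d > √X. -/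
lemma sum_normSq_trig_le {d : ℕ} (hd : 0 < d) (X : ℕ) (u : ℕ → ℂ) :
    ∑ b ∈ Icc 1 d, ‖trig X u (b / d)‖ ^ 2 ≤ (X + d) * ∑ n ∈ Icc 1 X, ‖u n‖ ^ 2 := by
  have hd' : (0 : ℝ) < d := by exact_mod_cast hd
  set c : ℕ → ℂ := fun a => ∑ n ∈ (Icc 1 X).filter (fun n => n ≡ a [MOD d]), u n with hc
  have h1 : ∀ b : ℕ, trig X u (b / d) = trig d c (b / d) := by
    intro b
    simp only [trig, hc, sum_mul]
    rw [sum_residues_eq hd (Icc 1 X) (fun n a => u n * e (a * ((b : ℝ) / d)))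
      (fun n a a' h => by rw [e_nat_mul_frac_congr hd b h])]
  have h2 : ∑ b ∈ Icc 1 d, ‖trig d c (b / d)‖ ^ 2 = d * ∑ a ∈ Icc 1 d, ‖c a‖ ^ 2 := by
    have h3 := gridAvg_normSq_trig (le_refl d) c
    rw [gridAvg_eq_Icc hd (f := fun t => ‖trig d c t‖ ^ 2)
      (fun t => by simp only [trig_add_one]), smul_eq_mul,
      inv_mul_eq_iff_eq_mul₀ hd'.ne'] at h3
    exact h3
  simp only [h1]
  rw [h2]
  have h4 : ∀ a, ‖c a‖ ^ 2 ≤ (X / d + 1) *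
      ∑ n ∈ (Icc 1 X).filter (fun n => n ≡ a [MOD d]), ‖u n‖ ^ 2 := by
    intro a
    refine (pow_le_pow_left₀ (norm_nonneg _) (norm_sum_le _ _) 2).trans ?_
    refine sq_sum_le_card_mul_sum_sq.trans ?_
    exact mul_le_mul_of_nonneg_right (card_filter_modEq_le d X a) (by positivity)
  calc (d : ℝ) * ∑ a ∈ Icc 1 d, ‖c a‖ ^ 2
      ≤ d * ∑ a ∈ Icc 1 d, (X / d + 1) *
        ∑ n ∈ (Icc 1 X).filter (fun n => n ≡ a [MOD d]), ‖u n‖ ^ 2 := by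
        gcongr with a _; exact h4 a
    _ = d * ((X / d + 1) * ∑ n ∈ Icc 1 X, ‖u n‖ ^ 2) := by
        rw [← mul_sum, sum_residues_eq hd (Icc 1 X) (fun n _ => ‖u n‖ ^ 2) (fun _ _ _ _ => rfl)]
    _ = _ := by field_simp

/-- For d > R no arc is removed, so the pointwise kernel bound is exactly the hypothesis of the
weighted large sieve. -/
lemma sum_normSq_cubeGen_medium_le {X L : ℕ} {R : ℝ} (hL : 1 ≤ L) (hLX : L ^ 2 ≤ X)
    (hR : 0 < R) :
    ∑ d ∈ (Icc 1 L).filter (fun d : ℕ => R < d), 1 / (d : ℝ) *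
        ∑ b ∈ cop d, ‖cubeGen X (b / d)‖ ^ 2
      ≤ 64 * (1 + Real.log X) ^ 2 * (X / R + L) * sqTot X := by
  have h := sum_weight_normSq_trig_le
    (s := ((Icc 1 L).filter (fun d : ℕ => R < d)).sigma cop)
    (w := fun p => 1 / (p.1 : ℝ)) (α := fun p => (p.2 : ℝ) / p.1) (X := X)
    (K := 64 * (1 + Real.log X) ^ 2 * (X / R + L)) (fun p _ => by positivity) (fun t => ?_)
    (fun n => (r3 n : ℂ))
  · rw [sum_sigma] at h
    simp only [← mul_sum] at h
    have h2 : ∑ n ∈ Icc 1 X, ‖(r3 n : ℂ)‖ ^ 2 = sqTot X := by simp [sqTot]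
    rw [h2] at h
    exact h
  · rw [sum_sigma]
    simp only [← mul_sum]
    refine le_trans ?_ (sum_kerMin_le hL hLX hR t)
    rw [sum_filter]
    refine sum_le_sum fun d _ => ?_
    split_ifs with hd
    · simp only [kerMin_of_lt hd]; exact le_rfl
    · exact mul_nonneg (by positivity) (sum_nonneg fun b _ => kerMin_nonneg _ _ _ _)

/-- The deviation of the generating function from its main term at `b / d`. -/
def cubeDev (X d b : ℕ) : ℂ := cubeGen X (b / d) - gam * sg d b ^ 3 * X

lemma abs_sum_r3_rho_sub_le (X Q : ℕ) :
    |∑ q ∈ Icc 1 Q, (∑ n ∈ Icc 1 X, (r3 n : ℝ) * (rho q n / (q : ℝ) ^ 3)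
        - gam * X * (hFun q / q))|
      ≤ (1 + Real.log Q) * ∑ d ∈ Icc 1 Q, 1 / (d : ℝ) *
        ∑ b ∈ cop d, ‖sg d b‖ ^ 3 * ‖cubeDev X d b‖ := by
  have h1 : ∀ q ∈ Icc 1 Q, |∑ n ∈ Icc 1 X, (r3 n : ℝ) * (rho q n / (q : ℝ) ^ 3)
        - gam * X * (hFun q / q)|
      ≤ 1 / (q : ℝ) * ∑ d ∈ q.divisors, ∑ b ∈ cop d, ‖sg d b‖ ^ 3 * ‖cubeDev X d b‖ := by
    intro q hq
    have hq0 : 0 < q := (mem_Icc.1 hq).1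
    have h2 : ((∑ n ∈ Icc 1 X, (r3 n : ℝ) * (rho q n / (q : ℝ) ^ 3)
        - gam * X * (hFun q / q) : ℝ) : ℂ)
        = (q : ℂ)⁻¹ * ∑ b ∈ Icc 1 q, sg q b ^ 3 * (starRingEnd ℂ) (cubeDev X q b) := by
      rw [Complex.ofReal_sub, sum_r3_mul_rho hq0, ← sum_norm_sg_pow_six hq0]
      simp only [cubeDev, map_sub, mul_sub, sum_sub_distrib]
      congr 1
      push_cast
      rw [mul_sum, sum_div, mul_sum]
      refine sum_congr rfl fun b _ => ?_
      have h6 : (‖sg q b‖ : ℂ) ^ 6 = sg q b ^ 3 * (starRingEnd ℂ) (sg q b) ^ 3 := by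
        rw [← mul_pow, Complex.mul_conj']; ring
      rw [h6]
      simp only [map_mul, map_pow, Complex.conj_ofReal, Complex.conj_natCast]
      ring
    have h3 := congrArg norm h2
    rw [Complex.norm_real, Real.norm_eq_abs] at h3
    rw [h3, norm_mul, norm_inv, Complex.norm_natCast, one_div]
    refine mul_le_mul_of_nonneg_left ((norm_sum_le _ _).trans (le_of_eq ?_)) (by positivity)
    rw [← sum_eq_sum_divisors_cop (fun d b => ‖sg d b‖ ^ 3 * ‖cubeDev X d b‖) _ hq0]
    · refine sum_congr rfl fun b _ => ?_
      rw [norm_mul, norm_pow, Complex.norm_conj]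
    · intro d b k hd hk
      have hk' : (k : ℝ) ≠ 0 := by positivity
      have : ((b * k : ℕ) : ℝ) / ((d * k : ℕ) : ℝ) = (b : ℝ) / d := by
        push_cast; rw [mul_div_mul_right _ _ hk']
      simp only [cubeDev, this, sg_scale d b k hd hk]
  refine (abs_sum_le_sum_abs _ _).trans ((sum_le_sum h1).trans ?_)
  rw [sum_inv_mul_sum_divisors, mul_sum]
  refine sum_le_sum fun d hd => ?_
  rw [← mul_assoc]
  exact mul_le_mul_of_nonneg_right (wt_le (mem_Icc.1 hd).1) (sum_nonneg fun b _ => by positivity)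

/-- The first term of `errBound` dominates when R ≥ X^(1/6), the second when R ≤ X^(1/6). -/
lemma rpow_mul_le_errBound {X : ℕ} {R : ℝ} (hR : 1 ≤ R) :
    (X : ℝ) ^ (3 / 2 : ℝ) * R ≤ errBound X R := by
  have hX : (0 : ℝ) ≤ X := Nat.cast_nonneg X
  have hR0 : 0 < R := by linarith
  obtain ⟨h1, h2, -, -⟩ := errBound_parts (X := X) hR0
  have hu0 : (0 : ℝ) ≤ (X : ℝ) ^ (1 / 6 : ℝ) := by positivity
  have e1 : (X : ℝ) ^ (4 / 3 : ℝ) = ((X : ℝ) ^ (1 / 6 : ℝ)) ^ 8 := by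
    rw [← Real.rpow_natCast, ← Real.rpow_mul hX]; norm_num
  have e2 : (X : ℝ) ^ (3 / 2 : ℝ) = ((X : ℝ) ^ (1 / 6 : ℝ)) ^ 9 := by
    rw [← Real.rpow_natCast, ← Real.rpow_mul hX]; norm_num
  have e3 : (X : ℝ) ^ 2 = ((X : ℝ) ^ (1 / 6 : ℝ)) ^ 12 := by
    rw [← Real.rpow_natCast _ 12, ← Real.rpow_mul hX, ← Real.rpow_natCast]; norm_num
  rw [e1] at h1; rw [e3] at h2; rw [e2]
  set u := (X : ℝ) ^ (1 / 6 : ℝ)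
  rcases le_total u R with h | h
  · refine le_trans ?_ h1
    calc u ^ 9 * R = u ^ 8 * R * u := by ring
      _ ≤ u ^ 8 * R * R := by gcongr
      _ = _ := by ring
  · refine le_trans ?_ h2
    rw [le_div_iff₀ hR0]
    have hu1 : 1 ≤ u := hR.trans h
    calc u ^ 9 * R * R ≤ u ^ 9 * u * u := by gcongr
      _ = u ^ 11 := by ring
      _ ≤ u ^ 12 := pow_le_pow_right₀ hu1 (by norm_num)

lemma two_mul_sum_le {s : Finset ℕ} (f g : ℕ → ℝ) {c : ℝ} (hc : 0 < c) :
    2 * ∑ b ∈ s, f b * g b ≤ c * ∑ b ∈ s, f b ^ 2 + (∑ b ∈ s, g b ^ 2) / c := by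
  rw [mul_sum, mul_sum, sum_div, ← sum_add_distrib]
  refine sum_le_sum fun b _ => ?_
  have h : 0 ≤ (c * f b - g b) ^ 2 / c := by positivity
  have e : (c * f b - g b) ^ 2 / c = c * f b ^ 2 + g b ^ 2 / c - 2 * (f b * g b) := by
    field_simp; ring
  linarith

lemma sum_sg_sq (d : ℕ) : ∑ b ∈ cop d, (‖sg d b‖ ^ 3) ^ 2 = gq d := by
  rw [gq]; exact sum_congr rfl fun b _ => by ring

/-- Passing from the deviation to the generating function. -/
lemma sum_sg_mul_cubeDev_le (X d : ℕ) {c : ℝ} (hc : 1 ≤ c) (hX : 0 < X) :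
    X * ∑ b ∈ cop d, ‖sg d b‖ ^ 3 * ‖cubeDev X d b‖
      ≤ (1 + gam) * (c * (X : ℝ) ^ 2 * gq d) + (∑ b ∈ cop d, ‖cubeGen X (b / d)‖ ^ 2) / c := by
  have hX' : (0 : ℝ) < X := by exact_mod_cast hX
  have hg := gam_pos
  have hc0 : 0 < c := by linarith
  have h1 : ∑ b ∈ cop d, ‖sg d b‖ ^ 3 * ‖cubeDev X d b‖
      ≤ ∑ b ∈ cop d, ‖sg d b‖ ^ 3 * ‖cubeGen X (b / d)‖ + gam * X * gq d := by
    rw [← sum_sg_sq, mul_sum, ← sum_add_distrib]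
    refine sum_le_sum fun b _ => ?_
    have h2 : ‖cubeDev X d b‖ ≤ ‖cubeGen X (b / d)‖ + gam * ‖sg d b‖ ^ 3 * X := by
      refine (norm_sub_le _ _).trans (le_of_eq ?_)
      rw [norm_mul, norm_gam_mul_sg, Complex.norm_natCast]
    refine (mul_le_mul_of_nonneg_left h2 (by positivity)).trans (le_of_eq ?_)
    ring
  have h3 := two_mul_sum_le (s := cop d) (fun b => X * ‖sg d b‖ ^ 3)
    (fun b => ‖cubeGen X (b / d)‖) hc0
  have e1 : ∑ b ∈ cop d, (X * ‖sg d b‖ ^ 3) ^ 2 = (X : ℝ) ^ 2 * gq d := by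
    rw [← sum_sg_sq, mul_sum]; exact sum_congr rfl fun b _ => by ring
  have e2 : ∑ b ∈ cop d, X * ‖sg d b‖ ^ 3 * ‖cubeGen X (b / d)‖
      = X * ∑ b ∈ cop d, ‖sg d b‖ ^ 3 * ‖cubeGen X (b / d)‖ := by
    rw [mul_sum]; exact sum_congr rfl fun b _ => by ring
  rw [e1, e2] at h3
  have h4 := mul_le_mul_of_nonneg_left h1 hX'.le
  have hq := gq_nonneg d
  have h5 : gam * X ^ 2 * gq d ≤ gam * (c * (X : ℝ) ^ 2 * gq d) := by
    have : (X : ℝ) ^ 2 * gq d ≤ c * ((X : ℝ) ^ 2 * gq d) :=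
      le_mul_of_one_le_left (by positivity) hc
    have := mul_le_mul_of_nonneg_left this hg.le
    linarith
  have h6 : 0 ≤ (∑ b ∈ cop d, ‖cubeGen X (b / d)‖ ^ 2) / c := by positivity
  have h7 : 0 ≤ c * ((X : ℝ) ^ 2 * gq d) := by positivity
  have h8 : 0 ≤ X * ∑ b ∈ cop d, ‖sg d b‖ ^ 3 * ‖cubeGen X (b / d)‖ := by positivity
  nlinarith

-- In the cross term the moduli run up to Q, far beyond √X, so d has three ranges: up to R the
-- deviation is small in mean square; from R to √X the large sieve applies; beyond √X the bound for
-- a single denominator is combined with the tail of the singular series.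
set_option maxHeartbeats 1000000 in
theorem exists_abs_sum_r3_rho_sub_le {ε : ℝ} (hε : 0 < ε) : ∃ C : ℝ, 0 < C ∧
    ∀ (X Q : ℕ) (R : ℝ), Q ≤ X → 1 ≤ R → R ^ 2 ≤ X →
      X * |∑ q ∈ Icc 1 Q, (∑ n ∈ Icc 1 X, (r3 n : ℝ) * (rho q n / (q : ℝ) ^ 3)
        - gam * X * (hFun q / q))| ≤ C * (X : ℝ) ^ ε * errBound X R := by
  set δ := min (ε / 2) 1 with hδd
  have hδ : 0 < δ := lt_min (by positivity) one_pos
  have hδε : δ + δ ≤ ε := by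
    have := min_le_left (ε / 2) 1; linarith
  obtain ⟨C1, hC1, hlog⟩ := one_add_log_pow_le hδ 3
  obtain ⟨C2, hC2, hpt⟩ := exists_sum_normSq_dev_le
  obtain ⟨C3, hC3, hnc⟩ := exists_sum_ncub_le hδ
  obtain ⟨C4, hC4, hgs⟩ := exists_sum_gq_le hδ (min_le_right _ _)
  have hg := gam_pos
  set A := (1 + gam) * C4 + C2 * C3 + 128 + (1 + gam) * C4 + 2 with hA
  refine ⟨C1 * A, by positivity, fun X Q R hQX hR hRX => ?_⟩
  have hR0 : 0 < R := by linarith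
  have hX : 0 < X := by
    rcases Nat.eq_zero_or_pos X with rfl | h
    · norm_num at hRX; nlinarith
    · exact h
  have hX' : (0 : ℝ) < X := by exact_mod_cast hX
  have hX1 : (1 : ℝ) ≤ X := by exact_mod_cast hX
  obtain ⟨hE1, hE2, hE3, hE0⟩ := errBound_parts (X := X) hR0
  have hE4 := rpow_mul_le_errBound (X := X) hR
  set E := errBound X R with hE
  set L := Nat.sqrt X with hLd
  have hL : 1 ≤ L := Nat.le_sqrt.2 (by omega)
  have hLX : L ^ 2 ≤ X := Nat.sqrt_le' X
  have hlogX := Real.log_nonneg hX1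
  have hsX : 1 ≤ Real.sqrt X := Real.one_le_sqrt.2 hX1
  have hRs : R ≤ Real.sqrt X := Real.le_sqrt_of_sq_le hRX
  have hsX2 : Real.sqrt X ≤ X := by
    rw [Real.sqrt_le_left (by positivity)]; nlinarith
  have hRX1 : R ≤ X := hRs.trans hsX2
  have hRd : R ^ δ ≤ (X : ℝ) ^ δ := Real.rpow_le_rpow hR0.le hRX1 hδ.le
  have hsd : Real.sqrt X ^ δ ≤ (X : ℝ) ^ δ := Real.rpow_le_rpow (by positivity) hsX2 hδ.le
  have hXd : 1 ≤ (X : ℝ) ^ δ := Real.one_le_rpow hX1 hδ.le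
  have hL2 : ((L : ℝ)) ^ 2 ≤ X := by exact_mod_cast hLX
  have hLR : (L : ℝ) ≤ X / R := by
    rw [le_div_iff₀ hR0]
    refine abs_le_of_sq_le_sq' ?_ hX'.le |>.2
    rw [mul_pow, sq (X : ℝ)]
    exact mul_le_mul hL2 hRX (by positivity) hX'.le
  have hLd' : ∀ d : ℕ, L < d → Real.sqrt X < d := fun d hd => by
    rw [Real.sqrt_lt' (by exact_mod_cast (by omega : 0 < d))]
    have : X < d ^ 2 := Nat.sqrt_lt'.1 hd
    exact_mod_cast this
  have hM := sqTot_nonneg X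
  -- the three ranges of `d`
  have hpoint : ∀ d ∈ Icc 1 Q, X * (1 / (d : ℝ) *
        ∑ b ∈ cop d, ‖sg d b‖ ^ 3 * ‖cubeDev X d b‖)
      ≤ (1 + gam) * ((X : ℝ) ^ 2 * (if (d : ℝ) ≤ R then gq d / R else gq d / d))
        + C2 * ((X : ℝ) ^ (4 / 3 : ℝ) * R ^ 2 *
          (if (d : ℝ) ≤ R then (ncub d : ℝ) / (d : ℝ) ^ 2 else 0))
        + (if R < (d : ℝ) ∧ d ≤ L then 1 / (d : ℝ) *
          ∑ b ∈ cop d, ‖cubeGen X (b / d)‖ ^ 2 else 0)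
        + (1 + gam) * (R * (X : ℝ) ^ 2 * (if L < d then gq d / d else 0))
        + 2 * (X / R * sqTot X) * (1 / d) := by
    intro d hd
    have hd0 := (mem_Icc.1 hd).1
    have hd' : (0 : ℝ) < d := by exact_mod_cast hd0
    have hdX : (d : ℝ) ≤ X := by exact_mod_cast (mem_Icc.1 hd).2.trans hQX
    have hgq := gq_nonneg d
    have hlast : 0 ≤ 2 * (X / R * sqTot X) * (1 / d) := by positivity
    rw [mul_left_comm]
    rcases le_or_gt (d : ℝ) R with h | h
    · have hdL : d ≤ L := by
        refine Nat.le_sqrt'.2 ?_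
        have : ((d : ℝ)) ^ 2 ≤ X := (pow_le_pow_left₀ hd'.le h 2).trans hRX
        exact_mod_cast this
      rw [if_pos h, if_pos h, if_neg (fun h' => absurd h'.1 (not_lt.2 h)),
        if_neg (by omega)]
      -- The weight d/R turns the Gauss sum part into g(d)/R and leaves (R/d) times the mean square
      -- of the deviations.
      have h1 := two_mul_sum_le (s := cop d) (fun b => X * ‖sg d b‖ ^ 3)
        (fun b => ‖cubeDev X d b‖) (c := d / R) (by positivity)
      have e1 : ∑ b ∈ cop d, (X * ‖sg d b‖ ^ 3) ^ 2 = (X : ℝ) ^ 2 * gq d := by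
        rw [← sum_sg_sq, mul_sum]; exact sum_congr rfl fun b _ => by ring
      have e2 : ∑ b ∈ cop d, X * ‖sg d b‖ ^ 3 * ‖cubeDev X d b‖
          = X * ∑ b ∈ cop d, ‖sg d b‖ ^ 3 * ‖cubeDev X d b‖ := by
        rw [mul_sum]; exact sum_congr rfl fun b _ => by ring
      rw [e1, e2] at h1
      have h2 : ∑ b ∈ cop d, ‖cubeDev X d b‖ ^ 2
          ≤ C2 * (X : ℝ) ^ (4 / 3 : ℝ) * (d * ncub d) := by
        refine le_trans ?_ (hpt X d hd0)
        simp only [sum_dev, cubeDev]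
        exact sum_le_sum_of_subset_of_nonneg (cop_subset d) fun _ _ _ => by positivity
      have h0 : 0 ≤ X * ∑ b ∈ cop d, ‖sg d b‖ ^ 3 * ‖cubeDev X d b‖ := by positivity
      have h3 : X * ∑ b ∈ cop d, ‖sg d b‖ ^ 3 * ‖cubeDev X d b‖
          ≤ d / R * ((X : ℝ) ^ 2 * gq d)
            + C2 * (X : ℝ) ^ (4 / 3 : ℝ) * (d * ncub d) / (d / R) := by
        have := div_le_div_of_nonneg_right h2 (by positivity : 0 ≤ d / R)
        linarith
      have h4 := mul_le_mul_of_nonneg_left h3 (by positivity : 0 ≤ 1 / (d : ℝ))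
      have e3 : 1 / (d : ℝ) * (d / R * ((X : ℝ) ^ 2 * gq d)
            + C2 * (X : ℝ) ^ (4 / 3 : ℝ) * (d * ncub d) / (d / R))
          = (X : ℝ) ^ 2 * (gq d / R)
            + C2 * ((X : ℝ) ^ (4 / 3 : ℝ) * (R * d) * (ncub d / (d : ℝ) ^ 2)) := by
        field_simp
      rw [e3] at h4
      have h5 : C2 * ((X : ℝ) ^ (4 / 3 : ℝ) * (R * d) * (ncub d / (d : ℝ) ^ 2))
          ≤ C2 * ((X : ℝ) ^ (4 / 3 : ℝ) * R ^ 2 * (ncub d / (d : ℝ) ^ 2)) := by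
        rw [sq R]; gcongr
      have h6 : 0 ≤ gam * ((X : ℝ) ^ 2 * (gq d / R)) := by positivity
      rw [mul_zero, mul_zero, add_zero, add_zero, add_mul 1 gam, one_mul]
      linarith
    · rw [if_neg (not_le.2 h), if_neg (not_le.2 h)]
      rcases le_or_gt d L with h' | h'
      · rw [if_pos ⟨h, h'⟩, if_neg (not_lt.2 h')]
        have h1 := mul_le_mul_of_nonneg_left (sum_sg_mul_cubeDev_le X d le_rfl hX)
          (by positivity : 0 ≤ 1 / (d : ℝ))
        have e1 : 1 / (d : ℝ) * ((1 + gam) * (1 * (X : ℝ) ^ 2 * gq d)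
            + (∑ b ∈ cop d, ‖cubeGen X (b / d)‖ ^ 2) / 1)
            = (1 + gam) * ((X : ℝ) ^ 2 * (gq d / d)) + 1 / (d : ℝ) *
          ∑ b ∈ cop d, ‖cubeGen X (b / d)‖ ^ 2 := by ring
        rw [e1] at h1
        linarith
      · rw [if_neg (fun hh => absurd hh.2 (not_le.2 h')), if_pos h']
        -- Here c = R: it gains R on the mean square, whose weighted sum is only logarithmically
        -- large, and loses R on the tail of the singular series, where √X is to spare.
        have h1 := mul_le_mul_of_nonneg_left (sum_sg_mul_cubeDev_le X d hR hX)
          (by positivity : 0 ≤ 1 / (d : ℝ))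
        have h2 : ∑ b ∈ cop d, ‖cubeGen X (b / d)‖ ^ 2 ≤ 2 * X * sqTot X := by
          have h3 := sum_normSq_trig_le hd0 X (fun n => (r3 n : ℂ))
          have h4 : ∑ n ∈ Icc 1 X, ‖(r3 n : ℂ)‖ ^ 2 = sqTot X := by simp [sqTot]
          rw [h4] at h3
          refine (sum_le_sum_of_subset_of_nonneg (cop_subset d)
            fun _ _ _ => by positivity).trans (h3.trans ?_)
          exact mul_le_mul_of_nonneg_right (by linarith) hM
        have h5 : 1 / (d : ℝ) * ((∑ b ∈ cop d, ‖cubeGen X (b / d)‖ ^ 2) / R)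
            ≤ 1 / (d : ℝ) * (2 * X * sqTot X / R) := by gcongr
        have e1 : 1 / (d : ℝ) * (2 * X * sqTot X / R) = 2 * (X / R * sqTot X) * (1 / d) := by
          ring
        have e2 : 1 / (d : ℝ) * ((1 + gam) * (R * (X : ℝ) ^ 2 * gq d))
            = (1 + gam) * (R * (X : ℝ) ^ 2 * (gq d / d)) := by ring
        have h6 : 0 ≤ (1 + gam) * ((X : ℝ) ^ 2 * (gq d / d)) := by positivity
        rw [mul_add, e2] at h1
        linarith
  have hsum := sum_le_sum hpoint
  simp only [sum_add_distrib, ← mul_sum] at hsum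
  set Λ := 1 + Real.log X with hΛd
  have hΛ1 : 1 ≤ Λ := by linarith
  have hΛ2 : 1 ≤ Λ ^ 2 := one_le_pow₀ hΛ1
  set T := Λ ^ 2 * (X : ℝ) ^ δ * E with hT
  have hpos : ∀ d ∈ Icc 1 Q, 0 < d := fun d hd => (mem_Icc.1 hd).1
  have b1 : (1 + gam) * ((X : ℝ) ^ 2 *
      ∑ d ∈ Icc 1 Q, (if (d : ℝ) ≤ R then gq d / R else gq d / d)) ≤ (1 + gam) * C4 * T := by
    have h := (hgs (Icc 1 Q) R hR0 hpos).trans (mul_le_mul_of_nonneg_left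
            (div_le_div_of_nonneg_right hRd hR0.le) hC4.le)
    calc _ ≤ (1 + gam) * ((X : ℝ) ^ 2 * (C4 * ((X : ℝ) ^ δ / R))) := by gcongr
      _ = (1 + gam) * C4 * (1 * (X : ℝ) ^ δ * ((X : ℝ) ^ 2 / R)) := by ring
      _ ≤ _ := by rw [hT]; gcongr
  have b2 : C2 * ((X : ℝ) ^ (4 / 3 : ℝ) * R ^ 2 *
          ∑ d ∈ Icc 1 Q, (if (d : ℝ) ≤ R then (ncub d : ℝ) / (d : ℝ) ^ 2 else 0))
      ≤ C2 * C3 * T := by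
    have h := hnc ((Icc 1 Q).filter (fun d : ℕ => (d : ℝ) ≤ R)) R hR0 fun d hd =>
      ⟨(mem_Icc.1 (mem_filter.1 hd).1).1, (mem_filter.1 hd).2⟩
    rw [sum_filter] at h
    replace h := h.trans (mul_le_mul_of_nonneg_left hRd hC3.le)
    calc _ ≤ C2 * ((X : ℝ) ^ (4 / 3 : ℝ) * R ^ 2 * (C3 * (X : ℝ) ^ δ)) := by gcongr
      _ = C2 * C3 * (1 * (X : ℝ) ^ δ * ((X : ℝ) ^ (4 / 3 : ℝ) * R ^ 2)) := by ring
      _ ≤ _ := by rw [hT]; gcongr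
  have b3 : ∑ d ∈ Icc 1 Q, (if R < (d : ℝ) ∧ d ≤ L then 1 / (d : ℝ) *
          ∑ b ∈ cop d, ‖cubeGen X (b / d)‖ ^ 2 else 0) ≤ 128 * T := by
    have h := sum_normSq_cubeGen_medium_le hL hLX hR0
    calc _ ≤ ∑ d ∈ (Icc 1 L).filter (fun d : ℕ => R < d), 1 / (d : ℝ) *
        ∑ b ∈ cop d, ‖cubeGen X (b / d)‖ ^ 2 := by
          rw [← sum_filter]
          refine sum_le_sum_of_subset_of_nonneg (fun d hd => ?_) fun _ _ _ => by positivity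
          simp only [mem_filter, mem_Icc] at hd ⊢
          exact ⟨⟨hd.1.1, hd.2.2⟩, hd.2.1⟩
      _ ≤ 64 * Λ ^ 2 * (X / R + X / R) * sqTot X := h.trans (by gcongr)
      _ = 128 * (Λ ^ 2 * 1 * (X / R * sqTot X)) := by ring
      _ ≤ _ := by
        have : 0 ≤ X / R * sqTot X := by positivity
        rw [hT]; gcongr
  have b4 : (1 + gam) * (R * (X : ℝ) ^ 2 * ∑ d ∈ Icc 1 Q, (if L < d then gq d / d else 0))
      ≤ (1 + gam) * C4 * T := by
    have h : ∑ d ∈ Icc 1 Q, (if L < d then gq d / d else 0)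
        ≤ C4 * ((X : ℝ) ^ δ / Real.sqrt X) := by
      refine le_trans (sum_le_sum fun d hd => ?_) ((hgs (Icc 1 Q) (Real.sqrt X) (by linarith)
        hpos).trans (mul_le_mul_of_nonneg_left
            (div_le_div_of_nonneg_right hsd (by positivity)) hC4.le))
      have hgq := gq_nonneg d
      split_ifs with h1 h2 h2
      · exact absurd h2 (not_le.2 (hLd' d h1))
      · exact le_rfl
      · positivity
      · positivity
    have e1 : (X : ℝ) ^ 2 / Real.sqrt X = (X : ℝ) ^ (3 / 2 : ℝ) := by
      rw [Real.sqrt_eq_rpow, ← Real.rpow_natCast, ← Real.rpow_sub hX']; norm_num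
    calc _ ≤ (1 + gam) * (R * (X : ℝ) ^ 2 * (C4 * ((X : ℝ) ^ δ / Real.sqrt X))) := by gcongr
      _ = (1 + gam) * C4 * (1 * (X : ℝ) ^ δ * ((X : ℝ) ^ 2 / Real.sqrt X * R)) := by ring
      _ ≤ _ := by rw [e1, hT]; gcongr
  have hQ1 : 1 + Real.log Q ≤ Λ := by
    rcases Nat.eq_zero_or_pos Q with rfl | hQ0
    · simp; exact hΛ1
    · have : (Q : ℝ) ≤ X := by exact_mod_cast hQX
      have := Real.log_le_log (by exact_mod_cast hQ0) this
      linarith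
  have b5 : 2 * (X / R * sqTot X) * ∑ d ∈ (Icc 1 Q : Finset ℕ), 1 / (d : ℝ) ≤ 2 * T := by
    have h := (sum_inv_le_one_add_log Q).trans hQ1
    have h0 : 0 ≤ X / R * sqTot X := by positivity
    calc _ ≤ 2 * (X / R * sqTot X) * Λ := by gcongr
      _ ≤ 2 * (X / R * sqTot X) * Λ ^ 2 := by
          have : Λ ≤ Λ ^ 2 := by nlinarith
          gcongr
      _ = 2 * (Λ ^ 2 * 1 * (X / R * sqTot X)) := by ring
      _ ≤ _ := by rw [hT]; gcongr
  have hmain : X * ∑ d ∈ Icc 1 Q, 1 / (d : ℝ) *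
        ∑ b ∈ cop d, ‖sg d b‖ ^ 3 * ‖cubeDev X d b‖ ≤ A * T := by
    refine hsum.trans ?_
    rw [hA]
    have : ((1 + gam) * C4 + C2 * C3 + 128 + (1 + gam) * C4 + 2) * T
      = (1 + gam) * C4 * T + C2 * C3 * T + 128 * T + (1 + gam) * C4 * T + 2 * T := by ring
    rw [this]; linarith
  have hT0 : 0 ≤ T := by positivity
  have hlogQ : 0 ≤ 1 + Real.log Q := by
    have := Real.log_natCast_nonneg Q; linarith
  calc _ ≤ X * ((1 + Real.log Q) * ∑ d ∈ Icc 1 Q, 1 / (d : ℝ) *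
        ∑ b ∈ cop d, ‖sg d b‖ ^ 3 * ‖cubeDev X d b‖) := by
        gcongr; exact abs_sum_r3_rho_sub_le X Q
    _ = (1 + Real.log Q) * (X * ∑ d ∈ Icc 1 Q, 1 / (d : ℝ) *
        ∑ b ∈ cop d, ‖sg d b‖ ^ 3 * ‖cubeDev X d b‖) := by ring
    _ ≤ Λ * (A * T) := by
        refine (mul_le_mul_of_nonneg_left hmain hlogQ).trans ?_
        gcongr
    _ = Λ ^ 3 * (A * ((X : ℝ) ^ δ * E)) := by rw [hT]; ring
    _ ≤ C1 * (X : ℝ) ^ δ * (A * ((X : ℝ) ^ δ * E)) :=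
        mul_le_mul_of_nonneg_right (hlog X hX1) (by positivity)
    _ = C1 * A * (X : ℝ) ^ (δ + δ) * E := by rw [Real.rpow_add hX']; ring
    _ ≤ _ := by
        have := Real.rpow_le_rpow_of_exponent_le hX1 hδε
        gcongr

/-! ### The constant `C₂` and harmonic sums -/

lemma measurable_bernoulliHalf : Measurable bernoulliHalf := by
  have h : Measurable fun u : ℝ => u - (⌊u⌋ : ℝ) := measurable_fract
  unfold bernoulliHalf
  exact (((h.pow_const 2).const_mul _).sub (h.const_mul _)).add_const _

lemma abs_bernoulliHalf_le (u : ℝ) : |bernoulliHalf u| ≤ 1 := by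
  have h0 := Int.fract_nonneg u
  have h1 := Int.fract_lt_one u
  rw [Int.fract] at h0 h1
  rw [bernoulliHalf, abs_le]
  constructor <;> nlinarith

lemma integrableOn_bernoulliHalf :
    MeasureTheory.IntegrableOn (fun u : ℝ => bernoulliHalf u / u ^ 3) (Set.Ioi (1 : ℝ)) := by
  have h := integrableOn_Ioi_rpow_of_lt (a := -3) (by norm_num) (c := 1) one_pos
  refine MeasureTheory.Integrable.mono' h
    (measurable_bernoulliHalf.div (measurable_id.pow_const 3)).aestronglyMeasurable ?_
  refine (MeasureTheory.ae_restrict_iff' measurableSet_Ioi).2 (Filter.Eventually.of_forall ?_)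
  intro u hu
  have hu0 : (0 : ℝ) < u := lt_trans one_pos hu
  rw [Real.rpow_neg hu0.le, Real.norm_eq_abs, abs_div, abs_of_pos (pow_pos hu0 3),
    div_eq_mul_inv, show (3 : ℝ) = ((3 : ℕ) : ℝ) by norm_num, Real.rpow_natCast]
  exact mul_le_of_le_one_left (by positivity) (abs_bernoulliHalf_le u)

lemma integral_bernoulliHalf_unit {n : ℕ} (hn : 0 < n) :
    ∫ u in (n : ℝ)..((n : ℝ) + 1), bernoulliHalf u / u ^ 3
      = (1 / 2 * Real.log (n + 1) - 1 / 2 * Real.log n) - 1 / 4 * (1 / n + 1 / (n + 1))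
        + 1 / 24 * (1 / (n : ℝ) ^ 2 - 1 / ((n : ℝ) + 1) ^ 2) := by
  have hn' : (0 : ℝ) < n := by exact_mod_cast hn
  have hcongr : Set.EqOn (fun u : ℝ => bernoulliHalf u / u ^ 3)
      (fun u => (1 / 2 * (u - n) ^ 2 - 1 / 2 * (u - n) + 1 / 12) / u ^ 3)
      (Set.uIcc (n : ℝ) (n + 1)) := by
    intro u hu
    rw [Set.uIcc_of_le (by linarith)] at hu
    simp only
    congr 1
    -- At the right end the fractional part jumps from 1 to 0, but the quadratic takes the same
    -- value at both, so the congruence holds on the closed interval.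
    rcases eq_or_lt_of_le hu.2 with h | h
    · subst h
      rw [bernoulliHalf]
      have : ⌊(n : ℝ) + 1⌋ = (n : ℤ) + 1 := by
        rw [Int.floor_eq_iff]; push_cast; constructor <;> linarith
      rw [this]; push_cast; ring
    · have : ⌊u⌋ = (n : ℤ) := by
        rw [Int.floor_eq_iff]; push_cast; exact ⟨hu.1, h⟩
      rw [bernoulliHalf, this]; push_cast; ring
  rw [intervalIntegral.integral_congr hcongr]
  have hderiv : ∀ u ∈ Set.uIcc (n : ℝ) (n + 1),
      HasDerivAt (fun u : ℝ => 1 / 2 * Real.log u + (n + 1 / 2) * u⁻¹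
        - ((n : ℝ) ^ 2 + n + 1 / 6) / 4 * (u ^ 2)⁻¹)
        ((1 / 2 * (u - n) ^ 2 - 1 / 2 * (u - n) + 1 / 12) / u ^ 3) u := by
    intro u hu
    rw [Set.uIcc_of_le (by linarith)] at hu
    have hu0 : 0 < u := hn'.trans_le hu.1
    have d1 := (Real.hasDerivAt_log hu0.ne').const_mul (1 / 2 : ℝ)
    have d2 := (hasDerivAt_inv hu0.ne').const_mul ((n : ℝ) + 1 / 2)
    have d3 := ((hasDerivAt_pow 2 u).inv (by positivity)).const_mul
      (((n : ℝ) ^ 2 + n + 1 / 6) / 4)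
    refine ((d1.add d2).sub d3).congr_deriv ?_
    field_simp
    ring
  rw [intervalIntegral.integral_eq_sub_of_hasDerivAt hderiv]
  · field_simp
    ring
  · refine ContinuousOn.intervalIntegrable fun u hu => ContinuousAt.continuousWithinAt ?_
    rw [Set.uIcc_of_le (by linarith)] at hu
    have hu0 : u ^ 3 ≠ 0 := pow_ne_zero _ (hn'.trans_le hu.1).ne'
    fun_prop (disch := assumption)

/-- The unit integrals telescope except for the harmonic number, which is how Euler's constant
enters. -/
lemma integral_bernoulliHalf_nat (n : ℕ) :
    ∫ u in (1 : ℝ)..((n : ℝ) + 1), bernoulliHalf u / u ^ 3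
      = 7 / 24 + 1 / (4 * (n + 1)) - 1 / 24 * (1 / ((n : ℝ) + 1) ^ 2)
        - 1 / 2 * (harmonic (n + 1) - Real.log (n + 1)) := by
  have hint : ∀ a b : ℝ, 1 ≤ a → a ≤ b → IntervalIntegrable
      (fun u : ℝ => bernoulliHalf u / u ^ 3) MeasureTheory.volume a b := by
    intro a b ha hab
    rw [intervalIntegrable_iff, Set.uIoc_of_le hab]
    exact integrableOn_bernoulliHalf.mono_set fun u hu => lt_of_le_of_lt ha hu.1
  induction n with
  | zero => simp; norm_num
  | succ n ih =>
    have h0 : (0 : ℝ) ≤ n := Nat.cast_nonneg n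
    rw [← intervalIntegral.integral_add_adjacent_intervals
      (hint 1 (n + 1) le_rfl (by linarith)) (hint (n + 1) _ (by linarith) (by push_cast; linarith)),
      ih]
    have h := integral_bernoulliHalf_unit (n := n + 1) (by omega)
    push_cast at h ⊢
    rw [h, harmonic_succ (n + 1)]
    push_cast
    field_simp
    ring

lemma integral_bernoulliHalf : ∫ u in Set.Ioi (1 : ℝ), bernoulliHalf u / u ^ 3
    = (7 / 12 - Real.eulerMascheroniConstant) / 2 := by
  have hn : Filter.Tendsto (fun n : ℕ => (n : ℝ) + 1) Filter.atTop Filter.atTop :=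
    Filter.tendsto_atTop_add_const_right _ _ tendsto_natCast_atTop_atTop
  have h1 := MeasureTheory.intervalIntegral_tendsto_integral_Ioi (1 : ℝ)
    integrableOn_bernoulliHalf hn
  refine tendsto_nhds_unique h1 ?_
  simp only [integral_bernoulliHalf_nat]
  have t1 : Filter.Tendsto (fun n : ℕ => 1 / ((n : ℝ) + 1)) Filter.atTop (nhds 0) :=
    tendsto_one_div_add_atTop_nhds_zero_nat
  have t2 : Filter.Tendsto (fun n : ℕ => (harmonic (n + 1) : ℝ) - Real.log ((n : ℝ) + 1))
      Filter.atTop (nhds Real.eulerMascheroniConstant) := by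
    have := (Filter.tendsto_add_atTop_iff_nat 1).2 Real.tendsto_harmonic_sub_log
    push_cast at this
    exact this
  have h := (((t1.const_mul (1 / 4 : ℝ)).const_add (7 / 24 : ℝ)).sub
    ((t1.pow 2).const_mul (1 / 24 : ℝ))).sub (t2.const_mul (1 / 2 : ℝ))
  refine (h.congr fun n => ?_).trans (le_of_eq ?_)
  · have : (0 : ℝ) < (n : ℝ) + 1 := by positivity
    field_simp
  · congr 1; ring

lemma constC2_eq : constC2 = Real.eulerMascheroniConstant - 3 / 2 := by
  rw [constC2, integral_bernoulliHalf]; ring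

/-- `∑_{k ≤ u} f(k / u) / k`. -/
def harmSum (f : ℝ → ℝ) (u : ℝ) : ℝ := ∑ k ∈ Icc 1 ⌊u⌋₊, 1 / (k : ℝ) * f (k / u)

lemma harmSum_of_lt_one (f : ℝ → ℝ) {u : ℝ} (hu : u < 1) : harmSum f u = 0 := by
  rw [harmSum, Nat.floor_eq_zero.2 hu]; simp

lemma abs_harmonic_sub_log_le {u : ℝ} (hu : 1 ≤ u) :
    |∑ k ∈ (Icc 1 ⌊u⌋₊ : Finset ℕ), 1 / (k : ℝ) - Real.log u - Real.eulerMascheroniConstant|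
      ≤ 2 / u := by
  set n := ⌊u⌋₊ with hn
  have hn1 : 1 ≤ n := Nat.le_floor (by exact_mod_cast hu)
  have hn' : (1 : ℝ) ≤ n := by exact_mod_cast hn1
  have hnu : (n : ℝ) ≤ u := Nat.floor_le (by linarith)
  have hun : u < n + 1 := Nat.lt_floor_add_one u
  have hH : ∑ k ∈ (Icc 1 n : Finset ℕ), 1 / (k : ℝ) = harmonic n := by
    rw [harmonic_eq_sum_Icc]; push_cast; simp [one_div]
  have h1 := Real.eulerMascheroniSeq_lt_eulerMascheroniConstant n
  have h2 := Real.eulerMascheroniConstant_lt_eulerMascheroniSeq' n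
  rw [Real.eulerMascheroniSeq] at h1
  rw [Real.eulerMascheroniSeq', if_neg (by omega)] at h2
  have h3 := Real.log_le_log (by linarith) hnu
  have h4 := Real.log_le_log (by linarith) hun.le
  have h5 : Real.log ((n : ℝ) + 1) - Real.log n ≤ 1 / n := by
    rw [← Real.log_div (by linarith) (by linarith)]
    refine (Real.log_le_sub_one_of_pos (by positivity)).trans (le_of_eq ?_)
    field_simp; ring
  have h6 : 1 / (n : ℝ) ≤ 2 / u := by
    rw [div_le_div_iff₀ (by linarith) (by linarith)]; linarith
  rw [hH, abs_le]
  constructor <;> linarith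

/-- For u < 1 the sum is empty, and u^(δ-1) dominates both log(1/u) and the constant. Allowing these
u lets the singular series later be summed over all d without truncation. -/
lemma exists_of_abs_le {f : ℝ → ℝ} {κ C δ : ℝ} (hδ : 0 < δ) (hδ1 : δ < 1)
    (h : ∀ u, 1 ≤ u → |harmSum f u - Real.log u - κ| ≤ C / u) :
    ∃ K : ℝ, 0 < K ∧ ∀ u, 0 < u → |harmSum f u - Real.log u - κ| ≤ K * u ^ (δ - 1) := by
  refine ⟨|C| + 1 / (1 - δ) + |κ|, ?_, fun u hu => ?_⟩
  · have : 0 < 1 / (1 - δ) := one_div_pos.2 (by linarith)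
    positivity
  have hd : 0 < 1 / (1 - δ) := one_div_pos.2 (by linarith)
  rcases le_or_gt 1 u with h1 | h1
  · refine (h u h1).trans ?_
    have h2 : u ^ (δ - 1) = u ^ δ / u := Real.rpow_sub_one hu.ne' δ
    have h3 : 1 ≤ u ^ δ := Real.one_le_rpow h1 hδ.le
    rw [h2, ← mul_div_assoc]
    refine div_le_div_of_nonneg_right ?_ hu.le
    calc C ≤ |C| * 1 := by rw [mul_one]; exact le_abs_self C
      _ ≤ (|C| + 1 / (1 - δ) + |κ|) * u ^ δ := by
        gcongr
        have := abs_nonneg κ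
        linarith
  · rw [harmSum_of_lt_one f h1]
    have h2 : 1 ≤ u ^ (δ - 1) := Real.one_le_rpow_of_pos_of_le_one_of_nonpos hu h1.le (by linarith)
    have h3 := Real.log_le_rpow_div (inv_pos.2 hu).le (ε := 1 - δ) (by linarith)
    rw [Real.log_inv, Real.inv_rpow hu.le, ← Real.rpow_neg hu.le, neg_sub] at h3
    have h4 : Real.log u < 0 := Real.log_neg hu h1
    have h5 : |0 - Real.log u - κ| ≤ u ^ (δ - 1) / (1 - δ) + |κ| := by
      refine (abs_sub _ _).trans ?_
      rw [zero_sub, abs_neg, abs_of_neg h4]; linarith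
    refine h5.trans ?_
    rw [add_mul, add_mul]
    have h6 : |κ| ≤ |κ| * u ^ (δ - 1) := le_mul_of_one_le_right (abs_nonneg _) h2
    have h7 : 0 ≤ |C| * u ^ (δ - 1) := by positivity
    have h8 : u ^ (δ - 1) / (1 - δ) = 1 / (1 - δ) * u ^ (δ - 1) := by ring
    linarith

lemma harmSum_one (u : ℝ) :
    harmSum (fun _ => 1) u = ∑ k ∈ (Icc 1 ⌊u⌋₊ : Finset ℕ), 1 / (k : ℝ) := by simp [harmSum]

lemma sum_Icc_cast (n : ℕ) : ∑ k ∈ (Icc 1 n : Finset ℕ), (k : ℝ) = n * (n + 1) / 2 := by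
  induction n with
  | zero => simp
  | succ n ih => rw [sum_Icc_succ_top (by omega), ih]; push_cast; ring

/-- Expanding the square gives the harmonic sum, then -2, then +1/2, each up to O(1/u); hence the
shift by -3/2. -/
lemma abs_harmSum_sq_le {u : ℝ} (hu : 1 ≤ u) :
    |harmSum (fun t => (1 - t) ^ 2) u - Real.log u - (Real.eulerMascheroniConstant - 3 / 2)|
      ≤ 6 / u := by
  have hu0 : 0 < u := by linarith
  set n := ⌊u⌋₊ with hn
  have hnu : (n : ℝ) ≤ u := Nat.floor_le (by linarith)
  have hun : u < n + 1 := Nat.lt_floor_add_one u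
  have h1 : harmSum (fun t => (1 - t) ^ 2) u
      = ∑ k ∈ (Icc 1 n : Finset ℕ), 1 / (k : ℝ) - 2 / u * n + n * (n + 1) / 2 / u ^ 2 := by
    have h2 : ∀ k ∈ Icc 1 n, 1 / (k : ℝ) * (1 - k / u) ^ 2
        = 1 / (k : ℝ) - 2 / u + k * (1 / u ^ 2) := by
      intro k hk
      have : (k : ℝ) ≠ 0 := by
        have := (mem_Icc.1 hk).1; positivity
      field_simp; ring
    rw [harmSum, sum_congr rfl h2, sum_add_distrib, sum_sub_distrib, ← sum_mul, sum_Icc_cast]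
    simp; ring
  have h3 := abs_le.1 (abs_harmonic_sub_log_le hu)
  rw [← hn] at h3
  have h4 : - (2 / u) ≤ 2 - 2 / u * n - 0 ∧ 2 - 2 / u * n ≤ 2 / u := by
    have e : 2 - 2 / u * n = 2 * (u - n) / u := by field_simp
    rw [sub_zero, e, ← neg_div]
    constructor <;> refine div_le_div_of_nonneg_right ?_ hu0.le <;> linarith
  have h5 : - (2 / u) ≤ n * (n + 1) / 2 / u ^ 2 - 1 / 2 ∧
      n * (n + 1) / 2 / u ^ 2 - 1 / 2 ≤ 2 / u := by
    have e : (n : ℝ) * (n + 1) / 2 / u ^ 2 - 1 / 2 = (n * (n + 1) - u ^ 2) / (2 * u) / u := by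
      field_simp
    rw [e, ← neg_div]
    have hn0 : (0 : ℝ) ≤ n := Nat.cast_nonneg n
    constructor <;> refine div_le_div_of_nonneg_right ?_ hu0.le
    · rw [le_div_iff₀ (by positivity)]; nlinarith
    · rw [div_le_iff₀ (by positivity)]; nlinarith
  rw [h1, abs_le]
  have e6 : 6 / u = 2 / u + 2 / u + 2 / u := by ring
  rw [e6]
  constructor <;> linarith [h3.1, h3.2, h4.1, h4.2, h5.1, h5.2]

/-! ### The singular series -/

/-- `∑ g(q) / q`. -/
def cZero : ℝ := ∑' q : ℕ, gq q / q

/-- `∑ g(q) log q / q`. -/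
def cOne : ℝ := ∑' q : ℕ, gq q / q * Real.log q

lemma summable_gq_div : Summable (fun q : ℕ => gq q / q) := by
  refine (summable_gq one_pos).congr fun q => ?_
  rw [Real.rpow_neg_one]; rfl

lemma summable_gq_mul_log : Summable (fun q : ℕ => gq q / q * Real.log q) := by
  refine Summable.of_nonneg_of_le (fun q => mul_nonneg (div_nonneg (gq_nonneg q)
    (Nat.cast_nonneg q)) (Real.log_natCast_nonneg q)) (fun q => ?_)
    ((summable_gq (δ := 1 / 2) (by norm_num)).mul_left 2)
  rcases Nat.eq_zero_or_pos q with rfl | hq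
  · simp [gq, cop]
  have hq' : (0 : ℝ) < q := by exact_mod_cast hq
  have h := Real.log_le_rpow_div hq'.le (ε := 1 / 2) (by norm_num)
  have hg := gq_nonneg q
  calc gq q / q * Real.log q ≤ gq q / q * ((q : ℝ) ^ (1 / 2 : ℝ) / (1 / 2)) := by gcongr
    _ = 2 * (gq q * ((q : ℝ) ^ (1 / 2 : ℝ) / q)) := by ring
    _ = _ := by
      rw [← Real.rpow_sub_one hq'.ne']; norm_num

lemma term_zero_eq (q : ℕ) : 1 / (q : ℝ) ^ 7 * gaussSixth q = gq q / q := by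
  rw [gq_eq]; ring

lemma term_one_eq (q : ℕ) : Real.log (q : ℝ) / (q : ℝ) ^ 7 * gaussSixth q
    = gq q / q * Real.log q := by
  rw [gq_eq]; ring

lemma gam_sq : Real.Gamma (4 / 3) ^ 6 = gam ^ 2 := by rw [gam]; ring

lemma constC0_eq : constC0 = gam ^ 2 * cZero := by
  rw [constC0, gam_sq, cZero]; simp only [term_zero_eq]

lemma constC1_eq : constC1 = gam ^ 2 * cOne := by
  rw [constC1, gam_sq, cOne]; simp only [term_one_eq]

/-- `∑_{l ≤ T} h(l) / l · f(l / T)`. -/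
def hSum (f : ℝ → ℝ) (T : ℝ) : ℝ := ∑ l ∈ Icc 1 ⌊T⌋₊, hFun l / l * f (l / T)

lemma hSum_eq (f : ℝ → ℝ) (T : ℝ) :
    hSum f T = ∑ d ∈ Icc 1 ⌊T⌋₊, gq d / d * harmSum f (T / d) := by
  have h1 : hSum f T = ∑ d ∈ Icc 1 ⌊T⌋₊, ∑ l ∈ (Icc 1 ⌊T⌋₊).filter (d ∣ ·),
      gq d * (1 / (l : ℝ) * f (l / T)) := by
    have h2 : ∀ l ∈ Icc 1 ⌊T⌋₊, hFun l / l * f (l / T)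
        = ∑ d ∈ l.divisors, gq d * (1 / (l : ℝ) * f (l / T)) := by
      intro l _
      rw [hFun_eq, ← sum_mul]; ring
    rw [hSum, sum_congr rfl h2]
    refine sum_comm' fun l d => ?_
    simp only [mem_Icc, Nat.mem_divisors, mem_filter]
    constructor
    · rintro ⟨⟨h1, h2⟩, h3, -⟩
      exact ⟨⟨⟨h1, h2⟩, h3⟩, Nat.pos_of_dvd_of_pos h3 h1, (Nat.le_of_dvd h1 h3).trans h2⟩
    · rintro ⟨⟨⟨h1, h2⟩, h3⟩, -⟩
      exact ⟨⟨h1, h2⟩, h3, by omega⟩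
  rw [h1]
  refine sum_congr rfl fun d hd => ?_
  have hd0 := (mem_Icc.1 hd).1
  have hd' : (d : ℝ) ≠ 0 := by positivity
  rw [harmSum, mul_sum]
  symm
  refine sum_bij (fun k _ => d * k) ?_ ?_ ?_ ?_
  · intro k hk
    simp only [mem_Icc, mem_filter, Nat.floor_div_natCast] at hk ⊢
    refine ⟨⟨Nat.mul_pos hd0 hk.1, ?_⟩, dvd_mul_right _ _⟩
    rw [mul_comm]
    exact (Nat.le_div_iff_mul_le hd0).1 hk.2
  · intro a _ b _ h
    exact Nat.eq_of_mul_eq_mul_left hd0 h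
  · intro l hl
    simp only [mem_Icc, mem_filter] at hl
    obtain ⟨⟨h1, h2⟩, k, rfl⟩ := hl
    refine ⟨k, ?_, rfl⟩
    simp only [mem_Icc, Nat.floor_div_natCast]
    refine ⟨Nat.pos_of_mul_pos_left h1, ?_⟩
    rw [Nat.le_div_iff_mul_le hd0, mul_comm]; exact h2
  · intro k hk
    have hk' : (k : ℝ) ≠ 0 := by have := (mem_Icc.1 hk).1; positivity
    have e1 : (k : ℝ) / (T / d) = ((d * k : ℕ) : ℝ) / T := by
      push_cast; rw [div_div_eq_mul_div, mul_comm]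
    rw [e1]
    push_cast
    field_simp

/-- Since h is a divisor sum of g, the sum becomes a g(d)/d-weighted sum of `harmSum` at T/d. Its
main term log T - log d + κ sums to `cZero` and `cOne`, and the error T^(δ-1) d^(1-δ) leaves the
convergent series of g(d) d^(-δ). -/
theorem exists_abs_hSum_sub_le {f : ℝ → ℝ} {κ C δ : ℝ} (hδ : 0 < δ) (hδ1 : δ < 1)
    (h : ∀ u, 1 ≤ u → |harmSum f u - Real.log u - κ| ≤ C / u) :
    ∃ K : ℝ, 0 < K ∧ ∀ T : ℝ, 1 ≤ T →
      |hSum f T - (cZero * (Real.log T + κ) - cOne)| ≤ K * T ^ (δ - 1) := by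
  obtain ⟨K, hK, hb⟩ := exists_of_abs_le hδ hδ1 h
  have hs := summable_gq hδ
  set G := ∑' q : ℕ, gq q * (q : ℝ) ^ (-δ) with hG
  have hG0 : 0 ≤ G := tsum_nonneg fun d => mul_nonneg (gq_nonneg d) (by positivity)
  refine ⟨K * (G + 1), by positivity, fun T hT => ?_⟩
  have hT0 : 0 < T := by linarith
  set F : ℕ → ℝ := fun d => gq d / d * harmSum f (T / d) with hF
  have hF0 : ∀ d ∉ Icc 1 ⌊T⌋₊, F d = 0 := by
    intro d hd
    rcases Nat.eq_zero_or_pos d with rfl | hd0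
    · simp [hF]
    · have : T < d := by
        rw [← Nat.floor_lt hT0.le]
        simp only [mem_Icc, not_and, not_le] at hd
        exact hd hd0
      have h1 : T / d < 1 := (div_lt_one (by linarith)).2 this
      simp [hF, harmSum_of_lt_one f h1]
  have hsF : HasSum F (hSum f T) := by
    rw [hSum_eq]; exact hasSum_sum_of_ne_finset_zero hF0
  have hsm : HasSum (fun d : ℕ => gq d / d * (Real.log T + κ) - gq d / d * Real.log d)
      (cZero * (Real.log T + κ) - cOne) :=
    (summable_gq_div.hasSum.mul_right _).sub summable_gq_mul_log.hasSum
  have hdiff := hsF.sub hsm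
  have hterm : ∀ d : ℕ, ‖F d - (gq d / d * (Real.log T + κ) - gq d / d * Real.log d)‖
      ≤ K * T ^ (δ - 1) * (gq d * (d : ℝ) ^ (-δ)) := by
    intro d
    rcases Nat.eq_zero_or_pos d with rfl | hd0
    · simp [hF, gq, cop]
    have hd' : (0 : ℝ) < d := by exact_mod_cast hd0
    have hg := gq_nonneg d
    have e1 : F d - (gq d / d * (Real.log T + κ) - gq d / d * Real.log d)
        = gq d / d * (harmSum f (T / d) - Real.log (T / d) - κ) := by
      rw [Real.log_div hT0.ne' hd'.ne']; simp only [hF]; ring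
    rw [e1, norm_mul, Real.norm_of_nonneg (by positivity), Real.norm_eq_abs]
    refine (mul_le_mul_of_nonneg_left (hb (T / d) (by positivity)) (by positivity)).trans
      (le_of_eq ?_)
    rw [Real.div_rpow hT0.le hd'.le, Real.rpow_neg hd'.le, Real.rpow_sub_one hd'.ne' δ]
    field_simp
  have h2 := tsum_of_norm_bounded (hs.hasSum.mul_left (K * T ^ (δ - 1))) hterm
  rw [hdiff.tsum_eq, Real.norm_eq_abs] at h2
  refine h2.trans ?_
  have : 0 ≤ T ^ (δ - 1) := by positivity
  nlinarith [mul_nonneg hK.le this]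

/-- The main terms of the variance. -/
theorem exists_abs_main_sub_le {ε : ℝ} (hε : 0 < ε) : ∃ K : ℝ, 0 < K ∧ ∀ x Q : ℝ, 1 ≤ x →
    Real.sqrt x ≤ Q →
      |hSum (fun _ => 1) (Real.sqrt x) + hSum (fun t => (1 - t) ^ 2) (Real.sqrt x)
        - hSum (fun _ => 1) Q - (cZero * Real.log (x / Q) + cZero * constC2 - cOne)|
        ≤ K * x ^ (-(1 / 2 : ℝ) + ε) := by
  set δ := min ε (1 / 2) with hδd
  have hδ : 0 < δ := lt_min hε (by norm_num)
  have hδ1 : δ < 1 := lt_of_le_of_lt (min_le_right _ _) (by norm_num)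
  have hδε : δ ≤ ε := min_le_left _ _
  obtain ⟨K1, hK1, h1⟩ := exists_abs_hSum_sub_le hδ hδ1 (f := fun _ => 1)
    (κ := Real.eulerMascheroniConstant) (C := 2)
    (fun u hu => by rw [harmSum_one]; exact abs_harmonic_sub_log_le hu)
  obtain ⟨K2, hK2, h2⟩ := exists_abs_hSum_sub_le hδ hδ1 (fun u hu => abs_harmSum_sq_le hu)
  refine ⟨2 * K1 + K2, by positivity, fun x Q hx hQ => ?_⟩
  have hx0 : 0 < x := by linarith
  have hs : 1 ≤ Real.sqrt x := Real.one_le_sqrt.2 hx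
  have hQ0 : 0 < Q := by linarith
  have e1 : Real.sqrt x ^ (δ - 1) ≤ x ^ (-(1 / 2 : ℝ) + ε) := by
    rw [Real.sqrt_eq_rpow, ← Real.rpow_mul hx0.le]
    exact Real.rpow_le_rpow_of_exponent_le hx (by linarith)
  have e2 : Q ^ (δ - 1) ≤ Real.sqrt x ^ (δ - 1) :=
    Real.rpow_le_rpow_of_nonpos (by linarith) hQ (by linarith)
  have a1 := abs_le.1 (h1 _ hs)
  have a2 := abs_le.1 (h2 _ hs)
  have a3 := abs_le.1 (h1 Q (hs.trans hQ))
  -- The logarithms add to ½ log x + ½ log x - log Q, the constants to γ + (γ - 3/2) - γ, and `cOne`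
  -- occurs 1 + 1 - 1 times.
  rw [constC2_eq, Real.log_div hx0.ne' hQ0.ne']
  have e3 : Real.log (Real.sqrt x) = Real.log x / 2 := Real.log_sqrt hx0.le
  rw [e3] at a1 a2
  have m1 := mul_le_mul_of_nonneg_left e1 hK1.le
  have m2 := mul_le_mul_of_nonneg_left e1 hK2.le
  have m3 := mul_le_mul_of_nonneg_left (e2.trans e1) hK1.le
  rw [abs_le]
  constructor <;> linarith [a1.1, a1.2, a2.1, a2.2, a3.1, a3.2]

lemma exists_hSum_le : ∃ C : ℝ, 0 < C ∧ ∀ L : ℕ,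
    ∑ l ∈ Icc 1 L, hFun l / l ≤ C * (1 + Real.log L) := by
  have hc : 0 ≤ cZero := tsum_nonneg fun q => div_nonneg (gq_nonneg q) (Nat.cast_nonneg q)
  refine ⟨cZero + 1, by positivity, fun L => ?_⟩
  have h1 : ∑ l ∈ Icc 1 L, hFun l / l = ∑ d ∈ Icc 1 L, wt L d * gq d := by
    rw [← sum_inv_mul_sum_divisors]
    exact sum_congr rfl fun l _ => by rw [hFun_eq]; ring
  have hl : 0 ≤ 1 + Real.log L := by have := Real.log_natCast_nonneg L; linarith
  have h2 : ∑ d ∈ Icc 1 L, wt L d * gq d ≤ ∑ d ∈ Icc 1 L, (1 + Real.log L) * (gq d / d) := by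
    refine sum_le_sum fun d hd => ?_
    refine (mul_le_mul_of_nonneg_right (wt_le (mem_Icc.1 hd).1) (gq_nonneg d)).trans
      (le_of_eq (by ring))
  have h3 : ∑ d ∈ Icc 1 L, gq d / (d : ℝ) ≤ cZero :=
    summable_gq_div.sum_le_tsum _ fun q _ => div_nonneg (gq_nonneg q) (Nat.cast_nonneg q)
  rw [h1]
  refine h2.trans ?_
  rw [← mul_sum, mul_comm]
  exact mul_le_mul_of_nonneg_right (by linarith) hl

/-! ### Switching divisors -/

/-- For a pair with difference t, the divisors q > Q of t correspond to l = t/q with l Q < t; since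
t ≤ X < (K + 1) Q, such l are at most K. The right side does not depend on Q, so two values of Q can
be compared. -/
lemma sum_pairSum_switch {X K : ℕ} {Q : ℝ} (hQ : 0 < Q) (hK : X < (K + 1) * Q) :
    ∑ q ∈ Icc 1 ⌊Q⌋₊, pairSum X q 0 + ∑ l ∈ Icc 1 K, pairSum X l ⌊l * Q⌋₊
      = ∑ q ∈ Icc 1 X, pairSum X q 0 := by
  have hcomm : ∀ (s : Finset ℕ) (y : ℕ → ℕ), ∑ l ∈ s, pairSum X l (y l)
      = ∑ m ∈ Icc 1 X, ∑ n ∈ Icc 1 X, ∑ l ∈ s,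
        if m + y l < n ∧ m ≡ n [MOD l] then (r3 n : ℝ) * r3 m else 0 := by
    intro s y
    simp only [pairSum]
    rw [sum_comm]
    exact sum_congr rfl fun m _ => sum_comm
  rw [hcomm (Icc 1 ⌊Q⌋₊) (fun _ => 0), hcomm (Icc 1 K) (fun l => ⌊l * Q⌋₊),
    hcomm (Icc 1 X) (fun _ => 0), ← sum_add_distrib]
  refine sum_congr rfl fun m hm => ?_
  rw [← sum_add_distrib]
  refine sum_congr rfl fun n hn => ?_
  simp only [mem_Icc] at hm hn
  rcases le_or_gt n m with hnm | hnm
  · rw [sum_eq_zero fun l _ => if_neg (by omega), sum_eq_zero fun l _ => if_neg (by omega),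
      sum_eq_zero fun l _ => if_neg (by omega), add_zero]
  obtain ⟨t, rfl⟩ : ∃ t, n = m + t := ⟨n - m, by omega⟩
  have ht : 0 < t := by omega
  have htX : t ≤ X := by omega
  have hmod : ∀ l, m ≡ m + t [MOD l] ↔ l ∣ t := by
    intro l
    rw [Nat.modEq_iff_dvd' (by omega), Nat.add_sub_cancel_left]
  simp only [← sum_filter]
  rw [sum_const, sum_const, sum_const, ← add_smul]
  congr 1
  have hA : (Icc 1 X).filter (fun q => m + 0 < m + t ∧ m ≡ m + t [MOD q])
      = (Icc 1 ⌊Q⌋₊).filter (fun q => m + 0 < m + t ∧ m ≡ m + t [MOD q])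
        ∪ ((Icc 1 X).filter (fun q => q ∣ t ∧ Q < q)) := by
    ext q
    simp only [mem_filter, mem_union, mem_Icc, hmod]
    constructor
    · rintro ⟨⟨h1, h2⟩, h3, h4⟩
      rcases le_or_gt (q : ℝ) Q with h | h
      · exact Or.inl ⟨⟨h1, Nat.le_floor h⟩, h3, h4⟩
      · exact Or.inr ⟨⟨h1, h2⟩, h4, h⟩
    · rintro (⟨⟨h1, h2⟩, h3, h4⟩ | ⟨⟨h1, h2⟩, h4, h⟩)
      · exact ⟨⟨h1, (Nat.le_of_dvd ht h4).trans htX⟩, h3, h4⟩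
      · exact ⟨⟨h1, h2⟩, by omega, h4⟩
  have hd : Disjoint ((Icc 1 ⌊Q⌋₊).filter (fun q => m + 0 < m + t ∧ m ≡ m + t [MOD q]))
      ((Icc 1 X).filter (fun q => q ∣ t ∧ Q < q)) := by
    rw [disjoint_left]
    intro q h1 h2
    simp only [mem_filter, mem_Icc] at h1 h2
    have := (Nat.le_floor_iff hQ.le).1 h1.1.2
    linarith [h2.2.2]
  rw [hA, card_union_of_disjoint hd]
  congr 1
  have hfl : ∀ l : ℕ, m + ⌊(l : ℝ) * Q⌋₊ < m + t ↔ (l : ℝ) * Q < t := by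
    intro l
    rw [Nat.add_lt_add_iff_left, Nat.floor_lt (by positivity)]
  refine card_bij' (fun l _ => t / l) (fun l _ => t / l) ?_ ?_ ?_ ?_
  · intro l hl
    simp only [mem_filter, mem_Icc, hmod, hfl] at hl ⊢
    obtain ⟨⟨h1, h2⟩, h3, k, rfl⟩ := hl
    rw [Nat.mul_div_cancel_left _ h1]
    have hk : 0 < k := Nat.pos_of_mul_pos_left ht
    have hl' : (0 : ℝ) < l := by exact_mod_cast h1
    refine ⟨⟨hk, le_trans (Nat.le_mul_of_pos_left k h1) htX⟩, dvd_mul_left _ _, ?_⟩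
    push_cast at h3
    exact lt_of_mul_lt_mul_left h3 hl'.le
  · intro q hq
    simp only [mem_filter, mem_Icc, hmod, hfl] at hq ⊢
    obtain ⟨⟨h1, h2⟩, ⟨k, rfl⟩, h3⟩ := hq
    rw [Nat.mul_div_cancel_left _ h1]
    have hk : 0 < k := Nat.pos_of_mul_pos_left ht
    have hk' : (0 : ℝ) < k := by exact_mod_cast hk
    have h4 : (k : ℝ) * Q < ((q * k : ℕ) : ℝ) := by push_cast; nlinarith
    have h5 : (k : ℝ) * Q < (K + 1) * Q := by
      have : ((q * k : ℕ) : ℝ) ≤ X := by exact_mod_cast htX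
      linarith
    have h6 : (k : ℝ) < ((K + 1 : ℕ) : ℝ) := by push_cast; exact lt_of_mul_lt_mul_right h5 hQ.le
    exact ⟨⟨hk, Nat.lt_succ_iff.1 (by exact_mod_cast h6)⟩, h4, dvd_mul_left _ _⟩
  · intro l hl
    simp only [mem_filter, mem_Icc, hmod] at hl
    exact Nat.div_div_self hl.2.2 ht.ne'
  · intro l hl
    simp only [mem_filter, mem_Icc] at hl
    exact Nat.div_div_self hl.2.1 ht.ne'

lemma two_mul_pairCount {X y : ℕ} (hy : y ≤ X) :
    2 * pairCount X y = ((X : ℝ) - y) ^ 2 - (X - y) := by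
  have h1 : pairCount X y = ∑ m ∈ Icc 1 X, ((X - (m + y) : ℕ) : ℝ) := by
    refine sum_congr rfl fun m hm => ?_
    rw [← sum_filter, sum_const, nsmul_eq_mul, mul_one]
    congr 1
    have : (Icc 1 X).filter (fun n => m + y < n) = Ioc (m + y) X := by
      ext n; simp only [mem_filter, mem_Icc, mem_Ioc]; omega
    rw [this, Nat.card_Ioc]
  obtain ⟨a, rfl⟩ : ∃ a, X = a + y := ⟨X - y, by omega⟩
  have h2 : ∀ a, ∑ m ∈ Icc 1 (a + y), ((a + y - (m + y) : ℕ) : ℝ)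
      = ∑ m ∈ Icc 1 a, ((a - m : ℕ) : ℝ) := by
    intro a
    symm
    refine sum_subset_zero_on_sdiff (Icc_subset_Icc_right (by omega)) (fun m hm => ?_)
      fun m hm => ?_
    · simp only [mem_sdiff, mem_Icc] at hm
      rw [show a + y - (m + y) = 0 by omega]; simp
    · rw [Nat.add_sub_add_right]
  have h3 : ∀ a : ℕ, 2 * ∑ m ∈ Icc 1 a, ((a - m : ℕ) : ℝ) = (a : ℝ) ^ 2 - a := by
    intro a
    induction a with
    | zero => simp
    | succ a ih =>
      rw [sum_Icc_succ_top (by omega)]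
      have : ∀ m ∈ Icc 1 a, ((a + 1 - m : ℕ) : ℝ) = ((a - m : ℕ) : ℝ) + 1 := by
        intro m hm
        rw [Nat.succ_sub (mem_Icc.1 hm).2]; push_cast; ring
      rw [sum_congr rfl this, sum_add_distrib, mul_add, mul_add, ih]
      simp; ring
  rw [h1, h2, h3]
  push_cast; ring

lemma abs_pairCount_sub_le {x Y : ℝ} (hx : 1 ≤ x) (hY : 0 ≤ Y) (hYx : Y ≤ x) :
    |2 * pairCount ⌊x⌋₊ ⌊Y⌋₊ - (x - Y) ^ 2| ≤ 4 * x := by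
  rw [two_mul_pairCount (Nat.floor_le_floor hYx)]
  have h1 := Nat.floor_le (by linarith : 0 ≤ x)
  have h2 := Nat.lt_floor_add_one x
  have h3 := Nat.floor_le hY
  have h4 := Nat.lt_floor_add_one Y
  have h5 : (⌊Y⌋₊ : ℝ) ≤ ⌊x⌋₊ := by exact_mod_cast Nat.floor_le_floor hYx
  set a : ℝ := ⌊x⌋₊ - ⌊Y⌋₊
  have ha0 : 0 ≤ a := by simp only [a]; linarith
  have ha1 : a ≤ x - Y + 1 := by simp only [a]; linarith
  have ha2 : x - Y - 1 ≤ a := by simp only [a]; linarith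
  have hb : 0 ≤ x - Y := by linarith
  rw [abs_le]
  constructor <;> nlinarith

/-! ### The error term of the variance -/

lemma exists_hSum_le_rpow {ε : ℝ} (hε : 0 < ε) : ∃ C : ℝ, 0 < C ∧ ∀ (L : ℕ) (x : ℝ), 1 ≤ x →
    (L : ℝ) ≤ x → ∑ l ∈ Icc 1 L, hFun l / l ≤ C * x ^ ε := by
  obtain ⟨C1, hC1, h1⟩ := exists_hSum_le
  obtain ⟨C2, hC2, h2⟩ := one_add_log_pow_le hε 1
  refine ⟨C1 * C2, by positivity, fun L x hx hL => ?_⟩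
  have h3 := h2 x hx
  rw [pow_one] at h3
  have h4 : 1 + Real.log L ≤ 1 + Real.log x := by
    rcases Nat.eq_zero_or_pos L with rfl | hL0
    · simp [Real.log_nonneg hx]
    · have := Real.log_le_log (by exact_mod_cast hL0) hL; linarith
  calc _ ≤ C1 * (1 + Real.log L) := h1 L
    _ ≤ C1 * (C2 * x ^ ε) := mul_le_mul_of_nonneg_left (h4.trans h3) hC1.le
    _ = _ := by ring

lemma hFun_nonneg (l : ℕ) : 0 ≤ hFun l := by
  rw [hFun_eq]; exact sum_nonneg fun q _ => gq_nonneg q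

/-- Correlations in residue classes with real cut-offs. -/
lemma exists_abs_sum_pairSum_sub_le {ε : ℝ} (hε : 0 < ε) : ∃ C : ℝ, 0 < C ∧
    ∀ (x R : ℝ) (L : ℕ) (Y : ℕ → ℝ), 1 ≤ x → 1 ≤ L → L ^ 2 ≤ ⌊x⌋₊ → 1 ≤ R → R ^ 2 ≤ ⌊x⌋₊ →
      (∀ l ∈ Icc 1 L, 0 ≤ Y l ∧ Y l ≤ x) →
      |2 * ∑ l ∈ Icc 1 L, pairSum ⌊x⌋₊ l ⌊Y l⌋₊
          - gam ^ 2 * ∑ l ∈ Icc 1 L, hFun l / l * (x - Y l) ^ 2|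
        ≤ C * x ^ ε * (errBound ⌊x⌋₊ R + x) := by
  obtain ⟨C1, hC1, h1⟩ := exists_sum_abs_pairSum_sub_le hε
  obtain ⟨C2, hC2, h2⟩ := exists_hSum_le_rpow hε
  have hg := gam_pos
  refine ⟨2 * C1 + 4 * gam ^ 2 * C2, by positivity, fun x R L Y hx hL hLX hR hRX hY => ?_⟩
  set X := ⌊x⌋₊ with hX
  have hXx : (X : ℝ) ≤ x := Nat.floor_le (by linarith)
  have hR0 : 0 < R := by linarith
  obtain ⟨-, -, -, hE0⟩ := errBound_parts (X := X) hR0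
  have hLx : (L : ℝ) ≤ x := by
    refine le_trans ?_ hXx
    have : L ≤ X := le_trans (by nlinarith) hLX
    exact_mod_cast this
  have k1 := h1 X L R (fun l => ⌊Y l⌋₊) hL hLX hR hRX
  have k2 := h2 L x hx hLx
  have e1 : 2 * ∑ l ∈ Icc 1 L, pairSum X l ⌊Y l⌋₊
          - gam ^ 2 * ∑ l ∈ Icc 1 L, hFun l / l * (x - Y l) ^ 2
      = ∑ l ∈ Icc 1 L, (2 * (pairSum X l ⌊Y l⌋₊ - gam ^ 2 * (hFun l / l) * pairCount X ⌊Y l⌋₊)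
        + gam ^ 2 * (hFun l / l) * (2 * pairCount X ⌊Y l⌋₊ - (x - Y l) ^ 2)) := by
    rw [mul_sum, mul_sum, ← sum_sub_distrib]
    exact sum_congr rfl fun l _ => by ring
  rw [e1]
  have h3 : ∀ l ∈ Icc 1 L, |2 * (pairSum X l ⌊Y l⌋₊
        - gam ^ 2 * (hFun l / l) * pairCount X ⌊Y l⌋₊)
        + gam ^ 2 * (hFun l / l) * (2 * pairCount X ⌊Y l⌋₊ - (x - Y l) ^ 2)|
      ≤ 2 * |pairSum X l ⌊Y l⌋₊ - gam ^ 2 * (hFun l / l) * pairCount X ⌊Y l⌋₊|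
        + gam ^ 2 * (hFun l / l) * (4 * x) := by
    intro l hl
    have hh := hFun_nonneg l
    refine (abs_add_le _ _).trans (add_le_add (by rw [abs_mul, abs_two]) ?_)
    rw [abs_mul, abs_of_nonneg (by positivity : 0 ≤ gam ^ 2 * (hFun l / l))]
    exact mul_le_mul_of_nonneg_left (abs_pairCount_sub_le hx (hY l hl).1 (hY l hl).2)
      (by positivity)
  refine (abs_sum_le_sum_abs _ _).trans ((sum_le_sum h3).trans ?_)
  rw [sum_add_distrib, ← mul_sum, ← sum_mul, ← mul_sum]
  have hXε : (X : ℝ) ^ ε ≤ x ^ ε := Real.rpow_le_rpow (by positivity) hXx hε.le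
  have hx0 : 0 < x := by linarith
  calc _ ≤ 2 * (C1 * (X : ℝ) ^ ε * errBound X R) + gam ^ 2 * (C2 * x ^ ε) * (4 * x) := by
        gcongr
    _ ≤ 2 * (C1 * x ^ ε * errBound X R) + gam ^ 2 * (C2 * x ^ ε) * (4 * x) := by gcongr
    _ ≤ _ := by
        have a1 : 0 ≤ C1 * x ^ ε * x := by positivity
        have a2 : 0 ≤ gam ^ 2 * (C2 * x ^ ε) * errBound X R := by positivity
        nlinarith

-- After the switch at Q and at √x, the error term is an exact sum of small pieces: three
-- correlation sums to moduli at most √x, the cross term, the rounding of Q and of x, and the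
-- difference between the sums of h(l)/l and their asymptotic value.
set_option maxHeartbeats 1000000 in
theorem exists_abs_errorU0_le_errBound {ε : ℝ} (hε : 0 < ε) : ∃ C : ℝ, 0 < C ∧
    ∀ (x R : ℝ), 1 ≤ x → 1 ≤ R → R ^ 2 ≤ ⌊x⌋₊ → ∀ k : ℕ, 1 ≤ k → ∀ Q : ℝ,
      x / ((k : ℝ) + 1) < Q → Q ≤ x / k → Real.sqrt x ≤ Q →
        |errorU0 k x Q| ≤ C * x ^ ε * errBound ⌊x⌋₊ R := by
  obtain ⟨C1, hC1, h1⟩ := exists_abs_sum_pairSum_sub_le hε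
  obtain ⟨C2, hC2, h2⟩ := exists_hSum_le_rpow hε
  obtain ⟨C3, hC3, h3⟩ := exists_abs_sum_r3_rho_sub_le hε
  obtain ⟨C4, hC4, h4⟩ := exists_abs_main_sub_le hε
  have hg := gam_pos
  refine ⟨1 + 15 * C1 + 4 * gam * C3 + 8 * gam ^ 2 * C2 + 4 * gam ^ 2 * C4, by positivity,
    fun x R hx hR hRX k hk Q hQ1 hQ2 hQ3 => ?_⟩
  set X := ⌊x⌋₊ with hXd
  have hx0 : 0 < x := by linarith
  have hXx : (X : ℝ) ≤ x := Nat.floor_le hx0.le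
  have hxX : x < X + 1 := Nat.lt_floor_add_one x
  have hX1 : 1 ≤ X := Nat.le_floor (by exact_mod_cast hx)
  have hX1' : (1 : ℝ) ≤ X := by exact_mod_cast hX1
  have hx2X : x ≤ 2 * X := by linarith
  have hR0 : 0 < R := by linarith
  have hk' : (1 : ℝ) ≤ k := by exact_mod_cast hk
  obtain ⟨hE1, hE2, hE3, hE0⟩ := errBound_parts (X := X) hR0
  have hE4 := rpow_mul_le_errBound (X := X) hR
  set E := errBound X R with hE
  set s := Real.sqrt x with hs
  have hs1 : 1 ≤ s := Real.one_le_sqrt.2 hx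
  have hss : s * s = x := Real.mul_self_sqrt hx0.le
  have hQ0 : 0 < Q := by linarith
  have hkQ : k * Q ≤ x := by
    rw [le_div_iff₀ (by linarith)] at hQ2; linarith
  have hkQ' : x < (k + 1) * Q := by
    rw [div_lt_iff₀ (by linarith)] at hQ1; linarith
  set L := ⌊s⌋₊ with hL
  have hLs : (L : ℝ) ≤ s := Nat.floor_le (by linarith)
  have hsL : s < L + 1 := Nat.lt_floor_add_one s
  have hL1 : 1 ≤ L := Nat.le_floor (by exact_mod_cast hs1)
  have hLX : L ^ 2 ≤ X := by
    refine Nat.le_floor ?_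
    push_cast
    calc (L : ℝ) ^ 2 ≤ s ^ 2 := by gcongr
      _ = x := by rw [sq, hss]
  have hks : (k : ℝ) ≤ s := by
    have : (k : ℝ) * s ≤ s * s := by nlinarith
    exact le_of_mul_le_mul_right this (by linarith)
  have hkL : k ≤ L := Nat.le_floor hks
  have hkX : k ^ 2 ≤ X := (Nat.pow_le_pow_left hkL 2).trans hLX
  have hQx : Q ≤ x := by nlinarith
  have hQX : ⌊Q⌋₊ ≤ X := Nat.floor_le_floor hQx
  -- sizes
  have hxε : 1 ≤ x ^ ε := Real.one_le_rpow hx hε.le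
  have hx32 : x ^ (3 / 2 : ℝ) ≤ 4 * E := by
    have a1 : x ^ (3 / 2 : ℝ) ≤ (2 * X : ℝ) ^ (3 / 2 : ℝ) :=
      Real.rpow_le_rpow hx0.le hx2X (by norm_num)
    have a2 : (2 * X : ℝ) ^ (3 / 2 : ℝ) = 2 ^ (3 / 2 : ℝ) * (X : ℝ) ^ (3 / 2 : ℝ) :=
      Real.mul_rpow (by norm_num) (by positivity)
    have a3 : (2 : ℝ) ^ (3 / 2 : ℝ) ≤ 4 := by
      calc (2 : ℝ) ^ (3 / 2 : ℝ) ≤ (2 : ℝ) ^ (2 : ℝ) :=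
            Real.rpow_le_rpow_of_exponent_le (by norm_num) (by norm_num)
        _ = 4 := by norm_num
    have a4 : (X : ℝ) ^ (3 / 2 : ℝ) ≤ E :=
      le_trans (le_mul_of_one_le_right (by positivity) hR) hE4
    rw [a2] at a1
    refine a1.trans ?_
    have : 0 ≤ (X : ℝ) ^ (3 / 2 : ℝ) := by positivity
    nlinarith
  have hxE : x ≤ 4 * E := by
    refine le_trans ?_ hx32
    calc x = x ^ (1 : ℝ) := (Real.rpow_one x).symm
      _ ≤ _ := Real.rpow_le_rpow_of_exponent_le hx (by norm_num)
  have hME : sumSq x ≤ E := by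
    refine le_trans ?_ hE3
    have : 1 ≤ X / R := by
      rw [one_le_div hR0]; nlinarith
    exact le_mul_of_one_le_left (sqTot_nonneg X) this
  have hM0 : 0 ≤ sumSq x := sqTot_nonneg X
  -- the pieces
  have b1 := h1 x R L (fun _ => 0) hx hL1 hLX hR hRX fun _ _ => ⟨le_rfl, hx0.le⟩
  have b2 := h1 x R L (fun l => l * s) hx hL1 hLX hR hRX fun l hl => ⟨by positivity, by
    have : (l : ℝ) ≤ L := by exact_mod_cast (mem_Icc.1 hl).2
    rw [← hss]
    exact mul_le_mul_of_nonneg_right (this.trans hLs) (by linarith)⟩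
  have b3 := h1 x R k (fun l => l * Q) hx hk hkX hR hRX fun l hl => ⟨by positivity, by
    have : (l : ℝ) ≤ k := by exact_mod_cast (mem_Icc.1 hl).2
    exact (mul_le_mul_of_nonneg_right this hQ0.le).trans hkQ⟩
  -- Subtracting the two switches eliminates the sum over all moduli up to X.
  have sw1 := sum_pairSum_switch (X := X) (K := k) hQ0 (lt_of_le_of_lt hXx hkQ')
  have sw2 := sum_pairSum_switch (X := X) (K := L) (Q := s) (by linarith)
    (by nlinarith)
  have e2 := h3 X ⌊Q⌋₊ R hQX hR hRX
  have mn := h4 x Q hx hQ3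
  have hW := h2 ⌊Q⌋₊ x hx ((Nat.floor_le hQ0.le).trans hQx)
  set W := ∑ l ∈ Icc 1 ⌊Q⌋₊, hFun l / l with hWd
  have hW0 : 0 ≤ W := sum_nonneg fun l _ => div_nonneg (hFun_nonneg l) (Nat.cast_nonneg l)
  set A := ∑ q ∈ Icc 1 ⌊Q⌋₊, ∑ n ∈ Icc 1 X, (r3 n : ℝ) * (rho q n / (q : ℝ) ^ 3) with hA
  rw [sum_sub_distrib, ← mul_sum, ← hA, ← hWd] at e2
  set W1 := hSum (fun _ => 1) s with hW1
  set W2 := hSum (fun t => (1 - t) ^ 2) s with hW2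
  have hWQ : hSum (fun _ => 1) Q = W := by simp [hSum, hWd]
  rw [hWQ] at mn
  have i1 : ∑ l ∈ Icc 1 L, hFun l / l * (x - (fun _ : ℕ => (0 : ℝ)) l) ^ 2 = x ^ 2 * W1 := by
    rw [hW1, hSum, mul_sum]
    exact sum_congr rfl fun l _ => by simp; ring
  have i2 : ∑ l ∈ Icc 1 L, hFun l / l * (x - (fun l : ℕ => l * s) l) ^ 2 = x ^ 2 * W2 := by
    rw [hW2, hSum, mul_sum]
    refine sum_congr rfl fun l _ => ?_
    have : x - l * s = x * (1 - l / s) := by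
      rw [← hss]; field_simp
    simp only [this]; ring
  rw [i1] at b1
  rw [i2] at b2
  simp only [Nat.floor_zero] at b1
  set P0 := ∑ l ∈ Icc 1 L, pairSum X l 0 with hP0
  set P1 := ∑ l ∈ Icc 1 L, pairSum X l ⌊l * s⌋₊ with hP1
  set P2 := ∑ l ∈ Icc 1 k, pairSum X l ⌊l * Q⌋₊ with hP2
  set P := ∑ q ∈ Icc 1 ⌊Q⌋₊, pairSum X q 0 with hP
  set Z := ∑ l ∈ Icc 1 k, hFun l / l * (x - l * Q) ^ 2 with hZ
  have hPP : P = P0 + P1 - P2 := by linarith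
  have hV : variance3 x Q = ⌊Q⌋₊ * sumSq x + 2 * P - 2 * (gam * x) * A + (gam * x) ^ 2 * W := by
    rw [variance3_eq]
    simp only [sum_add_distrib, sum_sub_distrib, ← mul_sum, sum_const, Nat.card_Icc, nsmul_eq_mul,
      Nat.add_sub_cancel]
    rfl
  -- The cross term is expanded around its mean with X in place of x, which leaves the small
  -- multiple of (x - X) W. Twice its main part against the square of the expected value is the -W
  -- among the main terms.
  have hU : errorU0 k x Q = (⌊Q⌋₊ - Q) * sumSq x + (2 * P0 - gam ^ 2 * (x ^ 2 * W1))
      + (2 * P1 - gam ^ 2 * (x ^ 2 * W2)) - (2 * P2 - gam ^ 2 * Z)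
      - 2 * gam * (x * (A - gam * X * W)) + 2 * gam ^ 2 * (x * ((x - X) * W))
      + gam ^ 2 * (x ^ 2 * (W1 + W2 - W
        - (cZero * Real.log (x / Q) + cZero * constC2 - cOne))) := by
    rw [errorU0, hV, constC0_eq, constC1_eq, gam_sq, hPP, ← hZ]
    ring
  have c0 : |(⌊Q⌋₊ - Q) * sumSq x| ≤ x ^ ε * E := by
    rw [abs_mul, abs_of_nonneg hM0]
    have f1 := Nat.floor_le hQ0.le
    have f2 := Nat.lt_floor_add_one Q
    have : |(⌊Q⌋₊ : ℝ) - Q| ≤ 1 := by rw [abs_le]; constructor <;> linarith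
    calc _ ≤ 1 * sumSq x := by gcongr
      _ ≤ x ^ ε * E := by gcongr
  have hT0 : 0 ≤ C1 * x ^ ε := by positivity
  have c1 : C1 * x ^ ε * (E + x) ≤ 5 * C1 * (x ^ ε * E) := by
    calc _ ≤ C1 * x ^ ε * (E + 4 * E) := by gcongr
      _ = _ := by ring
  have c2 : |2 * gam * (x * (A - gam * X * W))| ≤ 4 * gam * C3 * (x ^ ε * E) := by
    rw [abs_mul, abs_of_pos (by positivity : 0 < 2 * gam), abs_mul, abs_of_pos hx0]
    have hXε : (X : ℝ) ^ ε ≤ x ^ ε := Real.rpow_le_rpow (by positivity) hXx hε.le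
    calc _ ≤ 2 * gam * (2 * X * |A - gam * X * W|) := by gcongr
      _ = 4 * gam * (X * |A - gam * X * W|) := by ring
      _ ≤ 4 * gam * (C3 * (X : ℝ) ^ ε * E) := by gcongr
      _ ≤ 4 * gam * (C3 * x ^ ε * E) := by gcongr
      _ = _ := by ring
  have c3 : |2 * gam ^ 2 * (x * ((x - X) * W))| ≤ 8 * gam ^ 2 * C2 * (x ^ ε * E) := by
    have hxX0 : 0 ≤ x - X := by linarith
    rw [abs_of_nonneg (by positivity)]
    calc _ ≤ 2 * gam ^ 2 * ((4 * E) * (1 * (C2 * x ^ ε))) := by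
          gcongr
          linarith
      _ = _ := by ring
  have c4 : |gam ^ 2 * (x ^ 2 * (W1 + W2 - W
        - (cZero * Real.log (x / Q) + cZero * constC2 - cOne)))|
      ≤ 4 * gam ^ 2 * C4 * (x ^ ε * E) := by
    rw [abs_mul, abs_of_pos (by positivity : 0 < gam ^ 2), abs_mul,
      abs_of_pos (by positivity : 0 < x ^ 2)]
    have e5 : x ^ 2 * x ^ (-(1 / 2 : ℝ) + ε) = x ^ (3 / 2 : ℝ) * x ^ ε := by
      rw [← Real.rpow_natCast, ← Real.rpow_add hx0, ← Real.rpow_add hx0]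
      congr 1; push_cast; ring
    calc _ ≤ gam ^ 2 * (x ^ 2 * (C4 * x ^ (-(1 / 2 : ℝ) + ε))) := by gcongr
      _ = gam ^ 2 * C4 * (x ^ 2 * x ^ (-(1 / 2 : ℝ) + ε)) := by ring
      _ = gam ^ 2 * C4 * (x ^ (3 / 2 : ℝ) * x ^ ε) := by rw [e5]
      _ ≤ gam ^ 2 * C4 * (4 * E * x ^ ε) := by gcongr
      _ = _ := by ring
  have tot : (1 + 15 * C1 + 4 * gam * C3 + 8 * gam ^ 2 * C2 + 4 * gam ^ 2 * C4) * x ^ ε * E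
      = x ^ ε * E + 5 * C1 * (x ^ ε * E) + 5 * C1 * (x ^ ε * E) + 5 * C1 * (x ^ ε * E)
        + 4 * gam * C3 * (x ^ ε * E) + 8 * gam ^ 2 * C2 * (x ^ ε * E)
        + 4 * gam ^ 2 * C4 * (x ^ ε * E) := by ring
  rw [hU, tot]
  have b1' := abs_le.1 (b1.trans c1)
  have b2' := abs_le.1 (b2.trans c1)
  have b3' := abs_le.1 (b3.trans c1)
  have c0' := abs_le.1 c0
  have c2' := abs_le.1 c2
  have c3' := abs_le.1 c3
  have c4' := abs_le.1 c4
  rw [abs_le]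
  constructor
  · linarith only [b1'.1, b2'.1, b3'.2, c0'.1, c2'.2, c3'.1, c4'.1]
  · linarith only [b1'.2, b2'.2, b3'.1, c0'.2, c2'.1, c3'.2, c4'.2]

/-! ### The size of the mean square -/

/-- Since r3 takes integer values, its square dominates it, and its sum is asymptotic to a positive
multiple of x. -/
lemma exists_le_sumSq : ∃ c X : ℝ, 0 < c ∧ 1 ≤ X ∧ ∀ x : ℝ, X ≤ x → c * x ≤ sumSq x := by
  obtain ⟨C, hC, h⟩ := exists_abs_sum_r3_sub_le
  have hg := gam_pos
  set Y := (2 * C / gam) ^ 3 + 1 with hY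
  have hY0 : 0 ≤ (2 * C / gam) ^ 3 := by positivity
  refine ⟨gam / 4, 2 * Y, by positivity, by linarith, fun x hx => ?_⟩
  set X := ⌊x⌋₊ with hX
  have hx0 : 0 < x := by linarith
  have hxX : x < X + 1 := Nat.lt_floor_add_one x
  have hXY : (2 * C / gam) ^ 3 ≤ X := by linarith
  have hX2 : x ≤ 2 * X := by linarith
  have hX0 : (0 : ℝ) < X := by linarith
  have h1 := (abs_le.1 (h X)).1
  have h2 : 2 * C / gam ≤ (X : ℝ) ^ (1 / 3 : ℝ) := by
    have := Real.rpow_le_rpow hY0 hXY (by norm_num : (0 : ℝ) ≤ 1 / 3)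
    rwa [← Real.rpow_natCast, ← Real.rpow_mul (by positivity), show ((3 : ℕ) : ℝ) * (1 / 3) = 1 by
      norm_num, Real.rpow_one] at this
  have h3 : C * (X : ℝ) ^ (2 / 3 : ℝ) ≤ gam / 2 * X := by
    have e : (X : ℝ) = (X : ℝ) ^ (1 / 3 : ℝ) * (X : ℝ) ^ (2 / 3 : ℝ) := by
      rw [← Real.rpow_add hX0]; norm_num
    rw [div_le_iff₀ hg] at h2
    calc C * (X : ℝ) ^ (2 / 3 : ℝ)
        ≤ ((X : ℝ) ^ (1 / 3 : ℝ) * gam / 2) * (X : ℝ) ^ (2 / 3 : ℝ) := by gcongr; linarith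
      _ = gam / 2 * ((X : ℝ) ^ (1 / 3 : ℝ) * (X : ℝ) ^ (2 / 3 : ℝ)) := by ring
      _ = _ := by rw [← e]
  have h4 : ∑ n ∈ Icc 1 X, (r3 n : ℝ) ≤ sumSq x := by
    refine sum_le_sum fun n _ => ?_
    have : r3 n ≤ r3 n ^ 2 := Nat.le_self_pow (by norm_num) _
    exact_mod_cast this
  nlinarith

lemma exists_sumSq_le {ε : ℝ} (hε : 0 < ε) : ∃ C : ℝ, 0 < C ∧ ∀ x : ℝ, 1 ≤ x →
    sumSq x ≤ C * x ^ (7 / 6 + ε) := by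
  obtain ⟨C, hC, h⟩ := exists_sum_r3_sq_le hε
  refine ⟨C, hC, fun x hx => (h ⌊x⌋₊ (Nat.le_floor (by exact_mod_cast hx))).trans ?_⟩
  have := Nat.floor_le (by linarith : 0 ≤ x)
  gcongr

open Filter in
lemma eventually_sumSq_pos : ∀ᶠ x : ℝ in atTop, 0 < sumSq x := by
  obtain ⟨c, X, hc, hX, h⟩ := exists_le_sumSq
  filter_upwards [eventually_ge_atTop X] with x hx
  exact lt_of_lt_of_le (by have : 0 < x := by linarith
                           positivity) (h x hx)

open Filter in
lemma tendsto_add_div_log (a b : ℝ) : Tendsto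
    (fun x : ℝ => ((a + b / Real.log x : ℝ) : EReal)) atTop (nhds (a : EReal)) := by
  refine (continuous_coe_real_ereal.tendsto a).comp ?_
  have := (Real.tendsto_log_atTop.const_div_atTop b).const_add a
  rwa [add_zero] at this

open Filter in
lemma one_le_lowerExponent : 1 ≤ lowerExponent := by
  obtain ⟨c, X, hc, hX, h⟩ := exists_le_sumSq
  have h1 := (tendsto_add_div_log 1 (Real.log c)).liminf_eq
  rw [EReal.coe_one] at h1
  rw [lowerExponent, ← h1]
  refine liminf_le_liminf ?_
  filter_upwards [eventually_ge_atTop X, eventually_gt_atTop 1] with x hx hx1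
  have hl := Real.log_pos hx1
  refine EReal.coe_le_coe_iff.2 ?_
  have h2 := Real.log_le_log (by positivity) (h x hx)
  rw [Real.log_mul hc.ne' (by linarith)] at h2
  rw [le_div_iff₀ hl, add_mul, div_mul_cancel₀ _ hl.ne']
  linarith

open Filter in
lemma lowerExponent_le_upperExponent : lowerExponent ≤ upperExponent :=
  liminf_le_limsup

open Filter in
lemma upperExponent_le_add {ε : ℝ} (hε : 0 < ε) : upperExponent ≤ ((7 / 6 + ε : ℝ) : EReal) := by
  obtain ⟨C, hC, h⟩ := exists_sumSq_le hε
  have h1 := (tendsto_add_div_log (7 / 6 + ε) (Real.log C)).limsup_eq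
  rw [upperExponent, ← h1]
  refine limsup_le_limsup ?_
  filter_upwards [eventually_gt_atTop 1, eventually_sumSq_pos] with x hx1 hp
  have hl := Real.log_pos hx1
  refine EReal.coe_le_coe_iff.2 ?_
  have hx0 : 0 < x := by linarith
  have h2 := Real.log_le_log hp (h x hx1.le)
  rw [Real.log_mul hC.ne' (by positivity), Real.log_rpow hx0] at h2
  rw [div_le_iff₀ hl, add_mul, div_mul_cancel₀ _ hl.ne']
  linarith

lemma coe_toReal_upperExponent : ((upperExponent.toReal : ℝ) : EReal) = upperExponent := by
  refine EReal.coe_toReal (fun h => ?_) (fun h => ?_)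
  · have := upperExponent_le_add one_pos
    rw [h, top_le_iff] at this
    exact EReal.coe_ne_top _ this
  · have := one_le_lowerExponent.trans lowerExponent_le_upperExponent
    rw [h, le_bot_iff] at this
    exact EReal.coe_ne_bot 1 (by rw [EReal.coe_one]; exact this)

lemma upperExponent_le : upperExponent ≤ ((7 / 6 : ℝ) : EReal) := by
  rw [← coe_toReal_upperExponent, EReal.coe_le_coe_iff]
  refine le_of_forall_pos_le_add fun ε hε => ?_
  have := upperExponent_le_add hε
  rwa [← coe_toReal_upperExponent, EReal.coe_le_coe_iff] at this

open Filter in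
lemma eventually_sumSq_le {ε : ℝ} (hε : 0 < ε) :
    ∀ᶠ x : ℝ in atTop, sumSq x ≤ x ^ (upperExponent.toReal + ε) := by
  have h1 : upperExponent < ((upperExponent.toReal + ε : ℝ) : EReal) := by
    conv_lhs => rw [← coe_toReal_upperExponent]
    exact EReal.coe_lt_coe_iff.2 (by linarith)
  have h2 := eventually_lt_of_limsup_lt h1
  filter_upwards [h2, eventually_gt_atTop 1, eventually_sumSq_pos] with x hx hx1 hp
  have hl := Real.log_pos hx1
  have h3 := EReal.coe_lt_coe_iff.1 hx
  rw [div_lt_iff₀ hl, ← Real.log_rpow (by linarith)] at h3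
  exact ((Real.log_lt_log_iff hp (by positivity)).1 h3).le

/-! ### The bound for the error term -/

open Filter in
theorem exists_abs_errorU0_le {ε : ℝ} (hε : 0 < ε) : ∃ C : ℝ, 0 < C ∧
    ∀ᶠ x : ℝ in atTop, ∀ k : ℕ, 1 ≤ k → ∀ Q : ℝ,
      x / ((k : ℝ) + 1) < Q → Q ≤ x / k → Real.sqrt x * Real.log x ≤ Q →
        |errorU0 k x Q| ≤ C * (x ^ (10 / 9 + ε) * sumSq x ^ (2 / 3 : ℝ)) := by
  obtain ⟨C, hC, h⟩ := exists_abs_errorU0_le_errBound hε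
  obtain ⟨c, X0, hc, hX0, hlow⟩ := exists_le_sumSq
  -- The crude exponent 4/3 already yields R² ≪ x^(2/3), ample for the condition R² ≤ ⌊x⌋.
  obtain ⟨C1, hC1, hup⟩ := exists_sumSq_le (ε := 1 / 6) (by norm_num)
  refine ⟨C * (2 + 1 / c), by positivity, ?_⟩
  have t1 : ∀ᶠ x : ℝ in atTop, 1 / c ≤ x ^ (2 / 3 : ℝ) :=
    (tendsto_rpow_atTop (by norm_num)).eventually_ge_atTop _
  have t2 : ∀ᶠ x : ℝ in atTop, 2 * C1 ^ (2 / 3 : ℝ) ≤ x ^ (1 / 3 : ℝ) :=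
    (tendsto_rpow_atTop (by norm_num)).eventually_ge_atTop _
  have t3 : ∀ᶠ x : ℝ in atTop, 1 ≤ Real.log x := Real.tendsto_log_atTop.eventually_ge_atTop _
  filter_upwards [t1, t2, t3, eventually_ge_atTop X0] with x ht1 ht2 ht3 hxX0 k hk Q hQ1 hQ2 hQ3
  have hx1 : 1 ≤ x := hX0.trans hxX0
  have hx0 : 0 < x := by linarith
  set M := sumSq x with hM
  have hMlow := hlow x hxX0
  have hM0 : 0 < M := lt_of_lt_of_le (by positivity) hMlow
  have hMup := hup x hx1
  -- The solution of x^(4/3) R² = (x/R) M, where both sides equal x^(10/9) M^(2/3).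
  set R := M ^ (1 / 3 : ℝ) * x ^ (-(1 / 9) : ℝ) with hRd
  have hRsq : R ^ 2 = M ^ (2 / 3 : ℝ) * x ^ (-(2 / 9) : ℝ) := by
    rw [hRd, mul_pow, ← Real.rpow_natCast, ← Real.rpow_mul hM0.le, ← Real.rpow_natCast,
      ← Real.rpow_mul hx0.le]; norm_num
  have hR : 1 ≤ R := by
    have a1 : x ^ (1 / 3 : ℝ) ≤ M := by
      refine le_trans ?_ hMlow
      calc x ^ (1 / 3 : ℝ) = c * (1 / c) * x ^ (1 / 3 : ℝ) := by
            rw [mul_one_div_cancel hc.ne', one_mul]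
        _ ≤ c * x ^ (2 / 3 : ℝ) * x ^ (1 / 3 : ℝ) := by gcongr
        _ = c * x := by
            rw [mul_assoc, ← Real.rpow_add hx0]; norm_num
    calc (1 : ℝ) = (x ^ (1 / 3 : ℝ)) ^ (1 / 3 : ℝ) * x ^ (-(1 / 9) : ℝ) := by
          rw [← Real.rpow_mul hx0.le, ← Real.rpow_add hx0]; norm_num
      _ ≤ R := by rw [hRd]; gcongr
  have hR0 : 0 < R := by linarith
  have hfl : x / 2 ≤ (⌊x⌋₊ : ℝ) := by
    have a1 := Nat.lt_floor_add_one x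
    have a2 : (1 : ℝ) ≤ ⌊x⌋₊ := by exact_mod_cast Nat.le_floor (by exact_mod_cast hx1)
    linarith
  have hRX : R ^ 2 ≤ (⌊x⌋₊ : ℝ) := by
    refine le_trans ?_ hfl
    rw [hRsq]
    calc M ^ (2 / 3 : ℝ) * x ^ (-(2 / 9) : ℝ)
        ≤ (C1 * x ^ (7 / 6 + 1 / 6 : ℝ)) ^ (2 / 3 : ℝ) * x ^ (-(2 / 9) : ℝ) := by gcongr
      _ = C1 ^ (2 / 3 : ℝ) * x ^ (2 / 3 : ℝ) := by
          rw [Real.mul_rpow hC1.le (by positivity), ← Real.rpow_mul hx0.le, mul_assoc,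
            ← Real.rpow_add hx0]; norm_num
      _ ≤ (x ^ (1 / 3 : ℝ) / 2) * x ^ (2 / 3 : ℝ) := by gcongr; linarith
      _ = x / 2 := by
          rw [div_mul_eq_mul_div, ← Real.rpow_add hx0]; norm_num
  have hs : Real.sqrt x ≤ Q :=
    le_trans (le_mul_of_one_le_right (Real.sqrt_nonneg x) ht3) hQ3
  refine (h x R hx1 hR hRX k hk Q hQ1 hQ2 hs).trans ?_
  have hXx : (⌊x⌋₊ : ℝ) ≤ x := Nat.floor_le hx0.le
  have hE : errBound ⌊x⌋₊ R ≤ (2 + 1 / c) * (x ^ (10 / 9 : ℝ) * M ^ (2 / 3 : ℝ)) := by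
    have g1 : x ^ (4 / 3 : ℝ) * R ^ 2 = x ^ (10 / 9 : ℝ) * M ^ (2 / 3 : ℝ) := by
      rw [hRsq, mul_left_comm, ← Real.rpow_add hx0, mul_comm]; norm_num
    have g2 : x / R * M = x ^ (10 / 9 : ℝ) * M ^ (2 / 3 : ℝ) := by
      have a1 : x ^ (10 / 9 : ℝ) * x ^ (-(1 / 9) : ℝ) = x := by
        rw [← Real.rpow_add hx0]; norm_num
      have a2 : M ^ (2 / 3 : ℝ) * M ^ (1 / 3 : ℝ) = M := by
        rw [← Real.rpow_add hM0]; norm_num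
      rw [div_mul_eq_mul_div, div_eq_iff hR0.ne', hRd]
      calc x * M = (x ^ (10 / 9 : ℝ) * x ^ (-(1 / 9) : ℝ)) *
            (M ^ (2 / 3 : ℝ) * M ^ (1 / 3 : ℝ)) := by rw [a1, a2]
        _ = _ := by ring
    -- The lower bound x ≪ M makes the singular series term no larger than the minor-arc term.
    have g3 : x ^ 2 / R ≤ 1 / c * (x / R * M) := by
      have : x ≤ 1 / c * M := by
        rw [one_div_mul_eq_div, le_div_iff₀ hc]; linarith
      calc x ^ 2 / R = x / R * x := by ring
        _ ≤ x / R * (1 / c * M) := by gcongr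
        _ = _ := by ring
    have g4 : errBound ⌊x⌋₊ R ≤ x ^ (4 / 3 : ℝ) * R ^ 2 + x ^ 2 / R + x / R * M := by
      rw [errBound]
      have : sqTot ⌊x⌋₊ = M := rfl
      rw [this]
      gcongr
    rw [g2] at g3 g4
    rw [g1] at g4
    refine g4.trans ?_
    rw [add_mul]; linarith
  calc C * x ^ ε * errBound ⌊x⌋₊ R
      ≤ C * x ^ ε * ((2 + 1 / c) * (x ^ (10 / 9 : ℝ) * M ^ (2 / 3 : ℝ))) := by gcongr
    _ = _ := by rw [Real.rpow_add hx0]; ring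

end

end CubeVar

/-! ### Absolute convergence, the range of the exponents, and the three bounds. -/

theorem theorem2 :
    -- the series and the integral that define the constants converge absolutely
    Summable (fun q : ℕ => 1 / (q : ℝ) ^ 7 * gaussSixth q) ∧
    Summable (fun q : ℕ => Real.log (q : ℝ) / (q : ℝ) ^ 7 * gaussSixth q) ∧
    MeasureTheory.IntegrableOn (fun u : ℝ => bernoulliHalf u / u ^ 3) (Set.Ioi (1 : ℝ)) ∧
    -- the exponents are finite
    (1 ≤ lowerExponent ∧ lowerExponent ≤ upperExponent ∧
      upperExponent ≤ ((7 / 6 : ℝ) : EReal)) ∧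
    -- the bounds for the error term
    ∀ ε : ℝ, 0 < ε →
      (∃ C X : ℝ, ∀ x : ℝ, X ≤ x → ∀ k : ℕ, 1 ≤ k → ∀ Q : ℝ,
        x / ((k : ℝ) + 1) < Q → Q ≤ x / (k : ℝ) → Real.sqrt x * Real.log x ≤ Q →
          |errorU0 k x Q| ≤ C * x ^ ((10 / 9 : ℝ) + 2 / 3 * upperExponent.toReal + ε)) ∧
      (lowerExponent = upperExponent →
        ∃ C X : ℝ, ∀ x : ℝ, X ≤ x → ∀ k : ℕ, 1 ≤ k → ∀ Q : ℝ,
          x / ((k : ℝ) + 1) < Q → Q ≤ x / (k : ℝ) → Real.sqrt x * Real.log x ≤ Q →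
            |errorU0 k x Q| ≤ C * (x ^ ((10 / 9 : ℝ) + ε) * sumSq x ^ (2 / 3 : ℝ))) ∧
      (∃ C X : ℝ, ∀ x : ℝ, X ≤ x → ∀ k : ℕ, 1 ≤ k → ∀ Q : ℝ,
        x / ((k : ℝ) + 1) < Q → Q ≤ x / (k : ℝ) → Real.sqrt x * Real.log x ≤ Q →
          |errorU0 k x Q| ≤ C * x ^ ((17 / 9 : ℝ) + ε)) := by
  refine ⟨?_, ?_, CubeVar.integrableOn_bernoulliHalf, ⟨CubeVar.one_le_lowerExponent,
    CubeVar.lowerExponent_le_upperExponent, CubeVar.upperExponent_le⟩, fun ε hε => ⟨?_, ?_, ?_⟩⟩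
  · simp only [CubeVar.term_zero_eq]; exact CubeVar.summable_gq_div
  · simp only [CubeVar.term_one_eq]; exact CubeVar.summable_gq_mul_log
  · obtain ⟨C, hC, h⟩ := CubeVar.exists_abs_errorU0_le (half_pos hε)
    obtain ⟨X, hX⟩ := Filter.eventually_atTop.1 ((h.and (CubeVar.eventually_sumSq_le (half_pos hε))).and
      (Filter.eventually_ge_atTop 1))
    refine ⟨C, X, fun x hx k hk Q hQ1 hQ2 hQ3 => ?_⟩
    obtain ⟨⟨h1, h2⟩, h3⟩ := hX x hx
    have hx0 : 0 < x := by linarith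
    refine (h1 k hk Q hQ1 hQ2 hQ3).trans (mul_le_mul_of_nonneg_left ?_ hC.le)
    calc x ^ (10 / 9 + ε / 2) * sumSq x ^ (2 / 3 : ℝ)
        ≤ x ^ (10 / 9 + ε / 2) * (x ^ (upperExponent.toReal + ε / 2)) ^ (2 / 3 : ℝ) := by
          have := CubeVar.sqTot_nonneg ⌊x⌋₊
          change 0 ≤ sumSq x at this
          gcongr
      _ = x ^ (10 / 9 + ε / 2 + (upperExponent.toReal + ε / 2) * (2 / 3)) := by
          rw [← Real.rpow_mul hx0.le, ← Real.rpow_add hx0]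
      _ ≤ _ := Real.rpow_le_rpow_of_exponent_le h3 (by linarith)
  · intro _
    obtain ⟨C, hC, h⟩ := CubeVar.exists_abs_errorU0_le hε
    obtain ⟨X, hX⟩ := Filter.eventually_atTop.1 h
    exact ⟨C, X, hX⟩
  · obtain ⟨C, hC, h⟩ := CubeVar.exists_abs_errorU0_le (half_pos hε)
    obtain ⟨C1, hC1, hup⟩ := CubeVar.exists_sumSq_le (half_pos hε)
    obtain ⟨X, hX⟩ := Filter.eventually_atTop.1 (h.and (Filter.eventually_ge_atTop 1))
    refine ⟨C * C1 ^ (2 / 3 : ℝ), X, fun x hx k hk Q hQ1 hQ2 hQ3 => ?_⟩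
    obtain ⟨h1, h3⟩ := hX x hx
    have hx0 : 0 < x := by linarith
    refine (h1 k hk Q hQ1 hQ2 hQ3).trans ?_
    rw [mul_assoc]
    refine mul_le_mul_of_nonneg_left ?_ hC.le
    -- Here 10/9 + (2/3)(7/6) = 17/9, and the losses ε/2 + ε/3 stay below ε.
    calc x ^ (10 / 9 + ε / 2) * sumSq x ^ (2 / 3 : ℝ)
        ≤ x ^ (10 / 9 + ε / 2) * (C1 * x ^ (7 / 6 + ε / 2)) ^ (2 / 3 : ℝ) := by
          have := CubeVar.sqTot_nonneg ⌊x⌋₊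
          change 0 ≤ sumSq x at this
          have := hup x h3
          gcongr
      _ = C1 ^ (2 / 3 : ℝ) * x ^ (10 / 9 + ε / 2 + (7 / 6 + ε / 2) * (2 / 3)) := by
          rw [Real.mul_rpow hC1.le (by positivity), ← Real.rpow_mul hx0.le, mul_left_comm,
            ← Real.rpow_add hx0]
      _ ≤ _ := by
          refine mul_le_mul_of_nonneg_left
            (Real.rpow_le_rpow_of_exponent_le h3 (by linarith)) (by positivity)
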